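/- Let $G$ be a finite connected bridgeless cubic graph (parallel edges allowed) with $n\ge 4$ vertices, cellularly embedded (that is, every face is an open disk) in a closed surface, orientable or not, of Euler characteristic $\chi$. The representativity of the embedding is the least number of points of the embedded graph that lie on a simple closed curve in the surface whose complement is connected (it is $\infty$ if the surface is a sphere, where there is no such curve). Suppose that the representativity is at least $4$. A circuit double cover of $G$ is a multiset of circuits (connected $2$-regular subgraphs) of $G$ such that every edge of $G$ is contained in exactly two of its elements, counted with multiplicity. Then $G$ has at least $$2^{\sqrt[3]{n+2\chi}\,/100}$$ circuit double covers. -/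

import Mathlib

open scoped Graph

namespace Graph

variable {α β : Type*}

/-- A graph (loops and parallel edges allowed) is connected if it has a vertex and any two
vertices are joined by a walk. -/
def IsConnected (G : Graph α β) : Prop :=
  V(G).Nonempty ∧ ∀ x ∈ V(G), ∀ y ∈ V(G), Relation.ReflTransGen G.Adj x y

/-- The degree of a vertex: the number of edge ends at it (a loop counts twice). -/
noncomputable def deg (G : Graph α β) (x : α) : ℕ∞ :=
  (G.incidenceSet x).encard + (G.loopSet x).encard

/-- Every vertex has degree `3`. -/
def IsCubic (G : Graph α β) : Prop :=
  ∀ x ∈ V(G), G.deg x = 3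

/-- An edge is a bridge if its ends are in different components after its deletion. -/
def IsBridge (G : Graph α β) (e : β) : Prop :=
  ∃ x y, G.IsLink e x y ∧ ¬ Relation.ReflTransGen (G.deleteEdges {e}).Adj x y

/-- No edge is a bridge. -/
def IsBridgeless (G : Graph α β) : Prop :=
  ∀ e, ¬ G.IsBridge e

/-- A circuit of `G`: a finite connected subgraph in which every vertex has degree `2`. -/
structure IsCircuitOf (C G : Graph α β) : Prop where
  le : C ≤ G
  finite : V(C).Finite
  connected : C.IsConnected
  deg_eq_two : ∀ x ∈ V(C), C.deg x = 2

open Classical in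
/-- A circuit double cover of `G`: a multiset of circuits of `G` such that every edge of `G` is
contained in exactly two elements of it (counted with multiplicity). -/
def IsCircuitDoubleCover (G : Graph α β) (𝒞 : Multiset (Graph α β)) : Prop :=
  (∀ C ∈ 𝒞, C.IsCircuitOf G) ∧ ∀ e ∈ E(G), 𝒞.countP (fun C => e ∈ E(C)) = 2

/-- The number of circuit double covers of `G`. -/
noncomputable def numCircuitDoubleCovers (G : Graph α β) : ℕ :=
  {𝒞 : Multiset (Graph α β) | G.IsCircuitDoubleCover 𝒞}.ncard

end Graph

/-- A cellular embedding of a graph `G` (without isolated vertices) in a closed surface,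
orientable or not, given by its flags. A flag is a triangle of the barycentric subdivision of the
surface; its three corners are a vertex, (the midpoint of) an edge and (the centre of) a face.
Every flag has exactly one neighbour across each of its three sides:
* `flipVert x` has the same edge and the same face as `x`, and the other end of the edge,
* `flipEdge x` has the same vertex and the same face as `x`, and the next edge of the face there,
* `flipFace x` has the same vertex and the same edge as `x`, and the other side of the edge.
The four flags around an edge are `x`, `flipVert x`, `flipFace x`, `flipVert (flipFace x)`; the
flags around a vertex form an orbit of `flipEdge` and `flipFace`, and the flags of a face form an
orbit of `flipVert` and `flipEdge`. -/
structure SurfaceEmbedding {α β : Type*} (G : Graph α β) (F : Type*) where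
  /-- the vertex of a flag -/
  vert : F → α
  /-- the edge of a flag -/
  edge : F → β
  /-- the neighbour across the side from the edge to the face -/
  flipVert : F → F
  /-- the neighbour across the side from the vertex to the face -/
  flipEdge : F → F
  /-- the neighbour across the side from the vertex to the edge -/
  flipFace : F → F
  flipVert_invol : Function.Involutive flipVert
  flipEdge_invol : Function.Involutive flipEdge
  flipFace_invol : Function.Involutive flipFace
  flipVert_ne : ∀ x, flipVert x ≠ x
  flipEdge_ne : ∀ x, flipEdge x ≠ x
  flipFace_ne : ∀ x, flipFace x ≠ x
  flipVert_flipFace : ∀ x, flipVert (flipFace x) = flipFace (flipVert x)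
  flipVert_flipFace_ne : ∀ x, flipVert (flipFace x) ≠ x
  /-- the edge of a flag joins the vertices of the two flags along it -/
  isLink : ∀ x, G.IsLink (edge x) (vert x) (vert (flipVert x))
  /-- every vertex of `G` is drawn -/
  exists_vert : ∀ v ∈ V(G), ∃ x, vert x = v
  /-- every edge of `G` is drawn -/
  exists_edge : ∀ e ∈ E(G), ∃ x, edge x = e
  /-- the flags at a vertex of `G` are those around one point of the surface -/
  vert_eq_iff : ∀ x y, vert x = vert y ↔
    Relation.EqvGen (fun a b => b = flipEdge a ∨ b = flipFace a) x y
  /-- the flags at an edge of `G` are the four flags around one edge of the drawing -/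
  edge_eq_iff : ∀ x y, edge x = edge y ↔
    y = x ∨ y = flipVert x ∨ y = flipFace x ∨ y = flipVert (flipFace x)

namespace SurfaceEmbedding

variable {α β F : Type*} {G : Graph α β}

/-- The faces of the embedding: the orbits of flags under `flipVert` and `flipEdge`. -/
def Face (M : SurfaceEmbedding G F) : Type _ :=
  Quot (fun x y : F => y = M.flipVert x ∨ y = M.flipEdge x)

/-- The face of a flag. -/
def face (M : SurfaceEmbedding G F) (x : F) : M.Face :=
  Quot.mk _ x

/-- The Euler characteristic of the surface, `|V| - |E| + |faces|` (for a finite graph). -/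
noncomputable def eulerChar (M : SurfaceEmbedding G F) : ℤ :=
  (V(G).ncard : ℤ) - (E(G).ncard : ℤ) + (Nat.card M.Face : ℤ)

lemma face_flipVert (M : SurfaceEmbedding G F) (x : F) : M.face (M.flipVert x) = M.face x :=
  Eq.symm (Quot.sound (r := fun x y : F => y = M.flipVert x ∨ y = M.flipEdge x) (Or.inl rfl))

lemma face_flipEdge (M : SurfaceEmbedding G F) (x : F) : M.face (M.flipEdge x) = M.face x :=
  Eq.symm (Quot.sound (r := fun x y : F => y = M.flipVert x ∨ y = M.flipEdge x) (Or.inr rfl))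

lemma edge_flipVert (M : SurfaceEmbedding G F) (x : F) : M.edge (M.flipVert x) = M.edge x :=
  ((M.edge_eq_iff x _).2 (Or.inr (Or.inl rfl))).symm

lemma vert_flipEdge (M : SurfaceEmbedding G F) (x : F) : M.vert (M.flipEdge x) = M.vert x :=
  ((M.vert_eq_iff x _).2 (Relation.EqvGen.rel _ _ (Or.inl rfl))).symm

/-- The segments of which curves are made. `IsSegment M s p f` says that, for some flag `x` of the
face `f`, `s` is either the segment from the centre of `f` to the midpoint `p` of the edge of `x`
(the common side of `x` and `flipVert x`), or the segment from the centre of `f` to the vertex `p`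
of `x` (the common side of `x` and `flipEdge x`). -/
inductive IsSegment (M : SurfaceEmbedding G F) : Sym2 F ⊕ Sym2 F → α ⊕ β → M.Face → Prop
  | toEdge (x : F) : IsSegment M (Sum.inl s(x, M.flipVert x)) (Sum.inr (M.edge x)) (M.face x)
  | toVert (x : F) : IsSegment M (Sum.inr s(x, M.flipEdge x)) (Sum.inl (M.vert x)) (M.face x)

lemma IsSegment.unique {M : SurfaceEmbedding G F} {s : Sym2 F ⊕ Sym2 F} {p q : α ⊕ β}
    {f g : M.Face} (h : M.IsSegment s p f) (h' : M.IsSegment s q g) : p = q ∧ f = g := by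
  cases h with
  | toEdge x =>
    generalize hs : (Sum.inl s(x, M.flipVert x) : Sym2 F ⊕ Sym2 F) = s at h'
    cases h' with
    | toEdge y =>
      rcases Sym2.eq_iff.1 (Sum.inl.inj hs) with ⟨rfl, -⟩ | ⟨rfl, -⟩
      · exact ⟨rfl, rfl⟩
      · exact ⟨by rw [edge_flipVert], by rw [face_flipVert]⟩
    | toVert y => simp at hs
  | toVert x =>
    generalize hs : (Sum.inr s(x, M.flipEdge x) : Sym2 F ⊕ Sym2 F) = s at h'
    cases h' with
    | toEdge y => simp at hs
    | toVert y =>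
      rcases Sym2.eq_iff.1 (Sum.inr.inj hs) with ⟨rfl, -⟩ | ⟨rfl, -⟩
      · exact ⟨rfl, rfl⟩
      · exact ⟨by rw [vert_flipEdge], by rw [face_flipEdge]⟩

/-- The graph drawn on the surface whose vertices are the vertices of `G`, the midpoints of the
edges of `G` and the centres of the faces, and whose edges are the segments joining the centre of
a face to the vertices and to the edge midpoints on its boundary, one for each time that the
boundary of the face passes through them. -/
def segmentGraph (M : SurfaceEmbedding G F) :
    Graph ((α ⊕ β) ⊕ M.Face) (Sym2 F ⊕ Sym2 F) where
  vertexSet := {a | ∃ s p f, M.IsSegment s p f ∧ (a = Sum.inl p ∨ a = Sum.inr f)}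
  IsLink s a b := ∃ p f, M.IsSegment s p f ∧
    ((a = Sum.inl p ∧ b = Sum.inr f) ∨ (a = Sum.inr f ∧ b = Sum.inl p))
  isLink_symm := by
    intro s _
    refine ⟨fun a b => ?_⟩
    rintro ⟨p, f, h, h'⟩
    exact ⟨p, f, h, by tauto⟩
  eq_or_eq_of_isLink_of_isLink := by
    rintro s a b c d ⟨p, f, h, h'⟩ ⟨q, g, k, k'⟩
    obtain ⟨rfl, rfl⟩ := h.unique k
    rcases h' with ⟨rfl, rfl⟩ | ⟨rfl, rfl⟩ <;> rcases k' with ⟨rfl, rfl⟩ | ⟨rfl, rfl⟩ <;> simp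
  left_mem_of_isLink := by
    rintro s a b ⟨p, f, h, h'⟩
    exact ⟨s, p, f, h, by tauto⟩

/-- A simple closed curve on the surface that meets the drawing of `G` in finitely many points,
up to a deformation that does not increase the number of these points: a circuit of segments. In
each face that it visits, it runs from the boundary to the centre and back to the boundary, and
it passes from face to face through an edge or a vertex of `G`. -/
def IsSimpleClosedCurve (M : SurfaceEmbedding G F)
    (C : Graph ((α ⊕ β) ⊕ M.Face) (Sym2 F ⊕ Sym2 F)) : Prop :=
  C.IsCircuitOf M.segmentGraph

/-- Two flags are adjacent on the surface cut open along the curve `C`: they have a common side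
that is not a segment of `C`. -/
def AdjOff (M : SurfaceEmbedding G F)
    (C : Graph ((α ⊕ β) ⊕ M.Face) (Sym2 F ⊕ Sym2 F)) (x y : F) : Prop :=
  (y = M.flipVert x ∧ Sum.inl s(x, y) ∉ E(C)) ∨
  (y = M.flipEdge x ∧ Sum.inr s(x, y) ∉ E(C)) ∨
  y = M.flipFace x

/-- The curve does not split the surface: the complement of the curve is connected. -/
def IsNonseparating (M : SurfaceEmbedding G F)
    (C : Graph ((α ⊕ β) ⊕ M.Face) (Sym2 F ⊕ Sym2 F)) : Prop :=
  ∀ x y : F, Relation.EqvGen (M.AdjOff C) x y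

/-- The number of points of the drawing of `G` that the curve meets. -/
noncomputable def numPoints (M : SurfaceEmbedding G F)
    (C : Graph ((α ⊕ β) ⊕ M.Face) (Sym2 F ⊕ Sym2 F)) : ℕ∞ :=
  {p : α ⊕ β | Sum.inl p ∈ V(C)}.encard

/-- The representativity of the embedding: the least number of points of the drawing of `G` on a
simple closed curve that does not split the surface (`⊤` if there is no such curve, which is the
case of the sphere). -/
noncomputable def representativity (M : SurfaceEmbedding G F) : ℕ∞ :=
  ⨅ (C : Graph ((α ⊕ β) ⊕ M.Face) (Sym2 F ⊕ Sym2 F)) (_ : M.IsSimpleClosedCurve C)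
    (_ : M.IsNonseparating C), M.numPoints C

end SurfaceEmbedding

/-! Since `G` is cubic, `3n = 2|E|`, hence `n + 2χ = 3n - 2|E| + 2f = 2f`, where `f` is the number
of faces. The claim is therefore a lower bound in terms of the number of faces alone.

Representativity at least four enters in one way only. A set of two or three edges that meets every
face boundary evenly is crossed by a simple closed curve through the faces; that curve meets the
graph in at most three points, so it separates the surface, and the edges form a cut
(`SurfaceEmbedding.exists_cut`). `FacedCubic` keeps just this fact and the double cover by face
boundaries. Its faces are only even sets, so no surface is needed afterwards, and the class is
closed under contracting one side of a cut of three edges.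

Induction on the number of vertices disposes of the small cuts. At a nontrivial cut of three edges,
circuit double covers of the two contractions glue uniquely, because each pair of cut edges lies in
exactly one circuit on either side. So the numbers of covers multiply (`card_cdcs_contract_mul_le`),
the numbers of faces are subadditive, and so is the cube root. If all such cuts are trivial but
there is a cut of two edges, the graph is a necklace with four vertices, which has two covers. What
remains is the `Tight` case: two faces share at most one edge, and three pairwise adjacent faces
share a vertex.

In the `Tight` case new covers come from recombining faces. Fix a face `Q` and colour its edges with
three colours so that consecutive edges differ. Replace `Q` and its neighbours by three sets: the
`i`-th is the sum modulo 2 of `Q` and the neighbours across edges of colour `i`. An edge of `Q` lies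
in the two sets that do not have its colour. Two neighbours of `Q` that share an edge form a
triangle of faces with `Q`, so they meet `Q` in consecutive edges, have different colours and do not
cancel on the shared edge. The result is again an even double cover (`isEvenDoubleCover_recombine`).
Splitting its members into circuits does not change which paths of three edges are contained in a
member, and such paths tell the covers apart (`card_le_card_cdcs`).

There are two sources of many choices. A face of length `ℓ` has at least `ℓ/27` edges far apart, and
at each of them the two neighbouring edges may get equal or different colours. If all faces have
length at most `d`, there are at least `f/(2d)²` faces that can be recombined independently. With
the threshold `u = (2f)^(1/3)` the exponents are at least `u/27` and `u/8`; the constant 100 leaves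
room. -/

section

open scoped Classical

/-! ### Parity of sums of edge sets, independent sets and greedy colouring -/

section Parity

variable {ι E : Type*}

/-- The edges of `U` that lie in an odd number of the sets `A i`, `i ∈ I`. -/
noncomputable def oddPart (U : Finset E) (I : Finset ι) (A : ι → Finset E) : Finset E :=
  U.filter fun e => Odd (I.filter fun i => e ∈ A i).card

lemma mem_oddPart {U : Finset E} {I : Finset ι} {A : ι → Finset E} {e : E} :
    e ∈ oddPart U I A ↔ e ∈ U ∧ Odd (I.filter fun i => e ∈ A i).card := by
  simp [oddPart]

/-- Double counting of the pairs `(i, e)` with `e ∈ A i ∩ C`, modulo 2. Since `oddPart` is the sum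
of the `A i` modulo 2, this is bilinearity of the intersection parity. It is used for face
boundaries as well as for vertex stars. -/
lemma even_card_inter_oddPart {U : Finset E} {I : Finset ι} {A : ι → Finset E} {C : Finset E}
    (hC : C ⊆ U) :
    Even (C ∩ oddPart U I A).card ↔ Even (∑ i ∈ I, (A i ∩ C).card) := by
  have h1 : ∑ i ∈ I, (A i ∩ C).card = ∑ e ∈ C, (I.filter fun i => e ∈ A i).card := by
    have : ∀ i, A i ∩ C = C.filter fun e => e ∈ A i := by intro i; ext e; simp [and_comm]
    simp only [this]
    exact Finset.sum_card_bipartiteAbove_eq_sum_card_bipartiteBelow (fun i e => e ∈ A i)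
  have h2 : C ∩ oddPart U I A = C.filter fun e => Odd (I.filter fun i => e ∈ A i).card := by
    ext e; simp only [Finset.mem_inter, mem_oddPart, Finset.mem_filter]; grind
  rw [h1, h2, ← Nat.not_odd_iff_even, ← Nat.not_odd_iff_even, Finset.odd_sum_iff_odd_card_odd]

lemma even_card_inter_oddPart_of_even {U : Finset E} {I : Finset ι} {A : ι → Finset E}
    {C : Finset E} (hC : C ⊆ U) (h : ∀ i ∈ I, Even (A i ∩ C).card) :
    Even (C ∩ oddPart U I A).card :=
  (even_card_inter_oddPart hC).2 (Finset.even_sum _ h)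

lemma even_card_inter_triple {A : Finset E} {a b c : E} (hab : a ≠ b) (hac : a ≠ c)
    (hbc : b ≠ c) : Even (A ∩ {a, b, c}).card ↔
      (a ∈ A ∧ b ∈ A ∧ c ∉ A) ∨ (a ∈ A ∧ b ∉ A ∧ c ∈ A) ∨ (a ∉ A ∧ b ∈ A ∧ c ∈ A) ∨
        (a ∉ A ∧ b ∉ A ∧ c ∉ A) := by
  have key : A ∩ {a, b, c} = ({a, b, c} : Finset E).filter (· ∈ A) := by
    ext; simp [and_comm]
  rw [key]
  by_cases ha : a ∈ A <;> by_cases hb : b ∈ A <;> by_cases hc : c ∈ A <;>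
    simp [Finset.filter_insert, Finset.filter_singleton, *, Nat.even_iff]

/-- If the sets `A i` have even intersection with a triple and cover each of its elements exactly
twice, then exactly one of them contains any two given elements of the triple. -/
lemma card_filter_pair_eq_one {I : Finset ι} {A : ι → Finset E} {a b c : E} (hab : a ≠ b)
    (hac : a ≠ c) (hbc : b ≠ c) (hev : ∀ i ∈ I, Even (A i ∩ {a, b, c}).card)
    (ha : (I.filter fun i => a ∈ A i).card = 2) (hb : (I.filter fun i => b ∈ A i).card = 2)
    (hc : (I.filter fun i => c ∈ A i).card = 2) :
    (I.filter fun i => a ∈ A i ∧ b ∈ A i).card = 1 := by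
  have key : ∀ x y z : E, (∀ i ∈ I, x ∈ A i ↔ (x ∈ A i ∧ y ∈ A i) ∨ (x ∈ A i ∧ z ∈ A i)) →
      (∀ i ∈ I, ¬ ((x ∈ A i ∧ y ∈ A i) ∧ (x ∈ A i ∧ z ∈ A i))) →
      (I.filter fun i => x ∈ A i).card = (I.filter fun i => x ∈ A i ∧ y ∈ A i).card
        + (I.filter fun i => x ∈ A i ∧ z ∈ A i).card := by
    intro x y z h1 h2
    rw [← Finset.card_union_of_disjoint, ← Finset.filter_or]
    · exact congrArg _ (Finset.filter_congr h1)
    · exact Finset.disjoint_filter.2 fun i hi hp hq => h2 i hi ⟨hp, hq⟩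
  have h := fun i hi => (even_card_inter_triple hab hac hbc).1 (hev i hi)
  have k1 := key a b c (by grind) (by grind)
  have k2 := key b a c (by grind) (by grind)
  have k3 := key c a b (by grind) (by grind)
  have e1 : (I.filter fun i => b ∈ A i ∧ a ∈ A i) = (I.filter fun i => a ∈ A i ∧ b ∈ A i) := by
    simp [and_comm]
  have e2 : (I.filter fun i => c ∈ A i ∧ a ∈ A i) = (I.filter fun i => a ∈ A i ∧ c ∈ A i) := by
    simp [and_comm]
  have e3 : (I.filter fun i => c ∈ A i ∧ b ∈ A i) = (I.filter fun i => b ∈ A i ∧ c ∈ A i) := by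
    simp [and_comm]
  rw [e1] at k2
  rw [e2, e3] at k3
  omega

/-- A finite set with a symmetric relation in which every element is related to at most `d`
elements has a subset of at least a `d`-th of its size without related pairs. -/
lemma exists_independent_subset (A : Finset ι) (r : ι → ι → Prop) [DecidableRel r] (d : ℕ)
    (hr : ∀ a b, r a b → r b a) (hself : ∀ a ∈ A, r a a)
    (hd : ∀ a ∈ A, (A.filter (r a)).card ≤ d) :
    ∃ W ⊆ A, (∀ a ∈ W, ∀ b ∈ W, r a b → a = b) ∧ A.card ≤ W.card * d := by
  obtain ⟨W, hW, hmax⟩ := (A.powerset.filter fun W => ∀ a ∈ W, ∀ b ∈ W, r a b → a = b)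
    |>.exists_max_image Finset.card ⟨∅, by simp⟩
  simp only [Finset.mem_filter, Finset.mem_powerset] at hW hmax
  refine ⟨W, hW.1, hW.2, ?_⟩
  -- A largest independent `W` dominates `A`: an element related to nothing in `W` could be added.
  have hcov : A ⊆ W.biUnion fun w => A.filter (r w) := by
    intro a ha
    by_contra hcon
    simp only [Finset.mem_biUnion, Finset.mem_filter, not_exists, not_and] at hcon
    have haW : a ∉ W := fun h => hcon a h ha (hself a ha)
    have := hmax (insert a W) ⟨Finset.insert_subset ha hW.1, by
      intro x hx y hy hxy
      rcases Finset.mem_insert.1 hx with rfl | hx' <;>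
        rcases Finset.mem_insert.1 hy with rfl | hy'
      · rfl
      · exact absurd (hr _ _ hxy) (hcon y hy' ha)
      · exact absurd hxy (hcon x hx' ha)
      · exact hW.2 x hx' y hy' hxy⟩
    rw [Finset.card_insert_of_notMem haW] at this
    omega
  calc A.card ≤ _ := Finset.card_le_card hcov
    _ ≤ ∑ w ∈ W, (A.filter (r w)).card := Finset.card_biUnion_le
    _ ≤ W.card * d := by
      rw [← smul_eq_mul]; exact Finset.sum_le_card_nsmul _ _ _ fun w hw => hd w (hW.1 hw)

/-- Greedy extension of a proper `3`-colouring when every element has at most two neighbours. -/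
lemma exists_extend_coloring (Q : Finset E) (adj : E → E → Prop) [DecidableRel adj]
    (hsymm : ∀ a b, adj a b → adj b a) (hirr : ∀ a, ¬ adj a a)
    (hdeg : ∀ a ∈ Q, (Q.filter (adj a)).card ≤ 2) (P : Finset E) (hP : P ⊆ Q) (c₀ : E → Fin 3)
    (hc₀ : ∀ a ∈ P, ∀ b ∈ P, adj a b → c₀ a ≠ c₀ b) :
    ∃ c : E → Fin 3, (∀ a ∈ P, c a = c₀ a) ∧ ∀ a ∈ Q, ∀ b ∈ Q, adj a b → c a ≠ c b := by
  induction h : (Q \ P).card generalizing P c₀ with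
  | zero =>
    have : Q ⊆ P := by simpa using h
    exact ⟨c₀, fun _ _ => rfl, fun a ha b hb => hc₀ a (this ha) b (this hb)⟩
  | succ m ih =>
    obtain ⟨q, hq⟩ : (Q \ P).Nonempty := by rw [← Finset.card_pos]; omega
    have hqQ := (Finset.mem_sdiff.1 hq).1
    have hqP := (Finset.mem_sdiff.1 hq).2
    obtain ⟨i, hi⟩ : ∃ i : Fin 3, i ∉ (Q.filter (adj q)).image c₀ := by
      by_contra! hcon
      have h1 : (Finset.univ : Finset (Fin 3)) ⊆ (Q.filter (adj q)).image c₀ := fun i _ => hcon i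
      have h2 := (Finset.card_le_card h1).trans Finset.card_image_le
      have h3 := hdeg q hqQ
      simp only [Finset.card_univ, Fintype.card_fin] at h2
      omega
    have hi' : ∀ b ∈ Q, adj q b → c₀ b ≠ i := by
      intro b hb hab he
      exact hi (Finset.mem_image.2 ⟨b, by simp [hb, hab], he⟩)
    have hcard : (Q \ insert q P).card = m := by
      have : Q \ insert q P = (Q \ P).erase q := by ext; simp; tauto
      rw [this, Finset.card_erase_of_mem hq]; omega
    obtain ⟨c, hc1, hc2⟩ := ih (insert q P) (Finset.insert_subset hqQ hP)
      (Function.update c₀ q i) (by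
        intro a ha b hb hab
        rcases Finset.mem_insert.1 ha with rfl | ha' <;>
          rcases Finset.mem_insert.1 hb with rfl | hb'
        · exact absurd hab (hirr _)
        · have : b ≠ a := fun h => hqP (h ▸ hb')
          simp only [Function.update_self, Function.update_of_ne this]
          exact (hi' b (hP hb') hab).symm
        · have : a ≠ b := fun h => hqP (h ▸ ha')
          simp only [Function.update_self, Function.update_of_ne this]
          exact hi' a (hP ha') (hsymm _ _ hab)
        · have h1 : a ≠ q := fun h => hqP (h ▸ ha')
          have h2 : b ≠ q := fun h => hqP (h ▸ hb')
          rw [Function.update_of_ne h1, Function.update_of_ne h2]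
          exact hc₀ a ha' b hb' hab) hcard
    refine ⟨c, fun a ha => ?_, hc2⟩
    have : a ≠ q := fun h => hqP (h ▸ ha)
    rw [hc1 a (Finset.mem_insert_of_mem ha), Function.update_of_ne this]

end Parity

/-- The combinatorial data of a connected cubic graph together with a double cover of its edges by
even sets, the boundaries of the faces, in which every set of two or three edges that is even in
the dual graph is an edge cut. -/
structure FacedCubic (V E Φ : Type*) where
  verts : Finset V
  edges : Finset E
  faces : Finset Φ
  /-- the edges at a vertex -/
  star : V → Finset E
  /-- the edges on the boundary of a face -/
  bd : Φ → Finset E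
  star_subset : ∀ v ∈ verts, star v ⊆ edges
  card_star : ∀ v ∈ verts, (star v).card = 3
  card_ends : ∀ e ∈ edges, (verts.filter fun v => e ∈ star v).card = 2
  bd_subset : ∀ φ ∈ faces, bd φ ⊆ edges
  bd_nonempty : ∀ φ ∈ faces, (bd φ).Nonempty
  bd_even : ∀ φ ∈ faces, ∀ v ∈ verts, Even (bd φ ∩ star v).card
  card_sides : ∀ e ∈ edges, (faces.filter fun φ => e ∈ bd φ).card = 2
  conn : ∀ X ⊆ verts, oddPart edges X star = ∅ → X = ∅ ∨ X = verts
  -- The only trace of the surface: a short cycle of the dual graph is an edge cut.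
  dual : ∀ D ⊆ edges, D.card = 2 ∨ D.card = 3 → (∀ φ ∈ faces, Even (bd φ ∩ D).card) →
    ∃ X ⊆ verts, oddPart edges X star = D

/-! ### Cuts and counting in cubic graphs with faces -/

namespace FacedCubic

variable {V E Φ : Type*} (K : FacedCubic V E Φ)

/-- The edges with exactly one end in `X`. -/
noncomputable abbrev cut (X : Finset V) : Finset E := oddPart K.edges X K.star

lemma cut_subset (X : Finset V) : K.cut X ⊆ K.edges := Finset.filter_subset _ _

variable {K}

lemma exists_ends {e : E} (he : e ∈ K.edges) : ∃ x ∈ K.verts, ∃ y ∈ K.verts, x ≠ y ∧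
    ∀ v ∈ K.verts, e ∈ K.star v ↔ v = x ∨ v = y := by
  obtain ⟨x, y, hxy, h⟩ := Finset.card_eq_two.1 (K.card_ends e he)
  have key : ∀ v, v ∈ K.verts ∧ e ∈ K.star v ↔ v = x ∨ v = y := by
    intro v
    have := congrArg (v ∈ ·) h
    simpa using this
  exact ⟨x, ((key x).2 (.inl rfl)).1, y, ((key y).2 (.inr rfl)).1, hxy, fun v hv =>
    ⟨fun h => (key v).1 ⟨hv, h⟩, fun h => ((key v).2 h).2⟩⟩

lemma exists_other_end {e : E} (he : e ∈ K.edges) {x : V} (hx : x ∈ K.verts)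
    (hex : e ∈ K.star x) : ∃ y ∈ K.verts, x ≠ y ∧ ∀ v ∈ K.verts, e ∈ K.star v ↔ v = x ∨ v = y := by
  obtain ⟨a, ha, b, hb, hab, h⟩ := exists_ends he
  rcases (h x hx).1 hex with rfl | rfl
  · exact ⟨b, hb, hab, h⟩
  · exact ⟨a, ha, hab.symm, fun v hv => (h v hv).trans or_comm⟩

lemma exists_sides {e : E} (he : e ∈ K.edges) : ∃ x ∈ K.faces, ∃ y ∈ K.faces, x ≠ y ∧
    ∀ v ∈ K.faces, e ∈ K.bd v ↔ v = x ∨ v = y := by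
  obtain ⟨x, y, hxy, h⟩ := Finset.card_eq_two.1 (K.card_sides e he)
  have key : ∀ v, v ∈ K.faces ∧ e ∈ K.bd v ↔ v = x ∨ v = y := by
    intro v
    have := congrArg (v ∈ ·) h
    simpa using this
  exact ⟨x, ((key x).2 (.inl rfl)).1, y, ((key y).2 (.inr rfl)).1, hxy, fun v hv =>
    ⟨fun h => (key v).1 ⟨hv, h⟩, fun h => ((key v).2 h).2⟩⟩

lemma exists_other_side {e : E} (he : e ∈ K.edges) {x : Φ} (hx : x ∈ K.faces)
    (hex : e ∈ K.bd x) : ∃ y ∈ K.faces, x ≠ y ∧ ∀ v ∈ K.faces, e ∈ K.bd v ↔ v = x ∨ v = y := by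
  obtain ⟨a, ha, b, hb, hab, h⟩ := exists_sides he
  rcases (h x hx).1 hex with rfl | rfl
  · exact ⟨b, hb, hab, h⟩
  · exact ⟨a, ha, hab.symm, fun v hv => (h v hv).trans or_comm⟩

lemma odd_card_filter_pair {ι : Type*} {I X : Finset ι} {p : ι → Prop} [DecidablePred p]
    {x y : ι} (hxy : x ≠ y)
    (hX : X ⊆ I) (h : ∀ v ∈ I, p v ↔ v = x ∨ v = y) :
    Odd (X.filter p).card ↔ (x ∈ X ↔ y ∉ X) := by
  have : X.filter p = ({x, y} : Finset ι).filter (· ∈ X) := by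
    ext v
    simp only [Finset.mem_filter, Finset.mem_insert, Finset.mem_singleton]
    exact ⟨fun hv => ⟨(h v (hX hv.1)).1 hv.2, hv.1⟩, fun hv => ⟨hv.2, (h v (hX hv.2)).2 hv.1⟩⟩
  rw [this]
  by_cases hx : x ∈ X <;> by_cases hy : y ∈ X <;>
    simp [Finset.filter_insert, Finset.filter_singleton, hx, hy, hxy, Nat.odd_iff]

lemma mem_cut_iff {X : Finset V} (hX : X ⊆ K.verts) {e : E} (he : e ∈ K.edges) {x y : V}
    (hxy : x ≠ y) (h : ∀ v ∈ K.verts, e ∈ K.star v ↔ v = x ∨ v = y) :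
    e ∈ K.cut X ↔ (x ∈ X ↔ y ∉ X) := by
  rw [mem_oddPart, odd_card_filter_pair hxy hX h]
  simp [he]

lemma cut_compl {X : Finset V} (hX : X ⊆ K.verts) : K.cut (K.verts \ X) = K.cut X := by
  ext e
  by_cases he : e ∈ K.edges
  · obtain ⟨x, hx, y, hy, hxy, h⟩ := exists_ends he
    rw [mem_cut_iff hX he hxy h, mem_cut_iff Finset.sdiff_subset he hxy h]
    simp only [Finset.mem_sdiff, hx, hy, true_and]
    tauto
  · exact ⟨fun h => absurd (K.cut_subset _ h) he, fun h => absurd (K.cut_subset _ h) he⟩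

lemma cut_singleton {v : V} (hv : v ∈ K.verts) : K.cut {v} = K.star v := by
  ext e
  rw [mem_oddPart, Finset.filter_singleton]
  by_cases h : e ∈ K.star v
  · simp [h, K.star_subset v hv h]
  · simp [h]

lemma even_bd_inter_cut {X : Finset V} (hX : X ⊆ K.verts) {φ : Φ} (hφ : φ ∈ K.faces) :
    Even (K.bd φ ∩ K.cut X).card := by
  refine even_card_inter_oddPart_of_even (K.bd_subset φ hφ) fun v hv => ?_
  rw [Finset.inter_comm]
  exact K.bd_even φ hφ v (hX hv)

/-- Every face meets every cut evenly, whereas a face through the only edge of a cut would meet it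
once. So the double cover by faces already forbids bridges. -/
lemma card_cut_ne_one {X : Finset V} (hX : X ⊆ K.verts) : (K.cut X).card ≠ 1 := by
  intro h
  obtain ⟨e, he⟩ := Finset.card_eq_one.1 h
  have heK : e ∈ K.edges := K.cut_subset X (he ▸ Finset.mem_singleton_self e)
  obtain ⟨φ, hφ, _, _, _, h2⟩ := exists_sides heK
  have hev := even_bd_inter_cut hX hφ
  have hin : e ∈ K.bd φ := (h2 φ hφ).2 (.inl rfl)
  rw [he, Finset.inter_singleton_of_mem hin] at hev
  simp at hev

/-- The number of edges leaving `X` has the parity of the size of `X`. -/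
lemma even_card_cut_iff {X : Finset V} (hX : X ⊆ K.verts) :
    Even (K.cut X).card ↔ Even X.card := by
  have h := even_card_inter_oddPart (U := K.edges) (I := X) (A := K.star) (C := K.edges) subset_rfl
  rw [Finset.inter_eq_right.2 (K.cut_subset X)] at h
  have hs : ∑ i ∈ X, (K.star i ∩ K.edges).card = X.card * 3 := by
    rw [Finset.sum_const_nat (m := 3)]
    intro v hv
    rw [Finset.inter_eq_left.2 (K.star_subset v (hX hv)), K.card_star v (hX hv)]
  rw [h, hs, Nat.even_mul]
  simp [show ¬ Even 3 by decide]

lemma star_eq_triple {v : V} (hv : v ∈ K.verts) {a b : E} (ha : a ∈ K.star v) (hb : b ∈ K.star v)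
    (hab : a ≠ b) : ∃ c, a ≠ c ∧ b ≠ c ∧ K.star v = {a, b, c} := by
  have h2 : (((K.star v).erase a).erase b).card = 1 := by
    rw [Finset.card_erase_of_mem (by simp [hb, hab.symm]), Finset.card_erase_of_mem ha,
      K.card_star v hv]
  obtain ⟨c, hc⟩ := Finset.card_eq_one.1 h2
  have hc' : c ∈ ((K.star v).erase a).erase b := hc ▸ Finset.mem_singleton_self c
  simp only [Finset.mem_erase] at hc'
  refine ⟨c, hc'.2.1.symm, hc'.1.symm, ?_⟩
  rw [← hc, Finset.insert_erase (by simp [hb, hab.symm]), Finset.insert_erase ha]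

lemma exists_star_eq {v : V} (hv : v ∈ K.verts) {a : E} (ha : a ∈ K.star v) :
    ∃ b c, a ≠ b ∧ a ≠ c ∧ b ≠ c ∧ K.star v = {a, b, c} := by
  have h2 : ((K.star v).erase a).card = 2 := by
    rw [Finset.card_erase_of_mem ha, K.card_star v hv]
  obtain ⟨b, c, hbc, h⟩ := Finset.card_eq_two.1 h2
  have hb : b ∈ (K.star v).erase a := by simp [h]
  have hc : c ∈ (K.star v).erase a := by simp [h]
  exact ⟨b, c, (Finset.ne_of_mem_erase hb).symm, (Finset.ne_of_mem_erase hc).symm, hbc, by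
    rw [← h, Finset.insert_erase ha]⟩

lemma three_mul_card_verts : 3 * K.verts.card = 2 * K.edges.card := by
  have h2 : ∑ v ∈ K.verts, 3 = ∑ e ∈ K.edges, 2 := by
    rw [← Finset.sum_congr rfl K.card_ends, ← Finset.sum_congr rfl K.card_star]
    have : ∀ v ∈ K.verts, K.star v = K.edges.filter fun e => e ∈ K.star v := by
      intro v hv; ext e; simp only [Finset.mem_filter]
      exact ⟨fun h => ⟨K.star_subset v hv h, h⟩, fun h => h.2⟩
    rw [Finset.sum_congr rfl fun v hv => congrArg Finset.card (this v hv)]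
    exact Finset.sum_card_bipartiteAbove_eq_sum_card_bipartiteBelow (fun v e => e ∈ K.star v)
  simpa [mul_comm] using h2

/-- There are at most three times as many faces as vertices. -/
lemma card_faces_le : K.faces.card ≤ 3 * K.verts.card := by
  have h1 : ∑ φ ∈ K.faces, (K.bd φ).card = ∑ e ∈ K.edges, 2 := by
    rw [← Finset.sum_congr rfl K.card_sides]
    have : ∀ φ ∈ K.faces, K.bd φ = K.edges.filter fun e => e ∈ K.bd φ := by
      intro φ hφ; ext e; simp only [Finset.mem_filter]
      exact ⟨fun h => ⟨K.bd_subset φ hφ h, h⟩, fun h => h.2⟩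
    rw [Finset.sum_congr rfl fun φ hφ => congrArg Finset.card (this φ hφ)]
    exact Finset.sum_card_bipartiteAbove_eq_sum_card_bipartiteBelow (fun φ e => e ∈ K.bd φ)
  have h3 : K.faces.card ≤ ∑ φ ∈ K.faces, (K.bd φ).card := by
    rw [Finset.card_eq_sum_ones]
    exact Finset.sum_le_sum fun φ hφ => Finset.card_pos.2 (K.bd_nonempty φ hφ)
  rw [three_mul_card_verts]
  rw [h1] at h3
  simpa [mul_comm] using h3

/-! ### Even sets, circuits and double covers -/

variable (K)

/-- A set of edges with an even number of edges at every vertex. -/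
def IsEven (C : Finset E) : Prop :=
  C ⊆ K.edges ∧ ∀ v ∈ K.verts, Even (C ∩ K.star v).card

/-- A minimal nonempty even set. -/
structure IsCircuit (C : Finset E) : Prop where
  even : K.IsEven C
  nonempty : C.Nonempty
  minimal : ∀ D ⊆ C, K.IsEven D → D = ∅ ∨ D = C

/-- A set of circuits that covers every edge exactly twice. -/
structure IsCDC (𝒞 : Finset (Finset E)) : Prop where
  circuit : ∀ C ∈ 𝒞, K.IsCircuit C
  card_eq : ∀ e ∈ K.edges, (𝒞.filter fun C => e ∈ C).card = 2

/-- The circuit double covers. -/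
noncomputable def cdcs : Finset (Finset (Finset E)) :=
  K.edges.powerset.powerset.filter K.IsCDC

/-- A family of even sets that covers every edge exactly twice. -/
structure IsEvenDoubleCover {ι : Type*} (I : Finset ι) (A : ι → Finset E) : Prop where
  even : ∀ i ∈ I, K.IsEven (A i)
  card_eq : ∀ e ∈ K.edges, (I.filter fun i => e ∈ A i).card = 2

/-- Two edges have a common end. -/
def Meets (a b : E) : Prop := ∃ v ∈ K.verts, a ∈ K.star v ∧ b ∈ K.star v

variable {K}

lemma mem_cdcs {𝒞 : Finset (Finset E)} : 𝒞 ∈ K.cdcs ↔ K.IsCDC 𝒞 := by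
  simp only [cdcs, Finset.mem_filter, Finset.mem_powerset, and_iff_right_iff_imp]
  intro h C hC
  exact Finset.mem_powerset.2 (h.circuit C hC).even.1

lemma IsCDC.isEvenDoubleCover {𝒞 : Finset (Finset E)} (h : K.IsCDC 𝒞) :
    K.IsEvenDoubleCover 𝒞 id :=
  ⟨fun C hC => (h.circuit C hC).even, h.card_eq⟩

lemma IsEvenDoubleCover.card_pair {ι : Type*} {I : Finset ι} {A : ι → Finset E}
    (h : K.IsEvenDoubleCover I A) {v : V} (hv : v ∈ K.verts) {a b : E} (ha : a ∈ K.star v)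
    (hb : b ∈ K.star v) (hab : a ≠ b) :
    (I.filter fun i => a ∈ A i ∧ b ∈ A i).card = 1 := by
  obtain ⟨c, hac, hbc, hs⟩ := star_eq_triple hv ha hb hab
  have hcv : c ∈ K.star v := by simp [hs]
  refine card_filter_pair_eq_one hab hac hbc (fun i hi => ?_) ?_ ?_ ?_
  · rw [← hs]; exact (h.even i hi).2 v hv
  all_goals exact h.card_eq _ (K.star_subset v hv (by assumption))

lemma IsEven.mem_of_mem {A : Finset E} (hA : K.IsEven A) {v : V} (hv : v ∈ K.verts) {a b c : E}
    (hab : a ≠ b) (hac : a ≠ c) (hbc : b ≠ c) (hs : K.star v = {a, b, c}) :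
    (a ∈ A ∧ b ∈ A ∧ c ∉ A) ∨ (a ∈ A ∧ b ∉ A ∧ c ∈ A) ∨ (a ∉ A ∧ b ∈ A ∧ c ∈ A) ∨
        (a ∉ A ∧ b ∉ A ∧ c ∉ A) :=
  (even_card_inter_triple hab hac hbc).1 (hs ▸ hA.2 v hv)

/-- An even set contains every edge of a larger even set that it meets at a vertex. -/
lemma IsEven.mem_of_subset {A C : Finset E} (hA : K.IsEven A) (hC : K.IsEven C) (hCA : C ⊆ A)
    {v : V} (hv : v ∈ K.verts) {a b : E} (ha : a ∈ K.star v) (hb : b ∈ K.star v) (haC : a ∈ C)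
    (hbA : b ∈ A) : b ∈ C := by
  by_cases hab : a = b
  · exact hab ▸ haC
  obtain ⟨c, hac, hbc, hs⟩ := star_eq_triple hv ha hb hab
  have h1 := hA.mem_of_mem hv hab hac hbc hs
  have h2 := hC.mem_of_mem hv hab hac hbc hs
  have h3 := @hCA c
  have h4 := hCA haC
  tauto

lemma even_card_sdiff {C D : Finset E} (hCD : D ⊆ C) (hC : Even C.card) (hD : Even D.card) :
    Even (C \ D).card := by
  rw [Finset.card_sdiff_of_subset hCD, Nat.even_sub (Finset.card_le_card hCD)]
  tauto

lemma IsEven.sdiff {C D : Finset E} (hC : K.IsEven C) (hD : K.IsEven D) (hCD : D ⊆ C) :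
    K.IsEven (C \ D) := by
  refine ⟨Finset.sdiff_subset.trans hC.1, fun v hv => ?_⟩
  have : (C \ D) ∩ K.star v = (C ∩ K.star v) \ (D ∩ K.star v) := by ext; simp; tauto
  rw [this]
  exact even_card_sdiff (Finset.inter_subset_inter_right hCD) (hC.2 v hv) (hD.2 v hv)

lemma IsEven.exists_circuit {A : Finset E} (hA : K.IsEven A) {e : E} (he : e ∈ A) :
    ∃ C ⊆ A, K.IsCircuit C ∧ e ∈ C := by
  obtain ⟨C, hC, hmin⟩ := (A.powerset.filter fun C => K.IsEven C ∧ e ∈ C).exists_min_image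
    Finset.card ⟨A, by simp [hA, he]⟩
  simp only [Finset.mem_filter, Finset.mem_powerset] at hC hmin
  refine ⟨C, hC.1, ⟨hC.2.1, ⟨e, hC.2.2⟩, fun D hD hDe => ?_⟩, hC.2.2⟩
  by_cases heD : e ∈ D
  · right
    exact Finset.eq_of_subset_of_card_le hD (hmin D ⟨hD.trans hC.1, hDe, heD⟩)
  · left
    have h1 := hmin (C \ D) ⟨Finset.sdiff_subset.trans hC.1, hC.2.1.sdiff hDe hD,
      by simp [hC.2.2, heD]⟩
    rw [Finset.card_sdiff_of_subset hD] at h1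
    have h2 := Finset.card_le_card hD
    have h3 : 0 < C.card := Finset.card_pos.2 ⟨e, hC.2.2⟩
    exact Finset.card_eq_zero.1 (by omega)

/-- In a cubic graph an even set has degree 0 or 2 at each vertex. So if `C` and `C'` share an edge
at a vertex, they agree there with `A` and with each other; hence `C ∩ C'` is even, and minimality
makes it equal to both. -/
lemma IsEven.circuit_unique {A C C' : Finset E} (hA : K.IsEven A) (hCA : C ⊆ A) (hCA' : C' ⊆ A)
    (hC : K.IsCircuit C) (hC' : K.IsCircuit C') {e : E} (he : e ∈ C) (he' : e ∈ C') : C = C' := by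
  have hev : K.IsEven (C ∩ C') := by
    refine ⟨Finset.inter_subset_left.trans hC.even.1, fun v hv => ?_⟩
    by_cases hne : ∃ a ∈ K.star v, a ∈ C ∧ a ∈ C'
    · obtain ⟨a, ha, haC, haC'⟩ := hne
      have : C ∩ C' ∩ K.star v = C ∩ K.star v := by
        ext b
        simp only [Finset.mem_inter]
        refine ⟨fun h => ⟨h.1.1, h.2⟩, fun h => ⟨⟨h.1, ?_⟩, h.2⟩⟩
        exact hA.mem_of_subset hC'.even hCA' hv ha h.2 haC' (hCA h.1)
      rw [this]
      exact hC.even.2 v hv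
    · have : C ∩ C' ∩ K.star v = ∅ := by
        ext b
        simp only [Finset.mem_inter, Finset.notMem_empty, iff_false]
        exact fun h => hne ⟨b, h.2, h.1.1, h.1.2⟩
      simp [this]
  have hne : C ∩ C' ≠ ∅ := Finset.ne_empty_of_mem (Finset.mem_inter.2 ⟨he, he'⟩)
  have h1 := (hC.minimal _ Finset.inter_subset_left hev).resolve_left hne
  have h2 := (hC'.minimal _ Finset.inter_subset_right hev).resolve_left hne
  rw [← h1, h2]

/-- Every even double cover is refined by a circuit double cover that has the same paths of three
edges. -/
lemma IsEvenDoubleCover.exists_cdc {ι : Type*} {I : Finset ι} {A : ι → Finset E}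
    (h : K.IsEvenDoubleCover I A) : ∃ 𝒞, K.IsCDC 𝒞 ∧
      ∀ a e b, K.Meets a e → K.Meets e b →
        ((∃ C ∈ 𝒞, a ∈ C ∧ e ∈ C ∧ b ∈ C) ↔ ∃ i ∈ I, a ∈ A i ∧ e ∈ A i ∧ b ∈ A i) := by
  refine ⟨K.edges.powerset.filter fun C => K.IsCircuit C ∧ ∃ i ∈ I, C ⊆ A i, ⟨?_, ?_⟩, ?_⟩
  · intro C hC
    exact (Finset.mem_filter.1 hC).2.1
  · intro e he
    obtain ⟨i, j, hij, hI⟩ := Finset.card_eq_two.1 (h.card_eq e he)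
    have key : ∀ k, k ∈ I ∧ e ∈ A k ↔ k = i ∨ k = j := by
      intro k
      have := congrArg (k ∈ ·) hI
      simpa using this
    have hi := (key i).2 (.inl rfl)
    have hj := (key j).2 (.inr rfl)
    obtain ⟨C, hCi, hC, heC⟩ := (h.even i hi.1).exists_circuit hi.2
    obtain ⟨C', hCj, hC', heC'⟩ := (h.even j hj.1).exists_circuit hj.2
    -- Otherwise `A i` and `A j` would both contain `e` and the same second edge at `v`, but only
    -- one member of the cover contains a given pair of edges at a vertex.
    have hne : C ≠ C' := by
      rintro rfl
      obtain ⟨v, hv, _, _, _, hends⟩ := exists_ends he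
      have hev : e ∈ K.star v := (hends v hv).2 (.inl rfl)
      obtain ⟨b, c, heb, hec, hbc, hs⟩ := exists_star_eq hv hev
      have hb : b ∈ K.star v := by simp [hs]
      have hc : c ∈ K.star v := by simp [hs]
      have hm := hC.even.mem_of_mem hv heb hec hbc hs
      have p1 := h.card_pair hv hev hb heb
      have p2 := h.card_pair hv hev hc hec
      rw [Finset.card_eq_one] at p1 p2
      obtain ⟨x, hx⟩ := p1
      obtain ⟨y, hy⟩ := p2
      have hx' : ∀ k, (k ∈ I ∧ e ∈ A k ∧ b ∈ A k) ↔ k = x := by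
        intro k; have := congrArg (k ∈ ·) hx; simpa using this
      have hy' : ∀ k, (k ∈ I ∧ e ∈ A k ∧ c ∈ A k) ↔ k = y := by
        intro k; have := congrArg (k ∈ ·) hy; simpa using this
      have a1 := @hCi b
      have a2 := @hCi c
      have a3 := @hCj b
      have a4 := @hCj c
      rcases hm with hm | hm | hm | hm
      · exact hij (((hx' i).1 ⟨hi.1, hi.2, a1 hm.2.1⟩).trans
          ((hx' j).1 ⟨hj.1, hj.2, a3 hm.2.1⟩).symm)
      · exact hij (((hy' i).1 ⟨hi.1, hi.2, a2 hm.2.2⟩).trans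
          ((hy' j).1 ⟨hj.1, hj.2, a4 hm.2.2⟩).symm)
      · exact hm.1 heC
      · exact hm.1 heC
    rw [Finset.card_eq_two]
    refine ⟨C, C', hne, ?_⟩
    ext D
    simp only [Finset.mem_filter, Finset.mem_powerset, Finset.mem_insert, Finset.mem_singleton]
    constructor
    · rintro ⟨⟨hDK, hD, k, hk, hDk⟩, heD⟩
      rcases (key k).1 ⟨hk, hDk heD⟩ with rfl | rfl
      · exact .inl ((h.even k hk).circuit_unique hDk hCi hD hC heD heC)
      · exact .inr ((h.even k hk).circuit_unique hDk hCj hD hC' heD heC')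
    · rintro (rfl | rfl)
      · exact ⟨⟨hC.even.1, hC, i, hi.1, hCi⟩, heC⟩
      · exact ⟨⟨hC'.even.1, hC', j, hj.1, hCj⟩, heC'⟩
  · rintro a e b ⟨u, hu, hau, heu⟩ ⟨v, hv, hev, hbv⟩
    constructor
    · rintro ⟨C, hC, ha, he, hb⟩
      obtain ⟨-, -, i, hi, hCi⟩ := Finset.mem_filter.1 hC
      exact ⟨i, hi, hCi ha, hCi he, hCi hb⟩
    · rintro ⟨i, hi, ha, he, hb⟩
      obtain ⟨C, hCi, hC, heC⟩ := (h.even i hi).exists_circuit he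
      refine ⟨C, ?_, ?_, heC, ?_⟩
      · simp only [Finset.mem_filter, Finset.mem_powerset]
        exact ⟨hC.even.1, hC, i, hi, hCi⟩
      · exact (h.even i hi).mem_of_subset hC.even hCi hu heu hau heC ha
      · exact (h.even i hi).mem_of_subset hC.even hCi hv hev hbv heC hb

/-- Even double covers that are told apart by paths of three edges give different circuit double
covers. -/
lemma card_le_card_cdcs {σ ι : Type*} (S : Finset σ) (I : σ → Finset ι) (A : σ → ι → Finset E)
    (h : ∀ s ∈ S, K.IsEvenDoubleCover (I s) (A s))
    (hsep : ∀ s ∈ S, ∀ t ∈ S, s ≠ t → ∃ a e b, K.Meets a e ∧ K.Meets e b ∧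
      ¬ ((∃ i ∈ I s, a ∈ A s i ∧ e ∈ A s i ∧ b ∈ A s i) ↔
        ∃ i ∈ I t, a ∈ A t i ∧ e ∈ A t i ∧ b ∈ A t i)) :
    S.card ≤ K.cdcs.card := by
  have hex : ∀ s, ∃ 𝒞, s ∈ S → (K.IsCDC 𝒞 ∧ ∀ a e b, K.Meets a e → K.Meets e b →
        ((∃ C ∈ 𝒞, a ∈ C ∧ e ∈ C ∧ b ∈ C) ↔ ∃ i ∈ I s, a ∈ A s i ∧ e ∈ A s i ∧ b ∈ A s i)) := by
    intro s
    by_cases hs : s ∈ S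
    · obtain ⟨𝒞, h𝒞⟩ := (h s hs).exists_cdc
      exact ⟨𝒞, fun _ => h𝒞⟩
    · exact ⟨∅, fun h => absurd h hs⟩
  choose f hf using hex
  refine Finset.card_le_card_of_injOn f (fun s hs => mem_cdcs.2 (hf s hs).1) ?_
  intro s hs t ht hst
  by_contra hne
  obtain ⟨a, e, b, h1, h2, h3⟩ := hsep s hs t ht hne
  apply h3
  rw [← (hf s hs).2 a e b h1 h2, ← (hf t ht).2 a e b h1 h2, hst]

end FacedCubic

namespace FacedCubic

variable {V E Φ : Type*} (K : FacedCubic V E Φ)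

/-! ### Contraction of one side of a cut of three edges -/

/-- The edges with an end outside `S`. -/
noncomputable def outer (S : Finset V) : Finset E :=
  K.edges.filter fun e => ∃ v ∈ K.verts \ S, e ∈ K.star v

/-- The map that contracts `S` to the vertex `s`. -/
noncomputable def collapse (S : Finset V) (s v : V) : V := if v ∈ S then s else v

/-- The edges at the vertices after the contraction of `S` to `s`. -/
noncomputable def contractStar (S : Finset V) (s : V) : V → Finset E :=
  Function.update K.star s (K.cut S)

variable {K}

lemma outer_subset (S : Finset V) : K.outer S ⊆ K.edges := Finset.filter_subset _ _

lemma mem_outer_iff {S : Finset V} {e : E} (he : e ∈ K.edges) {x y : V} (hx : x ∈ K.verts)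
    (hy : y ∈ K.verts) (h : ∀ v ∈ K.verts, e ∈ K.star v ↔ v = x ∨ v = y) :
    e ∈ K.outer S ↔ x ∉ S ∨ y ∉ S := by
  simp only [outer, Finset.mem_filter, Finset.mem_sdiff, he, true_and]
  grind

lemma cut_subset_outer {S : Finset V} (hS : S ⊆ K.verts) : K.cut S ⊆ K.outer S := by
  intro e he
  have heK := K.cut_subset S he
  obtain ⟨x, hx, y, hy, hxy, h⟩ := exists_ends heK
  rw [mem_outer_iff heK hx hy h]
  rw [mem_cut_iff hS heK hxy h] at he
  tauto

lemma star_subset_outer {S : Finset V} {v : V} (hv : v ∈ K.verts) (hvS : v ∉ S) :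
    K.star v ⊆ K.outer S := by
  intro e he
  simp only [outer, Finset.mem_filter]
  exact ⟨K.star_subset v hv he, v, by simp [hv, hvS], he⟩

lemma outer_union_outer_compl (S : Finset V) :
    K.outer S ∪ K.outer (K.verts \ S) = K.edges := by
  ext e
  refine ⟨fun h => ?_, fun h => ?_⟩
  · rcases Finset.mem_union.1 h with h | h <;> exact outer_subset _ h
  · obtain ⟨x, hx, y, hy, hxy, hE⟩ := exists_ends h
    rw [Finset.mem_union, mem_outer_iff h hx hy hE, mem_outer_iff h hx hy hE]
    simp only [Finset.mem_sdiff]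
    tauto

lemma outer_inter_outer_compl {S : Finset V} (hS : S ⊆ K.verts) :
    K.outer S ∩ K.outer (K.verts \ S) = K.cut S := by
  ext e
  by_cases he : e ∈ K.edges
  · obtain ⟨x, hx, y, hy, hxy, hE⟩ := exists_ends he
    rw [Finset.mem_inter, mem_outer_iff he hx hy hE, mem_outer_iff he hx hy hE,
      mem_cut_iff hS he hxy hE]
    simp only [Finset.mem_sdiff, hx, hy]
    tauto
  · exact ⟨fun h => absurd (outer_subset _ (Finset.mem_inter.1 h).1) he,
      fun h => absurd (K.cut_subset _ h) he⟩

section Contract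

variable {S : Finset V} {s : V}

lemma contractStar_self : K.contractStar S s s = K.cut S := by simp [contractStar]

lemma contractStar_of_notMem (hs : s ∈ S) {v : V} (hv : v ∉ S) :
    K.contractStar S s v = K.star v := by
  rw [contractStar, Function.update_of_ne]
  rintro rfl
  exact hv hs

lemma contract_ends (hS : S ⊆ K.verts) (hs : s ∈ S) {e : E} (he : e ∈ K.outer S) {x y : V}
    (hx : x ∈ K.verts) (hy : y ∈ K.verts) (hxy : x ≠ y)
    (h : ∀ v ∈ K.verts, e ∈ K.star v ↔ v = x ∨ v = y) :
    collapse S s x ≠ collapse S s y ∧ ∀ v ∈ insert s (K.verts \ S),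
      e ∈ K.contractStar S s v ↔ v = collapse S s x ∨ v = collapse S s y := by
  have heK := outer_subset _ he
  have h1 := (mem_outer_iff heK hx hy h).1 he
  have h2 := mem_cut_iff hS heK hxy h
  refine ⟨by simp only [collapse]; grind, fun v hv => ?_⟩
  simp only [contractStar, collapse]
  rcases Finset.mem_insert.1 hv with rfl | hv
  · rw [Function.update_self, h2]; grind
  · have hv' := Finset.mem_sdiff.1 hv
    have hvs : v ≠ s := fun h => hv'.2 (h ▸ hs)
    rw [Function.update_of_ne hvs, h v hv'.1]; grind

/-- The cuts of the contraction are the cuts of `K` by preimages under `collapse`. This transfers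
`conn` and `dual`. -/
lemma oddPart_contract (hS : S ⊆ K.verts) (hs : s ∈ S) {X : Finset V}
    (hX : X ⊆ insert s (K.verts \ S)) :
    oddPart (K.outer S) X (K.contractStar S s) =
      K.cut (K.verts.filter fun v => collapse S s v ∈ X) := by
  ext e
  by_cases heK : e ∈ K.edges
  · obtain ⟨x, hx, y, hy, hxy, h⟩ := exists_ends heK
    rw [mem_cut_iff (Finset.filter_subset _ _) heK hxy h, mem_oddPart]
    simp only [Finset.mem_filter, hx, hy, true_and]
    by_cases he : e ∈ K.outer S
    · obtain ⟨h1, h2⟩ := contract_ends hS hs he hx hy hxy h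
      rw [odd_card_filter_pair h1 hX h2]
      simp [he]
    · have := (mem_outer_iff heK hx hy h).not.1 he
      simp only [he, false_and, false_iff]
      simp only [collapse]
      grind
  · exact ⟨fun h => absurd (outer_subset _ (mem_oddPart.1 h).1) heK,
      fun h => absurd (K.cut_subset _ h) heK⟩

/-- A set of vertices that is one side of a cut of three edges is connected. -/
lemma subset_or_disjoint_of_cut_subset_outer (hS : S ⊆ K.verts) (hcut : (K.cut S).card = 3)
    {X : Finset V} (hX : X ⊆ K.verts) (hXS : K.cut X ⊆ K.outer S) : S ⊆ X ∨ Disjoint S X := by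
  have h1 : S ∩ X ⊆ K.verts := Finset.inter_subset_left.trans hS
  have h2 : S \ X ⊆ K.verts := Finset.sdiff_subset.trans hS
  -- No edge of the cut of `X` has both ends in `S`, so no edge joins `S ∩ X` to `S \ X`, and the
  -- cut of `S` is the disjoint union of the cuts of these two parts. Their sizes add up to 3 and
  -- neither is 1, so one of them is 0, and by `conn` that part is empty.
  have key : ∀ e, (e ∈ K.cut S ↔ e ∈ K.cut (S ∩ X) ∨ e ∈ K.cut (S \ X)) ∧
      ¬ (e ∈ K.cut (S ∩ X) ∧ e ∈ K.cut (S \ X)) := by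
    intro e
    by_cases he : e ∈ K.edges
    · obtain ⟨x, hx, y, hy, hxy, h⟩ := exists_ends he
      have a1 := @hXS e
      rw [mem_outer_iff he hx hy h, mem_cut_iff hX he hxy h] at a1
      rw [mem_cut_iff hS he hxy h, mem_cut_iff h1 he hxy h, mem_cut_iff h2 he hxy h]
      simp only [Finset.mem_inter, Finset.mem_sdiff]
      tauto
    · have : ∀ Y, e ∉ K.cut Y := fun Y h => he (K.cut_subset _ h)
      simp [this]
  have hun : K.cut S = K.cut (S ∩ X) ∪ K.cut (S \ X) := by
    ext e; rw [Finset.mem_union]; exact (key e).1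
  have hdis : Disjoint (K.cut (S ∩ X)) (K.cut (S \ X)) :=
    Finset.disjoint_left.2 fun e ha hb => (key e).2 ⟨ha, hb⟩
  have hcard := congrArg Finset.card hun
  rw [Finset.card_union_of_disjoint hdis, hcut] at hcard
  have n1 := card_cut_ne_one h1
  have n2 := card_cut_ne_one h2
  have hz : (K.cut (S ∩ X)).card = 0 ∨ (K.cut (S \ X)).card = 0 := by omega
  have hfull : ∀ Y ⊆ S, Y ≠ ∅ → K.cut Y = ∅ → False := by
    intro Y hY hne h0
    have := (K.conn Y (hY.trans hS) h0).resolve_left hne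
    have : S = Y := (hS.trans this.ge).antisymm hY
    rw [this, h0] at hcut
    simp at hcut
  rcases hz with h0 | h0
  · right
    rw [Finset.disjoint_iff_inter_eq_empty]
    by_contra hne
    exact hfull _ Finset.inter_subset_left hne (Finset.card_eq_zero.1 h0)
  · left
    rw [← Finset.sdiff_eq_empty_iff_subset]
    by_contra hne
    exact hfull _ Finset.sdiff_subset hne (Finset.card_eq_zero.1 h0)

variable (K) in
/-- The contraction of one side `S` of a cut of three edges to the vertex `s`. -/
noncomputable def contract (hS : S ⊆ K.verts) (hcut : (K.cut S).card = 3) (hs : s ∈ S) :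
    FacedCubic V E Φ where
  verts := insert s (K.verts \ S)
  edges := K.outer S
  -- Faces that lie inside `S` lose all their edges and are dropped, so that boundaries stay
  -- nonempty.
  faces := K.faces.filter fun φ => (K.bd φ ∩ K.outer S).Nonempty
  star := K.contractStar S s
  bd φ := K.bd φ ∩ K.outer S
  star_subset v hv := by
    rcases Finset.mem_insert.1 hv with rfl | hv
    · rw [contractStar_self]; exact cut_subset_outer hS
    · have hv' := Finset.mem_sdiff.1 hv
      rw [contractStar_of_notMem hs hv'.2]
      exact star_subset_outer hv'.1 hv'.2
  card_star v hv := by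
    rcases Finset.mem_insert.1 hv with rfl | hv
    · rw [contractStar_self, hcut]
    · have hv' := Finset.mem_sdiff.1 hv
      rw [contractStar_of_notMem hs hv'.2, K.card_star v hv'.1]
  card_ends e he := by
    obtain ⟨x, hx, y, hy, hxy, h⟩ := exists_ends (outer_subset _ he)
    obtain ⟨h1, h2⟩ := contract_ends hS hs he hx hy hxy h
    rw [Finset.card_eq_two]
    refine ⟨_, _, h1, ?_⟩
    ext v
    simp only [Finset.mem_filter]
    rw [Finset.mem_insert (b := collapse S s x), Finset.mem_singleton]
    refine ⟨fun hv => (h2 v hv.1).1 hv.2, fun hv => ?_⟩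
    have hv1 : v ∈ insert s (K.verts \ S) := by
      simp only [collapse] at hv
      simp only [Finset.mem_insert, Finset.mem_sdiff]
      grind
    exact ⟨hv1, (h2 v hv1).2 hv⟩
  bd_subset φ _ := Finset.inter_subset_right
  bd_nonempty φ hφ := (Finset.mem_filter.1 hφ).2
  bd_even φ hφ v hv := by
    have hφ' := (Finset.mem_filter.1 hφ).1
    rcases Finset.mem_insert.1 hv with rfl | hv
    · rw [contractStar_self, Finset.inter_assoc,
        Finset.inter_eq_right.2 (cut_subset_outer hS)]
      exact even_bd_inter_cut hS hφ'
    · have hv' := Finset.mem_sdiff.1 hv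
      rw [contractStar_of_notMem hs hv'.2, Finset.inter_assoc,
        Finset.inter_eq_right.2 (star_subset_outer hv'.1 hv'.2)]
      exact K.bd_even φ hφ' v hv'.1
  card_sides e he := by
    rw [← K.card_sides e (outer_subset _ he)]
    congr 1
    ext φ
    simp only [Finset.mem_filter, Finset.mem_inter, he, and_true]
    exact ⟨fun h => ⟨h.1.1, h.2⟩, fun h => ⟨⟨h.1, e, Finset.mem_inter.2 ⟨h.2, he⟩⟩, h.2⟩⟩
  conn X hX h := by
    rw [oddPart_contract hS hs hX] at h
    have hc := K.conn _ (Finset.filter_subset _ _) h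
    rcases hc with hc | hc
    · left
      rw [Finset.filter_eq_empty_iff] at hc
      rw [Finset.eq_empty_iff_forall_notMem]
      intro v hv
      rcases Finset.mem_insert.1 (hX hv) with rfl | hv'
      · exact hc (hS hs) (by simpa [collapse, hs] using hv)
      · have hv' := Finset.mem_sdiff.1 hv'
        exact hc hv'.1 (by simpa [collapse, hv'.2] using hv)
    · right
      rw [Finset.filter_eq_self] at hc
      refine hX.antisymm fun v hv => ?_
      rcases Finset.mem_insert.1 hv with rfl | hv'
      · simpa [collapse, hs] using hc _ (hS hs)
      · have hv' := Finset.mem_sdiff.1 hv'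
        simpa [collapse, hv'.2] using hc _ hv'.1
  dual D hD hcard hev := by
    obtain ⟨X, hX, hXD⟩ := K.dual D (hD.trans (outer_subset _)) hcard (by
      intro φ hφ
      by_cases hne : (K.bd φ ∩ K.outer S).Nonempty
      · have := hev φ (Finset.mem_filter.2 ⟨hφ, hne⟩)
        rwa [Finset.inter_assoc, Finset.inter_eq_right.2 hD] at this
      · have : K.bd φ ∩ D = ∅ := by
          rw [Finset.eq_empty_iff_forall_notMem]
          intro e he
          exact hne ⟨e, Finset.mem_inter.2 ⟨(Finset.mem_inter.1 he).1,
            hD (Finset.mem_inter.1 he).2⟩⟩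
        simp [this])
    -- `X` does not split `S`, so it is a preimage under `collapse` and descends to the contraction.
    have hsub := subset_or_disjoint_of_cut_subset_outer hS hcut hX (hXD.trans_subset hD)
    refine ⟨(insert s (K.verts \ S)).filter (· ∈ X), Finset.filter_subset _ _, ?_⟩
    rw [oddPart_contract hS hs (Finset.filter_subset _ _), ← hXD]
    congr 1
    ext v
    simp only [Finset.mem_filter, Finset.mem_insert, Finset.mem_sdiff, collapse]
    rcases hsub with h | h
    · have := @h v
      have := @h s hs
      have := @hX v
      grind
    · have a1 : v ∈ S → v ∉ X := fun hv => Finset.disjoint_left.1 h hv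
      have a2 := Finset.disjoint_left.1 h hs
      have := @hX v
      grind

lemma isEven_contract_iff (hS : S ⊆ K.verts) (hcut : (K.cut S).card = 3) (hs : s ∈ S)
    {C : Finset E} : (K.contract hS hcut hs).IsEven C ↔ C ⊆ K.outer S ∧
      Even (C ∩ K.cut S).card ∧ ∀ v ∈ K.verts, v ∉ S → Even (C ∩ K.star v).card := by
  simp only [IsEven, contract, Finset.mem_insert, Finset.mem_sdiff]
  constructor
  · rintro ⟨h1, h2⟩
    refine ⟨h1, ?_, fun v hv hvS => ?_⟩
    · simpa [contractStar_self] using h2 s (.inl rfl)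
    · simpa [contractStar_of_notMem hs hvS] using h2 v (.inr ⟨hv, hvS⟩)
  · rintro ⟨h1, h2, h3⟩
    refine ⟨h1, ?_⟩
    rintro v (rfl | ⟨hv, hvS⟩)
    · simpa [contractStar_self] using h2
    · simpa [contractStar_of_notMem hs hvS] using h3 v hv hvS

lemma IsEven.contract (hS : S ⊆ K.verts) (hcut : (K.cut S).card = 3) (hs : s ∈ S)
    {C : Finset E} (hC : K.IsEven C) : (K.contract hS hcut hs).IsEven (C ∩ K.outer S) := by
  rw [isEven_contract_iff]
  refine ⟨Finset.inter_subset_right, ?_, fun v hv hvS => ?_⟩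
  · rw [Finset.inter_assoc, Finset.inter_eq_right.2 (cut_subset_outer hS)]
    refine even_card_inter_oddPart_of_even hC.1 fun v hv => ?_
    rw [Finset.inter_comm]
    exact hC.2 v (hS hv)
  · rw [Finset.inter_assoc, Finset.inter_eq_right.2 (star_subset_outer hv hvS)]
    exact hC.2 v hv

lemma isEven_of_contract (hS : S ⊆ K.verts) (hcut : (K.cut S).card = 3) (hs : s ∈ S)
    (hcut' : (K.cut (K.verts \ S)).card = 3) {t : V} (ht : t ∈ K.verts \ S) {C : Finset E}
    (hC : C ⊆ K.edges) (h1 : (K.contract hS hcut hs).IsEven (C ∩ K.outer S))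
    (h2 : (K.contract Finset.sdiff_subset hcut' ht).IsEven (C ∩ K.outer (K.verts \ S))) :
    K.IsEven C := by
  rw [isEven_contract_iff] at h1 h2
  refine ⟨hC, fun v hv => ?_⟩
  by_cases hvS : v ∈ S
  · have hvS' : v ∉ K.verts \ S := by simp [hvS]
    have := h2.2.2 v hv hvS'
    rwa [Finset.inter_assoc, Finset.inter_eq_right.2 (star_subset_outer hv hvS')] at this
  · have := h1.2.2 v hv hvS
    rwa [Finset.inter_assoc, Finset.inter_eq_right.2 (star_subset_outer hv hvS)] at this

end Contract

/-! ### Gluing circuit double covers along a cut of three edges -/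

lemma IsEven.card_inter_star {C : Finset E} (hC : K.IsEven C) {v : V} (hv : v ∈ K.verts)
    (hne : (C ∩ K.star v).Nonempty) : (C ∩ K.star v).card = 2 := by
  have h1 := hC.2 v hv
  have h2 : (C ∩ K.star v).card ≤ 3 :=
    (Finset.card_le_card Finset.inter_subset_right).trans (K.card_star v hv).le
  have h3 := Finset.card_pos.2 hne
  interval_cases h : (C ∩ K.star v).card <;> simp_all +decide

/-- A circuit meets a star in no or two edges, and each pair of edges at a vertex lies in exactly
one circuit of the cover. So the circuits through a vertex are indexed by the three pairs of edges
there. -/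
lemma IsCDC.existsUnique_inter_star {𝒞 : Finset (Finset E)} (h : K.IsCDC 𝒞) {v : V}
    (hv : v ∈ K.verts) {P : Finset E} (hP : P ⊆ K.star v) (hPc : P.card = 2) :
    ∃! C, C ∈ 𝒞 ∧ C ∩ K.star v = P := by
  obtain ⟨a, b, hab, rfl⟩ := Finset.card_eq_two.1 hPc
  have ha : a ∈ K.star v := hP (by simp)
  have hb : b ∈ K.star v := hP (by simp)
  have h1 := h.isEvenDoubleCover.card_pair hv ha hb hab
  obtain ⟨C, hC⟩ := Finset.card_eq_one.1 h1
  have key : ∀ D, D ∈ 𝒞 ∧ a ∈ D ∧ b ∈ D ↔ D = C := by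
    intro D
    have := congrArg (D ∈ ·) hC
    simpa using this
  have hiff : ∀ D, D ∈ 𝒞 ∧ D ∩ K.star v = {a, b} ↔ D ∈ 𝒞 ∧ a ∈ D ∧ b ∈ D := by
    intro D
    refine and_congr_right fun hD => ⟨fun h => ?_, fun h' => ?_⟩
    · have h1 : a ∈ D ∩ K.star v := by simp [h]
      have h2 : b ∈ D ∩ K.star v := by simp [h]
      exact ⟨(Finset.mem_inter.1 h1).1, (Finset.mem_inter.1 h2).1⟩
    · have h3 : ({a, b} : Finset E) ⊆ D ∩ K.star v := by
        intro x hx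
        rcases Finset.mem_insert.1 hx with rfl | hx
        · simp [h'.1, ha]
        · rw [Finset.mem_singleton.1 hx]; simp [h'.2, hb]
      refine (Finset.eq_of_subset_of_card_le h3 ?_).symm
      rw [(h.circuit D hD).even.card_inter_star hv ⟨a, h3 (by simp)⟩, hPc]
  exact ⟨C, (hiff C).2 ((key C).2 rfl), fun D hD => (key D).1 ((hiff D).1 hD)⟩

/-- The sets of edges that restrict to members of `𝒞₁` and `𝒞₂` that agree on the common edges. -/
noncomputable def glue (E₁ E₂ : Finset E) (𝒞₁ 𝒞₂ : Finset (Finset E)) : Finset (Finset E) :=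
  (E₁ ∪ E₂).powerset.filter fun D => D.Nonempty ∧ (D ∩ E₁ = ∅ ∨ D ∩ E₁ ∈ 𝒞₁) ∧
    (D ∩ E₂ = ∅ ∨ D ∩ E₂ ∈ 𝒞₂) ∧ (D ∩ (E₁ ∩ E₂) = ∅ → D ∩ E₁ = ∅ ∨ D ∩ E₂ = ∅)

section Glue

variable {E₁ E₂ : Finset E} {𝒞₁ 𝒞₂ : Finset (Finset E)}

lemma mem_glue {D : Finset E} : D ∈ glue E₁ E₂ 𝒞₁ 𝒞₂ ↔ D ⊆ E₁ ∪ E₂ ∧ D.Nonempty ∧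
    (D ∩ E₁ = ∅ ∨ D ∩ E₁ ∈ 𝒞₁) ∧ (D ∩ E₂ = ∅ ∨ D ∩ E₂ ∈ 𝒞₂) ∧
      (D ∩ (E₁ ∩ E₂) = ∅ → D ∩ E₁ = ∅ ∨ D ∩ E₂ = ∅) := by
  simp only [glue, Finset.mem_filter, Finset.mem_powerset]

lemma glue_comm : glue E₁ E₂ 𝒞₁ 𝒞₂ = glue E₂ E₁ 𝒞₂ 𝒞₁ := by
  ext D
  rw [mem_glue, mem_glue, Finset.union_comm, Finset.inter_comm E₁ E₂]
  tauto

/-- A member that meets the common edges is joined with its partner on the other side; one that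
avoids them is already a member of the glued family. -/
lemma exists_mem_glue (h₁ : ∀ C ∈ 𝒞₁, C ⊆ E₁ ∧ C.Nonempty) (h₂ : ∀ C ∈ 𝒞₂, C ⊆ E₂)
    (hp : ∀ C ∈ 𝒞₁, (C ∩ (E₁ ∩ E₂)).Nonempty →
      ∃ C' ∈ 𝒞₂, C' ∩ (E₁ ∩ E₂) = C ∩ (E₁ ∩ E₂)) {C : Finset E} (hC : C ∈ 𝒞₁) :
    ∃ D ∈ glue E₁ E₂ 𝒞₁ 𝒞₂, D ∩ E₁ = C := by
  obtain ⟨hCE, hne⟩ := h₁ C hC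
  by_cases hδ : (C ∩ (E₁ ∩ E₂)).Nonempty
  · obtain ⟨C', hC', hCC⟩ := hp C hC hδ
    have hCE' := h₂ C' hC'
    have key : ∀ x, (x ∈ C' ∧ x ∈ E₁ ∧ x ∈ E₂) ↔ (x ∈ C ∧ x ∈ E₁ ∧ x ∈ E₂) := by
      intro x; have := congrArg (x ∈ ·) hCC; simpa using this
    have e1 : (C ∪ C') ∩ E₁ = C := by
      ext x; have := key x; have := @hCE x; have := @hCE' x
      simp only [Finset.mem_inter, Finset.mem_union]; tauto
    have e2 : (C ∪ C') ∩ E₂ = C' := by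
      ext x; have := key x; have := @hCE x; have := @hCE' x
      simp only [Finset.mem_inter, Finset.mem_union]; tauto
    refine ⟨C ∪ C', mem_glue.2 ⟨Finset.union_subset_union hCE hCE', hne.mono
      Finset.subset_union_left, .inr (by rwa [e1]), .inr (by rwa [e2]), fun h => ?_⟩, e1⟩
    obtain ⟨x, hx⟩ := hδ
    have : x ∈ (C ∪ C') ∩ (E₁ ∩ E₂) := by
      simp only [Finset.mem_inter, Finset.mem_union] at hx ⊢; tauto
    simp [h] at this
  · rw [Finset.not_nonempty_iff_eq_empty] at hδ
    have e1 : C ∩ E₁ = C := Finset.inter_eq_left.2 hCE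
    have e2 : C ∩ E₂ = ∅ := by
      rw [← hδ, ← Finset.inter_assoc, e1]
    exact ⟨C, mem_glue.2 ⟨hCE.trans Finset.subset_union_left, hne, .inr (e1.symm ▸ hC), .inl e2,
      fun _ => .inr e2⟩, e1⟩

/-- The part in `E₁` fixes the part on the common edges. If that is nonempty it determines the
partner in `𝒞₂`; if it is empty, the last clause in `glue` forces the part in `E₂` to be empty. -/
lemma glue_inter_injective
    (hp : ∀ C ∈ 𝒞₁, (C ∩ (E₁ ∩ E₂)).Nonempty → ∀ C' ∈ 𝒞₂, ∀ C'' ∈ 𝒞₂,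
      C' ∩ (E₁ ∩ E₂) = C ∩ (E₁ ∩ E₂) → C'' ∩ (E₁ ∩ E₂) = C ∩ (E₁ ∩ E₂) → C' = C'')
    {D D' : Finset E} (hD : D ∈ glue E₁ E₂ 𝒞₁ 𝒞₂) (hD' : D' ∈ glue E₁ E₂ 𝒞₁ 𝒞₂)
    (hDD : D ∩ E₁ = D' ∩ E₁) (hne : (D ∩ E₁).Nonempty) : D = D' := by
  rw [mem_glue] at hD hD'
  have hD1 : D ∩ E₁ ∈ 𝒞₁ := hD.2.2.1.resolve_left hne.ne_empty
  have hin : ∀ X : Finset E, X ∩ (E₁ ∩ E₂) = X ∩ E₁ ∩ (E₁ ∩ E₂) := by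
    intro X; ext; simp
  have hin2 : ∀ X : Finset E, X ∩ (E₁ ∩ E₂) = X ∩ E₂ ∩ (E₁ ∩ E₂) := by
    intro X; ext; simp
  have hδ : D ∩ (E₁ ∩ E₂) = D' ∩ (E₁ ∩ E₂) := by rw [hin D, hin D', hDD]
  have h2 : D ∩ E₂ = D' ∩ E₂ := by
    by_cases hd : D ∩ (E₁ ∩ E₂) = ∅
    · rw [(hD.2.2.2.2 hd).resolve_left hne.ne_empty,
        (hD'.2.2.2.2 (hδ ▸ hd)).resolve_left (hDD ▸ hne.ne_empty)]
    · have a1 : D ∩ E₂ ≠ ∅ := fun h => hd (by rw [hin2, h, Finset.empty_inter])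
      have a2 : D' ∩ E₂ ≠ ∅ := fun h => hd (by rw [hδ, hin2, h, Finset.empty_inter])
      refine hp _ hD1 ?_ _ (hD.2.2.2.1.resolve_left a1) _ (hD'.2.2.2.1.resolve_left a2) ?_ ?_
      · rw [← hin]; exact Finset.nonempty_iff_ne_empty.2 hd
      · rw [← hin, ← hin2]
      · rw [← hin, ← hin2, hδ]
  have hU : ∀ X : Finset E, X ⊆ E₁ ∪ E₂ → X = (X ∩ E₁) ∪ (X ∩ E₂) := by
    intro X hX; rw [← Finset.inter_union_distrib_left, Finset.inter_eq_left.2 hX]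
  rw [hU D hD.1, hU D' hD'.1, hDD, h2]

/-- Restriction to `E₁` is a bijection between the members that contain `e`, so gluing keeps the
multiplicity with which `e` is covered. -/
lemma card_filter_glue (h₁ : ∀ C ∈ 𝒞₁, C ⊆ E₁ ∧ C.Nonempty) (h₂ : ∀ C ∈ 𝒞₂, C ⊆ E₂)
    (hp : ∀ C ∈ 𝒞₁, (C ∩ (E₁ ∩ E₂)).Nonempty →
      ∃! C', C' ∈ 𝒞₂ ∧ C' ∩ (E₁ ∩ E₂) = C ∩ (E₁ ∩ E₂)) {e : E} (he : e ∈ E₁) :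
    ((glue E₁ E₂ 𝒞₁ 𝒞₂).filter fun D => e ∈ D).card = (𝒞₁.filter fun C => e ∈ C).card := by
  refine Finset.card_nbij (· ∩ E₁) ?_ ?_ ?_
  · intro D hD
    obtain ⟨hD, heD⟩ := Finset.mem_filter.1 hD
    have : e ∈ D ∩ E₁ := Finset.mem_inter.2 ⟨heD, he⟩
    exact Finset.mem_filter.2
      ⟨(mem_glue.1 hD).2.2.1.resolve_left (Finset.ne_empty_of_mem this), this⟩
  · intro D hD D' hD' hDD
    obtain ⟨hD, heD⟩ := Finset.mem_filter.1 hD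
    refine glue_inter_injective ?_ hD (Finset.mem_filter.1 hD').1 hDD
      ⟨e, Finset.mem_inter.2 ⟨heD, he⟩⟩
    intro C hC hne C' hC' C'' hC'' h' h''
    exact (hp C hC hne).unique ⟨hC', h'⟩ ⟨hC'', h''⟩
  · intro C hC
    obtain ⟨hC, heC⟩ := Finset.mem_filter.1 hC
    obtain ⟨D, hD, hDC⟩ := exists_mem_glue h₁ h₂ (fun C hC hne =>
      let ⟨C', h, _⟩ := hp C hC hne; ⟨C', h.1, h.2⟩) hC
    refine ⟨D, Finset.mem_coe.2 (Finset.mem_filter.2 ⟨hD, ?_⟩), hDC⟩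
    rw [← hDC] at heC
    exact (Finset.mem_inter.1 heC).1

/-- Recovers `𝒞₁` from the glued family, which makes gluing injective. -/
lemma image_glue (h₁ : ∀ C ∈ 𝒞₁, C ⊆ E₁ ∧ C.Nonempty) (h₂ : ∀ C ∈ 𝒞₂, C ⊆ E₂)
    (hp : ∀ C ∈ 𝒞₁, (C ∩ (E₁ ∩ E₂)).Nonempty →
      ∃ C' ∈ 𝒞₂, C' ∩ (E₁ ∩ E₂) = C ∩ (E₁ ∩ E₂)) :
    ((glue E₁ E₂ 𝒞₁ 𝒞₂).image (· ∩ E₁)).erase ∅ = 𝒞₁ := by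
  ext C
  simp only [Finset.mem_erase, Finset.mem_image]
  constructor
  · rintro ⟨hne, D, hD, rfl⟩
    exact (mem_glue.1 hD).2.2.1.resolve_left hne
  · intro hC
    exact ⟨(h₁ C hC).2.ne_empty, exists_mem_glue h₁ h₂ hp hC⟩

end Glue

/-- In both contractions the three cut edges form the star of the new vertex. A circuit that uses
two of them is matched with the only circuit on the other side that uses the same two. -/
lemma existsUnique_partner {S T : Finset V} {s t : V} (hS : S ⊆ K.verts)
    (hcut : (K.cut S).card = 3) (hs : s ∈ S) (hT : T ⊆ K.verts) (hcut' : (K.cut T).card = 3)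
    (ht : t ∈ T) (hST : K.cut S = K.cut T) {𝒞₁ 𝒞₂ : Finset (Finset E)}
    (h₁ : (K.contract hS hcut hs).IsCDC 𝒞₁) (h₂ : (K.contract hT hcut' ht).IsCDC 𝒞₂) :
    ∀ C ∈ 𝒞₁, (C ∩ K.cut S).Nonempty → ∃! C', C' ∈ 𝒞₂ ∧ C' ∩ K.cut S = C ∩ K.cut S := by
  intro C hC hne
  have e1 : (K.contract hS hcut hs).star s = K.cut S := contractStar_self
  have e2 : (K.contract hT hcut' ht).star t = K.cut S := contractStar_self.trans hST.symm
  have m1 : s ∈ (K.contract hS hcut hs).verts := Finset.mem_insert_self _ _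
  have m2 : t ∈ (K.contract hT hcut' ht).verts := Finset.mem_insert_self _ _
  have hc := (h₁.circuit C hC).even.card_inter_star m1 (e1.symm ▸ hne)
  rw [e1] at hc
  have := h₂.existsUnique_inter_star m2 (P := C ∩ K.cut S)
    (by rw [e2]; exact Finset.inter_subset_right) hc
  rwa [e2] at this

/-- Circuit double covers of the two contractions at a cut of three edges can be glued. -/
lemma card_cdcs_contract_mul_le {S : Finset V} {s t : V} (hS : S ⊆ K.verts)
    (hcut : (K.cut S).card = 3) (hs : s ∈ S) (hcut' : (K.cut (K.verts \ S)).card = 3)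
    (ht : t ∈ K.verts \ S) :
    (K.contract hS hcut hs).cdcs.card *
      (K.contract Finset.sdiff_subset hcut' ht).cdcs.card ≤ K.cdcs.card := by
  have hδ : K.outer S ∩ K.outer (K.verts \ S) = K.cut S := outer_inter_outer_compl hS
  have hδ' : K.outer (K.verts \ S) ∩ K.outer S = K.cut S := by rw [Finset.inter_comm, hδ]
  have hU : K.outer S ∪ K.outer (K.verts \ S) = K.edges := outer_union_outer_compl S
  have hcc : K.cut S = K.cut (K.verts \ S) := (cut_compl hS).symm
  rw [← Finset.card_product]
  have sub₁ : ∀ 𝒞, (K.contract hS hcut hs).IsCDC 𝒞 → ∀ C ∈ 𝒞, C ⊆ K.outer S ∧ C.Nonempty :=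
    fun 𝒞 h C hC => ⟨(h.circuit C hC).even.1, (h.circuit C hC).nonempty⟩
  have sub₂ : ∀ 𝒞, (K.contract Finset.sdiff_subset hcut' ht).IsCDC 𝒞 →
      ∀ C ∈ 𝒞, C ⊆ K.outer (K.verts \ S) ∧ C.Nonempty :=
    fun 𝒞 h C hC => ⟨(h.circuit C hC).even.1, (h.circuit C hC).nonempty⟩
  have part₁ : ∀ 𝒞₁ 𝒞₂, (K.contract hS hcut hs).IsCDC 𝒞₁ →
      (K.contract Finset.sdiff_subset hcut' ht).IsCDC 𝒞₂ → ∀ C ∈ 𝒞₁,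
      (C ∩ (K.outer S ∩ K.outer (K.verts \ S))).Nonempty → ∃! C', C' ∈ 𝒞₂ ∧
        C' ∩ (K.outer S ∩ K.outer (K.verts \ S)) = C ∩ (K.outer S ∩ K.outer (K.verts \ S)) := by
    intro 𝒞₁ 𝒞₂ h₁ h₂
    rw [hδ]
    exact existsUnique_partner hS hcut hs Finset.sdiff_subset hcut' ht hcc h₁ h₂
  have part₂ : ∀ 𝒞₁ 𝒞₂, (K.contract hS hcut hs).IsCDC 𝒞₁ →
      (K.contract Finset.sdiff_subset hcut' ht).IsCDC 𝒞₂ → ∀ C ∈ 𝒞₂,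
      (C ∩ (K.outer (K.verts \ S) ∩ K.outer S)).Nonempty → ∃! C', C' ∈ 𝒞₁ ∧
        C' ∩ (K.outer (K.verts \ S) ∩ K.outer S) = C ∩ (K.outer (K.verts \ S) ∩ K.outer S) := by
    intro 𝒞₁ 𝒞₂ h₁ h₂
    rw [hδ', hcc]
    exact existsUnique_partner Finset.sdiff_subset hcut' ht hS hcut hs hcc.symm h₂ h₁
  refine Finset.card_le_card_of_injOn
    (fun p => glue (K.outer S) (K.outer (K.verts \ S)) p.1 p.2) ?_ ?_
  · rintro ⟨𝒞₁, 𝒞₂⟩ hp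
    obtain ⟨h₁, h₂⟩ := Finset.mem_product.1 hp
    rw [mem_cdcs] at h₁ h₂
    refine Finset.mem_coe.2 (mem_cdcs.2 ⟨fun D hD => ?_, fun e he => ?_⟩)
    · obtain ⟨hDU, hne, hD₁, hD₂, hDδ⟩ := mem_glue.1 hD
      rw [hδ] at hDδ
      rw [hU] at hDU
      have hempty : ∀ K' : FacedCubic V E Φ, K'.IsEven ∅ := fun K' => ⟨by simp, by simp⟩
      refine ⟨isEven_of_contract hS hcut hs hcut' ht hDU ?_ ?_, hne, fun X hX hXe => ?_⟩
      · rcases hD₁ with h | h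
        · rw [h]; exact hempty _
        · exact (h₁.circuit _ h).even
      · rcases hD₂ with h | h
        · rw [h]; exact hempty _
        · exact (h₂.circuit _ h).even
      -- Minimality of `D`: on each side the trace of an even `X ⊆ D` is even in the contraction, so
      -- it is all or nothing of the trace of `D`.
      · have x1 : X ∩ K.outer S = D ∩ K.outer S ∨ (X ∩ K.outer S = ∅ ∧ D ∩ K.outer S ≠ ∅) := by
          rcases hD₁ with h | h
          · left
            rw [h, ← Finset.subset_empty, ← h]
            exact Finset.inter_subset_inter_right hX
          · rcases (h₁.circuit _ h).minimal _ (Finset.inter_subset_inter_right hX)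
              (hXe.contract hS hcut hs) with h' | h'
            · exact .inr ⟨h', (h₁.circuit _ h).nonempty.ne_empty⟩
            · exact .inl h'
        have x2 : X ∩ K.outer (K.verts \ S) = D ∩ K.outer (K.verts \ S) ∨
            (X ∩ K.outer (K.verts \ S) = ∅ ∧ D ∩ K.outer (K.verts \ S) ≠ ∅) := by
          rcases hD₂ with h | h
          · left
            rw [h, ← Finset.subset_empty, ← h]
            exact Finset.inter_subset_inter_right hX
          · rcases (h₂.circuit _ h).minimal _ (Finset.inter_subset_inter_right hX)
              (hXe.contract Finset.sdiff_subset hcut' ht) with h' | h'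
            · exact .inr ⟨h', (h₂.circuit _ h).nonempty.ne_empty⟩
            · exact .inl h'
        have hsplit : ∀ Y ⊆ K.edges, Y = (Y ∩ K.outer S) ∪ (Y ∩ K.outer (K.verts \ S)) := by
          intro Y hY
          rw [← Finset.inter_union_distrib_left, hU, Finset.inter_eq_left.2 hY]
        -- If `X` takes everything on one side and nothing on the other, `D` has no cut edge. Then
        -- the last clause in `glue` says that `D` lives on one side only.
        have hmixed : ∀ A B : Finset E, A ∩ B = K.cut S → X ∩ A = ∅ → D ∩ A ≠ ∅ →
            X ∩ B = D ∩ B → D ∩ K.cut S = ∅ := by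
          intro A B hAB h1 h2 h3
          rw [Finset.eq_empty_iff_forall_notMem]
          intro x hx
          rw [← hAB] at hx
          simp only [Finset.mem_inter] at hx
          have : x ∈ X ∩ B := by rw [h3]; simp [hx]
          have : x ∈ X ∩ A := by simp [hx, (Finset.mem_inter.1 this).1]
          simp [h1] at this
        rcases x1 with x1 | ⟨x1, x1'⟩ <;> rcases x2 with x2 | ⟨x2, x2'⟩
        · right; rw [hsplit X hXe.1, hsplit D hDU, x1, x2]
        · left
          have h0 := (hDδ (hmixed _ _ hδ' x2 x2' x1)).resolve_right x2'
          rw [hsplit X hXe.1, x1, x2, h0, Finset.empty_union]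
        · left
          have h0 := (hDδ (hmixed _ _ hδ x1 x1' x2)).resolve_left x1'
          rw [hsplit X hXe.1, x1, x2, h0, Finset.empty_union]
        · left; rw [hsplit X hXe.1, x1, x2, Finset.empty_union]
    · rw [← hU] at he
      rcases Finset.mem_union.1 he with he | he
      · rw [card_filter_glue (sub₁ _ h₁) (fun C hC => (sub₂ _ h₂ C hC).1) (part₁ _ _ h₁ h₂) he]
        exact h₁.card_eq e he
      · dsimp only
        rw [glue_comm, card_filter_glue (sub₂ _ h₂) (fun C hC => (sub₁ _ h₁ C hC).1)
          (part₂ _ _ h₁ h₂) he]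
        exact h₂.card_eq e he
  · rintro ⟨𝒞₁, 𝒞₂⟩ hp ⟨𝒟₁, 𝒟₂⟩ hq hpq
    obtain ⟨h₁, h₂⟩ := Finset.mem_product.1 hp
    obtain ⟨k₁, k₂⟩ := Finset.mem_product.1 hq
    rw [mem_cdcs] at h₁ h₂ k₁ k₂
    dsimp only at hpq h₁ h₂ k₁ k₂
    have r1 := image_glue (sub₁ _ h₁) (fun C hC => (sub₂ _ h₂ C hC).1) (fun C hC hne =>
      let ⟨C', h, _⟩ := part₁ _ _ h₁ h₂ C hC hne; ⟨C', h.1, h.2⟩)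
    have r2 := image_glue (sub₁ _ k₁) (fun C hC => (sub₂ _ k₂ C hC).1) (fun C hC hne =>
      let ⟨C', h, _⟩ := part₁ _ _ k₁ k₂ C hC hne; ⟨C', h.1, h.2⟩)
    have r3 := image_glue (sub₂ _ h₂) (fun C hC => (sub₁ _ h₁ C hC).1) (fun C hC hne =>
      let ⟨C', h, _⟩ := part₂ _ _ h₁ h₂ C hC hne; ⟨C', h.1, h.2⟩)
    have r4 := image_glue (sub₂ _ k₂) (fun C hC => (sub₁ _ k₁ C hC).1) (fun C hC hne =>
      let ⟨C', h, _⟩ := part₂ _ _ k₁ k₂ C hC hne; ⟨C', h.1, h.2⟩)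
    rw [hpq] at r1
    rw [glue_comm, hpq, glue_comm] at r3
    rw [← r1, ← r3, r2, r4]

/-- Every edge survives in at least one of the contractions, hence so does every face. -/
lemma card_faces_le_contract {S : Finset V} {s t : V} (hS : S ⊆ K.verts)
    (hcut : (K.cut S).card = 3) (hs : s ∈ S) (hcut' : (K.cut (K.verts \ S)).card = 3)
    (ht : t ∈ K.verts \ S) : K.faces.card ≤ (K.contract hS hcut hs).faces.card +
      (K.contract Finset.sdiff_subset hcut' ht).faces.card := by
  refine le_trans (Finset.card_le_card ?_) (Finset.card_union_le _ _)
  intro φ hφ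
  obtain ⟨e, he⟩ := K.bd_nonempty φ hφ
  have heK := K.bd_subset φ hφ he
  rw [← outer_union_outer_compl S] at heK
  rcases Finset.mem_union.1 heK with h | h
  · exact Finset.mem_union_left _ (Finset.mem_filter.2 ⟨hφ, e, Finset.mem_inter.2 ⟨he, h⟩⟩)
  · exact Finset.mem_union_right _ (Finset.mem_filter.2 ⟨hφ, e, Finset.mem_inter.2 ⟨he, h⟩⟩)

lemma card_verts_contract {S : Finset V} {s : V} (hS : S ⊆ K.verts)
    (hcut : (K.cut S).card = 3) (hs : s ∈ S) :
    (K.contract hS hcut hs).verts.card = (K.verts \ S).card + 1 :=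
  Finset.card_insert_of_notMem (by simp [hs])

end FacedCubic

namespace FacedCubic

variable {V E Φ : Type*} {K : FacedCubic V E Φ}

/-! ### The local structure in the absence of small cuts -/

variable (K) in
/-- There are no cuts of two edges and only trivial cuts of three edges, and there are at least
four vertices. -/
structure Tight : Prop where
  card_ne_two : ∀ X ⊆ K.verts, (K.cut X).card ≠ 2
  eq_star : ∀ X ⊆ K.verts, (K.cut X).card = 3 → ∃ v ∈ K.verts, K.cut X = K.star v
  four_le : 4 ≤ K.verts.card

lemma mem_cut_insert {X : Finset V} {v : V} (hv : v ∉ X) (hvK : v ∈ K.verts) {e : E} :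
    e ∈ K.cut (insert v X) ↔ ¬ (e ∈ K.cut X ↔ e ∈ K.star v) := by
  rw [mem_oddPart, mem_oddPart, Finset.filter_insert]
  by_cases he : e ∈ K.edges
  · by_cases h : e ∈ K.star v
    · have : v ∉ X.filter fun i => e ∈ K.star i := fun h => hv (Finset.mem_filter.1 h).1
      simp only [he, h, if_true, Finset.card_insert_of_notMem this, true_and, iff_true]
      exact Nat.odd_add_one
    · simp [he, h]
  · have : e ∉ K.star v := fun h => he (K.star_subset v hvK h)
    simp [he, this]

lemma mem_cut_pair {x y : V} (hx : x ∈ K.verts) (hy : y ∈ K.verts) (hxy : x ≠ y) {e : E} :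
    e ∈ K.cut {x, y} ↔ ¬ (e ∈ K.star x ↔ e ∈ K.star y) := by
  rw [mem_cut_insert (by simpa using hxy) hx, cut_singleton hy]
  tauto

/-- Two parallel edges leave at most one further edge at each of `x` and `y`. The cut of `{x, y}` is
even, hence of size 0 or 2: the latter is excluded by `Tight`, the former by connectedness and the
presence of four vertices. -/
lemma Tight.eq_of_mem_star (hK : K.Tight) {x y : V} (hx : x ∈ K.verts) (hy : y ∈ K.verts)
    (hxy : x ≠ y) {a b : E} (hax : a ∈ K.star x) (hay : a ∈ K.star y) (hbx : b ∈ K.star x)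
    (hby : b ∈ K.star y) : a = b := by
  by_contra hab
  obtain ⟨c, hac, hbc, hsx⟩ := star_eq_triple hx hax hbx hab
  obtain ⟨d, had, hbd, hsy⟩ := star_eq_triple hy hay hby hab
  have hX : ({x, y} : Finset V) ⊆ K.verts := by
    intro z hz
    rcases Finset.mem_insert.1 hz with rfl | hz
    · exact hx
    · rwa [Finset.mem_singleton.1 hz]
  have hsub : K.cut {x, y} ⊆ {c, d} := by
    intro e he
    rw [mem_cut_pair hx hy hxy, hsx, hsy] at he
    simp only [Finset.mem_insert, Finset.mem_singleton] at he ⊢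
    tauto
  have hle : (K.cut {x, y}).card ≤ 2 := (Finset.card_le_card hsub).trans Finset.card_le_two
  have hp := (even_card_cut_iff hX).2 (by simp [Finset.card_pair hxy])
  have h2 := hK.card_ne_two _ hX
  have h0 : (K.cut {x, y}).card = 0 := by
    interval_cases h : (K.cut {x, y}).card <;> simp_all +decide
  rcases K.conn _ hX (Finset.card_eq_zero.1 h0) with h | h
  · simp at h
  · have := hK.four_le
    rw [← h, Finset.card_pair hxy] at this
    omega

lemma mem_bd_iff {A B : Φ} (hA : A ∈ K.faces) (hB : B ∈ K.faces) (hAB : A ≠ B) {e : E}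
    (heA : e ∈ K.bd A) (heB : e ∈ K.bd B) : ∀ φ ∈ K.faces, e ∈ K.bd φ ↔ φ = A ∨ φ = B := by
  obtain ⟨C, hC, hAC, h⟩ := exists_other_side (K.bd_subset A hA heA) hA heA
  rcases (h B hB).1 heB with rfl | rfl
  · exact absurd rfl hAB
  · exact h

/-- Two common edges of `A` and `B` would meet every face in no or two edges, so by `dual` they
would form a cut of two edges. -/
lemma Tight.edge_unique (hK : K.Tight) {A B : Φ} (hA : A ∈ K.faces) (hB : B ∈ K.faces)
    (hAB : A ≠ B) {e g : E} (heA : e ∈ K.bd A) (heB : e ∈ K.bd B) (hgA : g ∈ K.bd A)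
    (hgB : g ∈ K.bd B) : e = g := by
  by_contra heg
  have h1 := mem_bd_iff hA hB hAB heA heB
  have h2 := mem_bd_iff hA hB hAB hgA hgB
  obtain ⟨X, hX, hc⟩ := K.dual {e, g} (by
    intro x hx
    rcases Finset.mem_insert.1 hx with rfl | hx
    · exact K.bd_subset A hA heA
    · rw [Finset.mem_singleton.1 hx]; exact K.bd_subset A hA hgA)
    (.inl (Finset.card_pair heg)) (by
      intro φ hφ
      have k1 := h1 φ hφ
      have k2 := h2 φ hφ
      by_cases h : φ = A ∨ φ = B
      · have : K.bd φ ∩ {e, g} = {e, g} := Finset.inter_eq_right.2 (by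
          intro x hx
          rcases Finset.mem_insert.1 hx with rfl | hx
          · exact k1.2 h
          · rw [Finset.mem_singleton.1 hx]; exact k2.2 h)
        rw [this, Finset.card_pair heg]; decide
      · have : K.bd φ ∩ {e, g} = ∅ := by
          ext x; simp only [Finset.mem_inter, Finset.mem_insert, Finset.mem_singleton,
            Finset.notMem_empty, iff_false]
          rintro ⟨hx, rfl | rfl⟩
          · exact h (k1.1 hx)
          · exact h (k2.1 hx)
        simp [this])
  exact hK.card_ne_two X hX (by rw [show K.cut X = _ from hc, Finset.card_pair heg])

/-- Three pairwise adjacent faces meet in a vertex. -/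
lemma Tight.star_of_triangle (hK : K.Tight) {A B C : Φ} (hA : A ∈ K.faces) (hB : B ∈ K.faces)
    (hC : C ∈ K.faces) (hAB : A ≠ B) (hAC : A ≠ C) (hBC : B ≠ C) {e f g : E}
    (heA : e ∈ K.bd A) (heB : e ∈ K.bd B) (hfA : f ∈ K.bd A) (hfC : f ∈ K.bd C)
    (hgB : g ∈ K.bd B) (hgC : g ∈ K.bd C) : e ≠ f ∧ K.Meets e f := by
  have h1 := mem_bd_iff hA hB hAB heA heB
  have h2 := mem_bd_iff hA hC hAC hfA hfC
  have h3 := mem_bd_iff hB hC hBC hgB hgC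
  have hef : e ≠ f := by
    rintro rfl
    rcases (h1 C hC).1 hfC with h | h
    · exact hAC h.symm
    · exact hBC h.symm
  have heg : e ≠ g := by
    rintro rfl
    rcases (h1 C hC).1 hgC with h | h
    · exact hAC h.symm
    · exact hBC h.symm
  have hfg : f ≠ g := by
    rintro rfl
    rcases (h2 B hB).1 hgB with h | h
    · exact hAB h.symm
    · exact hBC h
  have hcard : ({e, f, g} : Finset E).card = 3 := Finset.card_eq_three.2
    ⟨e, f, g, hef, heg, hfg, rfl⟩
  -- The three edges meet each of `A`, `B`, `C` in two edges and every other face in none. By `dual`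
  -- they form a cut, and in the `Tight` case such a cut is a star.
  obtain ⟨X, hX, hc⟩ := K.dual {e, f, g} (by
    intro x hx
    simp only [Finset.mem_insert, Finset.mem_singleton] at hx
    rcases hx with rfl | rfl | rfl
    · exact K.bd_subset A hA heA
    · exact K.bd_subset A hA hfA
    · exact K.bd_subset B hB hgB) (.inr hcard) (by
      intro φ hφ
      rw [even_card_inter_triple hef heg hfg, h1 φ hφ, h2 φ hφ, h3 φ hφ]
      by_cases a : φ = A
      · subst a; simp [hAB, hAC]
      · by_cases b : φ = B
        · subst b; simp [hAB.symm, hBC]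
        · simp [a, b, em])
  obtain ⟨v, hv, hs⟩ := hK.eq_star X hX (by rw [show K.cut X = _ from hc, hcard])
  rw [show K.cut X = _ from hc] at hs
  exact ⟨hef, v, hv, by simp [← hs], by simp [← hs]⟩

/-- The two neighbours of an edge on the boundary of a face. -/
lemma Tight.exists_neighbours (hK : K.Tight) {Q : Φ} (hQ : Q ∈ K.faces) {w : E}
    (hw : w ∈ K.bd Q) : ∃ m ∈ K.bd Q, ∃ p ∈ K.bd Q, w ≠ m ∧ w ≠ p ∧ m ≠ p ∧
      (∃ x ∈ K.verts, ∃ y ∈ K.verts, x ≠ y ∧ w ∈ K.star x ∧ w ∈ K.star y ∧ m ∈ K.star x ∧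
        p ∈ K.star y) ∧
      ∀ b ∈ K.bd Q, K.Meets w b → b = w ∨ b = m ∨ b = p := by
  obtain ⟨x, hx, y, hy, hxy, hends⟩ := exists_ends (K.bd_subset Q hQ hw)
  have hwx : w ∈ K.star x := (hends x hx).2 (.inl rfl)
  have hwy : w ∈ K.star y := (hends y hy).2 (.inr rfl)
  have heven : K.IsEven (K.bd Q) := ⟨K.bd_subset Q hQ, K.bd_even Q hQ⟩
  have key : ∀ z ∈ K.verts, w ∈ K.star z → ∃ m ∈ K.bd Q, w ≠ m ∧ m ∈ K.star z ∧
      ∀ b ∈ K.bd Q, b ∈ K.star z → b = w ∨ b = m := by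
    intro z hz hwz
    have hc := heven.card_inter_star hz ⟨w, Finset.mem_inter.2 ⟨hw, hwz⟩⟩
    have hc' : ((K.bd Q ∩ K.star z).erase w).card = 1 := by
      rw [Finset.card_erase_of_mem (Finset.mem_inter.2 ⟨hw, hwz⟩), hc]
    obtain ⟨m, hm⟩ := Finset.card_eq_one.1 hc'
    have hk : ∀ b, (b ≠ w ∧ b ∈ K.bd Q ∧ b ∈ K.star z) ↔ b = m := by
      intro b
      have := congrArg (b ∈ ·) hm
      simpa using this
    have hm' := (hk m).2 rfl
    refine ⟨m, hm'.2.1, hm'.1.symm, hm'.2.2, fun b hb hbz => ?_⟩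
    by_cases hbw : b = w
    · exact .inl hbw
    · exact .inr ((hk b).1 ⟨hbw, hb, hbz⟩)
  obtain ⟨m, hm, hwm, hmx, hm'⟩ := key x hx hwx
  obtain ⟨p, hp, hwp, hpy, hp'⟩ := key y hy hwy
  have hmp : m ≠ p := by
    rintro rfl
    exact hwm (hK.eq_of_mem_star hx hy hxy hwx hwy hmx hpy)
  refine ⟨m, hm, p, hp, hwm, hwp, hmp, ⟨x, hx, y, hy, hxy, hwx, hwy, hmx, hpy⟩, ?_⟩
  rintro b hb ⟨z, hz, hwz, hbz⟩
  rcases (hends z hz).1 hwz with rfl | rfl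
  · have := hm' b hb hbz; tauto
  · have := hp' b hb hbz; tauto

lemma Meets.symm {a b : E} (h : K.Meets a b) : K.Meets b a :=
  let ⟨v, hv, ha, hb⟩ := h; ⟨v, hv, hb, ha⟩

lemma Meets.refl {a : E} (h : a ∈ K.edges) : K.Meets a a := by
  obtain ⟨x, hx, _, _, _, hends⟩ := exists_ends h
  exact ⟨x, hx, (hends x hx).2 (.inl rfl), (hends x hx).2 (.inl rfl)⟩

/-- With more than four vertices, no three edges of a face form a triangle. -/
lemma Tight.not_meets (hK : K.Tight) (h4 : K.verts.card ≠ 4) {Q : Φ} (hQ : Q ∈ K.faces)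
    {w m p : E} (hw : w ∈ K.bd Q) (hm : m ∈ K.bd Q) (hp : p ∈ K.bd Q) (hwm : w ≠ m) (hwp : w ≠ p)
    (hmp : m ≠ p) (h : ∃ x ∈ K.verts, ∃ y ∈ K.verts, x ≠ y ∧ w ∈ K.star x ∧ w ∈ K.star y ∧
      m ∈ K.star x ∧ p ∈ K.star y) : ¬ K.Meets m p := by
  rintro ⟨z, hz, hmz, hpz⟩
  obtain ⟨x, hx, y, hy, hxy, hwx, hwy, hmx, hpy⟩ := h
  have heven : K.IsEven (K.bd Q) := ⟨K.bd_subset Q hQ, K.bd_even Q hQ⟩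
  have hthree : ∀ v ∈ K.verts, w ∈ K.star v → m ∈ K.star v → p ∈ K.star v → False := by
    intro v hv h1 h2 h3
    have hsub : ({w, m, p} : Finset E) ⊆ K.bd Q ∩ K.star v := by
      intro e he
      simp only [Finset.mem_insert, Finset.mem_singleton] at he
      rcases he with rfl | rfl | rfl <;> simp [*]
    have := Finset.card_le_card hsub
    rw [heven.card_inter_star hv ⟨w, hsub (by simp)⟩,
      Finset.card_eq_three.2 ⟨w, m, p, hwm, hwp, hmp, rfl⟩] at this
    omega
  have hzx : z ≠ x := by rintro rfl; exact hthree z hz hwx hmz hpz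
  have hzy : z ≠ y := by rintro rfl; exact hthree z hz hwy hmz hpz
  obtain ⟨sx, _, _, hsx⟩ := star_eq_triple hx hwx hmx hwm
  obtain ⟨sy, _, _, hsy⟩ := star_eq_triple hy hwy hpy hwp
  obtain ⟨sz, _, _, hsz⟩ := star_eq_triple hz hmz hpz hmp
  have hpx : p ∉ K.star x := fun h => hthree x hx hwx hmx h
  have hmy : m ∉ K.star y := fun h => hthree y hy hwy h hpy
  have hwz : w ∉ K.star z := fun h => hthree z hz h hmz hpz
  have hX : ({z, x, y} : Finset V) ⊆ K.verts := by
    intro v hv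
    simp only [Finset.mem_insert, Finset.mem_singleton] at hv
    rcases hv with rfl | rfl | rfl <;> assumption
  have hcut : ∀ e, e ∈ K.cut {z, x, y} ↔
      ¬ (¬ (e ∈ K.star x ↔ e ∈ K.star y) ↔ e ∈ K.star z) := by
    intro e
    rw [mem_cut_insert (by simp [hzx, hzy]) hz, mem_cut_pair hx hy hxy]
  have hw' : w ∉ K.cut {z, x, y} := by rw [hcut]; tauto
  have hm' : m ∉ K.cut {z, x, y} := by rw [hcut]; tauto
  have hp' : p ∉ K.cut {z, x, y} := by rw [hcut]; tauto
  -- Only the third edges at the corners leave the triangle. The cut is odd and not of size 1, so it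
  -- has size 3 and is the star of a vertex `v`.
  have hsub : K.cut {z, x, y} ⊆ {sx, sy, sz} := by
    intro e he
    have h1 : e ≠ w := fun h => hw' (h ▸ he)
    have h2 : e ≠ m := fun h => hm' (h ▸ he)
    have h3 : e ≠ p := fun h => hp' (h ▸ he)
    rw [hcut, hsx, hsy, hsz] at he
    simp only [Finset.mem_insert, Finset.mem_singleton] at he ⊢
    tauto
  have hle : (K.cut {z, x, y}).card ≤ 3 := (Finset.card_le_card hsub).trans Finset.card_le_three
  have hX3 : ({z, x, y} : Finset V).card = 3 :=
    Finset.card_eq_three.2 ⟨z, x, y, hzx, hzy, hxy, rfl⟩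
  have hodd : ¬ Even (K.cut {z, x, y}).card := by
    rw [even_card_cut_iff hX, hX3]; decide
  have h1 := card_cut_ne_one hX
  have h3 : (K.cut {z, x, y}).card = 3 := by
    interval_cases h : (K.cut {z, x, y}).card <;> simp_all +decide
  obtain ⟨v, hv, hvs⟩ := hK.eq_star _ hX h3
  have hvX : v ∉ ({z, x, y} : Finset V) := by
    intro hvX
    simp only [Finset.mem_insert, Finset.mem_singleton] at hvX
    rcases hvX with rfl | rfl | rfl
    · exact hm' (hvs ▸ hmz)
    · exact hm' (hvs ▸ hmx)
    · exact hp' (hvs ▸ hpy)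
  -- Adding `v` cancels the cut, so the triangle and `v` make up the whole graph.
  have h0 : K.cut (insert v {z, x, y}) = ∅ := by
    rw [Finset.eq_empty_iff_forall_notMem]
    intro e
    rw [mem_cut_insert hvX hv, hvs]
    simp
  rcases K.conn _ (Finset.insert_subset hv hX) h0 with h | h
  · simp at h
  · apply h4
    rw [← h, Finset.card_insert_of_notMem hvX, hX3]

/-- The faces around an edge that leaves the face `Q`. -/
lemma Tight.exists_spoke (hK : K.Tight) {Q : Φ} (hQ : Q ∈ K.faces) :
    ∃ e₁ e₂ s p q : E, ∃ F₁ ∈ K.faces, ∃ F₂ ∈ K.faces, ∃ R ∈ K.faces,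
      Q ≠ F₁ ∧ Q ≠ F₂ ∧ Q ≠ R ∧ F₁ ≠ F₂ ∧ F₁ ≠ R ∧ F₂ ≠ R ∧
      e₁ ≠ e₂ ∧ K.Meets e₁ e₂ ∧ K.Meets e₁ s ∧ K.Meets s p ∧
      (e₁ ∈ K.bd Q ∧ e₁ ∈ K.bd F₁) ∧ (e₂ ∈ K.bd Q ∧ e₂ ∈ K.bd F₂) ∧
      (s ∈ K.bd F₁ ∧ s ∈ K.bd F₂) ∧ (p ∈ K.bd F₁ ∧ p ∈ K.bd R) ∧
      (q ∈ K.bd F₂ ∧ q ∈ K.bd R) := by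
  have heven : ∀ φ ∈ K.faces, K.IsEven (K.bd φ) := fun φ hφ => ⟨K.bd_subset φ hφ, K.bd_even φ hφ⟩
  obtain ⟨e₁, he₁⟩ := K.bd_nonempty Q hQ
  obtain ⟨v, hv, _, _, _, hends⟩ := exists_ends (K.bd_subset Q hQ he₁)
  have hv1 : e₁ ∈ K.star v := (hends v hv).2 (.inl rfl)
  -- At the vertex `v` of `Q` two edges lie on `Q` and the third is the spoke `s`. The faces `F₁`
  -- and `F₂` lie on its two sides, and `R` is the third face at its far end `w`.
  obtain ⟨e₂, s, h12, h1s, h2s, hsv, he₂, hsQ⟩ : ∃ e₂ s, e₁ ≠ e₂ ∧ e₁ ≠ s ∧ e₂ ≠ s ∧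
      K.star v = {e₁, e₂, s} ∧ e₂ ∈ K.bd Q ∧ s ∉ K.bd Q := by
    obtain ⟨b, c, h1, h2, h3, hs⟩ := exists_star_eq hv hv1
    rcases (heven Q hQ).mem_of_mem hv h1 h2 h3 hs with h | h | h | h
    · exact ⟨b, c, h1, h2, h3, hs, h.2.1, h.2.2⟩
    · exact ⟨c, b, h2, h1, h3.symm, by rw [hs]; ext; simp; tauto, h.2.2, h.2.1⟩
    · exact absurd he₁ h.1
    · exact absurd he₁ h.1
  have hv2 : e₂ ∈ K.star v := by simp [hsv]
  have hvs : s ∈ K.star v := by simp [hsv]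
  obtain ⟨F₁, hF₁, hQ1, hs1⟩ := exists_other_side (K.bd_subset Q hQ he₁) hQ he₁
  obtain ⟨F₂, hF₂, hQ2, hs2⟩ := exists_other_side (K.bd_subset Q hQ he₂) hQ he₂
  have a1 : e₁ ∈ K.bd F₁ := (hs1 F₁ hF₁).2 (.inr rfl)
  have a2 : e₂ ∈ K.bd F₂ := (hs2 F₂ hF₂).2 (.inr rfl)
  have hF : F₁ ≠ F₂ := by
    rintro rfl
    exact h12 (hK.edge_unique hQ hF₁ hQ1 he₁ a1 he₂ a2)
  have a3 : e₂ ∉ K.bd F₁ := fun h => by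
    rcases (hs2 F₁ hF₁).1 h with h | h
    · exact hQ1 h.symm
    · exact hF h
  have a4 : e₁ ∉ K.bd F₂ := fun h => by
    rcases (hs1 F₂ hF₂).1 h with h | h
    · exact hQ2 h.symm
    · exact hF h.symm
  have s1 : s ∈ K.bd F₁ := by
    have := (heven F₁ hF₁).mem_of_mem hv h12 h1s h2s hsv; tauto
  have s2 : s ∈ K.bd F₂ := by
    have := (heven F₂ hF₂).mem_of_mem hv h12 h1s h2s hsv; tauto
  have hss := mem_bd_iff hF₁ hF₂ hF s1 s2
  obtain ⟨w, hw, hvw, hsw⟩ := exists_other_end (K.star_subset v hv hvs) hv hvs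
  have hws : s ∈ K.star w := (hsw w hw).2 (.inr rfl)
  obtain ⟨p, q, hsp, hsq, hpq, hstar, hp1, hq1⟩ : ∃ p q, s ≠ p ∧ s ≠ q ∧ p ≠ q ∧
      K.star w = {s, p, q} ∧ p ∈ K.bd F₁ ∧ q ∉ K.bd F₁ := by
    obtain ⟨b, c, h1, h2, h3, hs⟩ := exists_star_eq hw hws
    rcases (heven F₁ hF₁).mem_of_mem hw h1 h2 h3 hs with h | h | h | h
    · exact ⟨b, c, h1, h2, h3, hs, h.2.1, h.2.2⟩
    · exact ⟨c, b, h2, h1, h3.symm, by rw [hs]; ext; simp; tauto, h.2.2, h.2.1⟩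
    · exact absurd s1 h.1
    · exact absurd s1 h.1
  have hwp : p ∈ K.star w := by simp [hstar]
  have hwq : q ∈ K.star w := by simp [hstar]
  have hp2 : p ∉ K.bd F₂ := fun h => hsp (hK.edge_unique hF₁ hF₂ hF s1 s2 hp1 h)
  have hq2 : q ∈ K.bd F₂ := by
    have := (heven F₂ hF₂).mem_of_mem hw hsp hsq hpq hstar; tauto
  obtain ⟨R, hR, hFR, hpR⟩ := exists_other_side (K.star_subset w hw hwp) hF₁ hp1
  have hpR' : p ∈ K.bd R := (hpR R hR).2 (.inr rfl)
  have hF2R : F₂ ≠ R := by rintro rfl; exact hp2 hpR'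
  have hsR : s ∉ K.bd R := fun h => by
    rcases (hss R hR).1 h with h | h
    · exact hFR h.symm
    · exact hF2R h.symm
  have hqR : q ∈ K.bd R := by
    have := (heven R hR).mem_of_mem hw hsp hsq hpq hstar; tauto
  -- If `R` were `Q`, then `p = e₁` and `q = e₂`, and these two edges would both join `v` and `w`.
  have hQR : Q ≠ R := by
    rintro rfl
    have e1 := hK.edge_unique hQ hF₁ hQ1 he₁ a1 hpR' hp1
    have e2 := hK.edge_unique hQ hF₂ hQ2 he₂ a2 hqR hq2
    subst e1 e2
    exact h12 (hK.eq_of_mem_star hv hw hvw hv1 hwp hv2 hwq)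
  exact ⟨e₁, e₂, s, p, q, F₁, hF₁, F₂, hF₂, R, hR, hQ1, hQ2, hQR, hF, hFR, hF2R, h12,
    ⟨v, hv, hv1, hv2⟩, ⟨v, hv, hv1, hvs⟩, ⟨w, hw, hws, hwp⟩, ⟨he₁, a1⟩, ⟨he₂, a2⟩, ⟨s1, s2⟩,
    ⟨hp1, hpR'⟩, ⟨hq2, hqR⟩⟩

end FacedCubic

namespace FacedCubic

variable {V E Φ : Type*} {K : FacedCubic V E Φ}

/-! ### Recombining the faces around a set of centres -/

variable (K) in
/-- The labels of a face `R`, given a set `J` of central faces and a colouring of the edges of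
each of them: a centre gets all three of its labels, a face next to a centre gets the label of the
colour of the common edge, and every other face gets its own label. -/
noncomputable def labels (J : Finset Φ) (c : Φ → E → Fin 3) (R : Φ) :
    Finset (Φ ⊕ Φ × Fin 3) :=
  if R ∈ J then Finset.univ.image fun i => Sum.inr (R, i)
  else if h : ∃ p : Φ × E, p.1 ∈ J ∧ p.2 ∈ K.bd R ∧ p.2 ∈ K.bd p.1 then
    {Sum.inr (h.choose.1, c h.choose.1 h.choose.2)}
  else {Sum.inl R}

variable (K) in
/-- The sum of the faces with label `l`. -/
noncomputable def recombine (J : Finset Φ) (c : Φ → E → Fin 3) (l : Φ ⊕ Φ × Fin 3) : Finset E :=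
  oddPart K.edges (K.faces.filter fun R => l ∈ K.labels J c R) K.bd

variable (K) in
/-- No face touches two different members of `J`. -/
def Sparse (J : Finset Φ) : Prop :=
  J ⊆ K.faces ∧ ∀ Q ∈ J, ∀ Q' ∈ J, ∀ R ∈ K.faces,
    (K.bd R ∩ K.bd Q).Nonempty → (K.bd R ∩ K.bd Q').Nonempty → Q = Q'

variable (K) in
/-- Consecutive edges of the face `Q` have different colours. -/
def ProperOn (c : E → Fin 3) (Q : Φ) : Prop :=
  ∀ a ∈ K.bd Q, ∀ b ∈ K.bd Q, a ≠ b → K.Meets a b → c a ≠ c b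

variable {J : Finset Φ} {c : Φ → E → Fin 3}

lemma Sparse.subset (hJ : K.Sparse J) {U : Finset Φ} (hU : U ⊆ J) : K.Sparse U :=
  ⟨hU.trans hJ.1, fun Q hQ Q' hQ' => hJ.2 Q (hU hQ) Q' (hU hQ')⟩

lemma Sparse.eq_of_mem (hJ : K.Sparse J) {Q Q' R : Φ} (hQ : Q ∈ J) (hQ' : Q' ∈ J)
    (hR : R ∈ K.faces) {e g : E} (heR : e ∈ K.bd R) (heQ : e ∈ K.bd Q) (hgR : g ∈ K.bd R)
    (hgQ : g ∈ K.bd Q') : Q = Q' :=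
  hJ.2 Q hQ Q' hQ' R hR ⟨e, Finset.mem_inter.2 ⟨heR, heQ⟩⟩ ⟨g, Finset.mem_inter.2 ⟨hgR, hgQ⟩⟩

lemma mem_labels_of_mem {R : Φ} (hR : R ∈ J) {l : Φ ⊕ Φ × Fin 3} :
    l ∈ K.labels J c R ↔ ∃ i, l = Sum.inr (R, i) := by
  simp [labels, hR, eq_comm]

lemma labels_of_notMem {R : Φ} (hR : R ∉ J) :
    (∃ Q ∈ J, ∃ g ∈ K.bd R, g ∈ K.bd Q ∧ K.labels J c R = {Sum.inr (Q, c Q g)}) ∨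
      ((∀ Q ∈ J, ∀ g ∈ K.bd R, g ∉ K.bd Q) ∧ K.labels J c R = {Sum.inl R}) := by
  by_cases h : ∃ p : Φ × E, p.1 ∈ J ∧ p.2 ∈ K.bd R ∧ p.2 ∈ K.bd p.1
  · left
    exact ⟨h.choose.1, h.choose_spec.1, h.choose.2, h.choose_spec.2.1, h.choose_spec.2.2, by
      simp [labels, hR, h]⟩
  · right
    refine ⟨fun Q hQ g hg hgQ => h ⟨(Q, g), hQ, hg, hgQ⟩, ?_⟩
    rw [labels, if_neg hR, dif_neg h]

/-- The choice hidden in `labels` is harmless: sparseness makes the centre next to `R` unique, and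
`edge_unique` the common edge. -/
lemma labels_of_adjacent (hK : K.Tight) (hJ : K.Sparse J) {Q R : Φ} (hQ : Q ∈ J)
    (hR : R ∈ K.faces) (hQR : Q ≠ R) {e : E} (heQ : e ∈ K.bd Q) (heR : e ∈ K.bd R) :
    R ∉ J ∧ K.labels J c R = {Sum.inr (Q, c Q e)} := by
  have hRJ : R ∉ J := fun h => hQR (hJ.eq_of_mem hQ h hR heR heQ heR heR)
  refine ⟨hRJ, ?_⟩
  rcases labels_of_notMem (K := K) (c := c) hRJ with ⟨Q', hQ', g, hgR, hgQ', h⟩ | ⟨h, -⟩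
  · obtain rfl := hJ.eq_of_mem hQ hQ' hR heR heQ hgR hgQ'
    rw [h, hK.edge_unique (hJ.1 hQ) hR hQR heQ heR hgQ' hgR]
  · exact absurd heQ (h Q hQ e heR)

lemma eq_of_inl_mem_labels {R X : Φ} (h : Sum.inl X ∈ K.labels J c R) : X = R := by
  by_cases hR : R ∈ J
  · rw [mem_labels_of_mem hR] at h
    simp at h
  · rcases labels_of_notMem (K := K) (c := c) hR with ⟨Q, -, g, -, -, h'⟩ | ⟨-, h'⟩
    · simp [h'] at h
    · simpa [h'] using h

/-- Modulo 2, `e` survives in the sum of the faces labelled `l` exactly when one of its two sides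
carries `l` and the other does not. -/
lemma mem_recombine_iff {A B : Φ} (hA : A ∈ K.faces) (hB : B ∈ K.faces) (hAB : A ≠ B) {e : E}
    (heA : e ∈ K.bd A) (heB : e ∈ K.bd B) {l : Φ ⊕ Φ × Fin 3} :
    e ∈ K.recombine J c l ↔ (l ∈ K.labels J c A ↔ l ∉ K.labels J c B) := by
  rw [recombine, mem_oddPart, odd_card_filter_pair hAB (Finset.filter_subset _ _)
    (mem_bd_iff hA hB hAB heA heB)]
  simp [K.bd_subset A hA heA, hA, hB]

/-- The centre carries all three of its labels and the face across `e` only the one of the colour of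
`e`, which therefore cancels. -/
lemma mem_recombine_iff_of_center (hK : K.Tight) (hJ : K.Sparse J) {Q : Φ} (hQ : Q ∈ J) {e : E}
    (he : e ∈ K.bd Q) {l : Φ ⊕ Φ × Fin 3} :
    e ∈ K.recombine J c l ↔ ∃ i, i ≠ c Q e ∧ l = Sum.inr (Q, i) := by
  obtain ⟨F, hF, hQF, hs⟩ := exists_other_side (K.bd_subset Q (hJ.1 hQ) he) (hJ.1 hQ) he
  have heF : e ∈ K.bd F := (hs F hF).2 (.inr rfl)
  rw [mem_recombine_iff (hJ.1 hQ) hF hQF he heF, mem_labels_of_mem hQ,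
    (labels_of_adjacent hK hJ hQ hF hQF he heF).2, Finset.mem_singleton]
  constructor
  · intro h
    by_cases h1 : l = Sum.inr (Q, c Q e)
    · exact absurd h1 (h.1 ⟨_, h1⟩)
    · obtain ⟨i, hi⟩ := h.2 h1
      exact ⟨i, by rintro rfl; exact h1 hi, hi⟩
  · rintro ⟨i, hi, rfl⟩
    simp [hi]

/-- This is where properness is needed. The label sets of the two sides of an edge are either three
labels and one of them, or two singletons, and the symmetric difference has two elements once the
singletons are distinct. -/
lemma card_symmDiff_labels (hK : K.Tight) (hJ : K.Sparse J) (hc : ∀ Q ∈ J, K.ProperOn (c Q) Q)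
    {A B : Φ} (hA : A ∈ K.faces) (hB : B ∈ K.faces) (hAB : A ≠ B) {e : E} (heA : e ∈ K.bd A)
    (heB : e ∈ K.bd B) : ∃ l l', l ≠ l' ∧ ∀ k, (k ∈ K.labels J c A ↔ k ∉ K.labels J c B) ↔
      k = l ∨ k = l' := by
  have center : ∀ Q ∈ J, e ∈ K.bd Q → ∃ l l', l ≠ l' ∧ ∀ k, e ∈ K.recombine J c k ↔
      k = l ∨ k = l' := by
    intro Q hQ he
    obtain ⟨i, j, hij, h⟩ : ∃ i j : Fin 3, i ≠ j ∧ ∀ k, k ≠ c Q e ↔ k = i ∨ k = j := by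
      generalize c Q e = x
      revert x; decide
    refine ⟨Sum.inr (Q, i), Sum.inr (Q, j), by simp [hij], fun k => ?_⟩
    rw [mem_recombine_iff_of_center hK hJ hQ he]
    constructor
    · rintro ⟨x, hx, rfl⟩
      rcases (h x).1 hx with rfl | rfl <;> simp
    · rintro (rfl | rfl)
      · exact ⟨i, (h i).2 (.inl rfl), rfl⟩
      · exact ⟨j, (h j).2 (.inr rfl), rfl⟩
  simp only [← mem_recombine_iff hA hB hAB heA heB]
  by_cases hAJ : A ∈ J
  · exact center A hAJ heA
  by_cases hBJ : B ∈ J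
  · exact center B hBJ heB
  simp only [mem_recombine_iff hA hB hAB heA heB]
  have single : ∀ a b : Φ ⊕ Φ × Fin 3, a ≠ b → ∃ l l', l ≠ l' ∧
      ∀ k, (k ∈ ({a} : Finset (Φ ⊕ Φ × Fin 3)) ↔ k ∉ ({b} : Finset (Φ ⊕ Φ × Fin 3))) ↔
        k = l ∨ k = l' := by
    intro a b hab
    refine ⟨a, b, hab, fun k => ?_⟩
    simp only [Finset.mem_singleton]
    constructor
    · intro h; tauto
    · rintro (rfl | rfl) <;> simp [hab, hab.symm]
  rcases labels_of_notMem (K := K) (c := c) hAJ with ⟨Q, hQ, g, hgA, hgQ, hlA⟩ | ⟨-, hlA⟩ <;>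
    rcases labels_of_notMem (K := K) (c := c) hBJ with ⟨Q', hQ', g', hgB, hgQ', hlB⟩ | ⟨-, hlB⟩ <;>
    rw [hlA, hlB] <;> apply single
  -- Two adjacent neighbours of the same centre form a triangle of faces with it. So their edges on
  -- the centre are consecutive and have different colours.
  · intro h
    simp only [Sum.inr.injEq, Prod.mk.injEq] at h
    obtain ⟨rfl, h⟩ := h
    obtain ⟨hne, hm⟩ := hK.star_of_triangle (hJ.1 hQ) hA hB (by rintro rfl; exact hAJ hQ)
      (by rintro rfl; exact hBJ hQ) hAB hgQ hgA hgQ' hgB heA heB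
    exact hc Q hQ g hgQ g' hgQ' hne hm h
  · simp
  · simp
  · simpa using hAB

lemma isEvenDoubleCover_recombine (hK : K.Tight) (hJ : K.Sparse J)
    (hc : ∀ Q ∈ J, K.ProperOn (c Q) Q) :
    K.IsEvenDoubleCover (K.faces.biUnion (K.labels J c)) (K.recombine J c) := by
  refine ⟨fun l _ => ⟨Finset.filter_subset _ _, fun v hv => ?_⟩, fun e he => ?_⟩
  · rw [Finset.inter_comm]
    exact even_card_inter_oddPart_of_even (K.star_subset v hv)
      fun φ hφ => K.bd_even φ (Finset.mem_filter.1 hφ).1 v hv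
  · obtain ⟨A, hA, B, hB, hAB, hs⟩ := exists_sides he
    have heA := (hs A hA).2 (.inl rfl)
    have heB := (hs B hB).2 (.inr rfl)
    obtain ⟨l, l', hl, h⟩ := card_symmDiff_labels (c := c) hK hJ hc hA hB hAB heA heB
    rw [Finset.card_eq_two]
    refine ⟨l, l', hl, ?_⟩
    ext k
    rw [Finset.mem_filter, mem_recombine_iff hA hB hAB heA heB, h k]
    simp only [Finset.mem_insert, Finset.mem_singleton, and_iff_right_iff_imp]
    intro hk
    rw [← h k] at hk
    rw [Finset.mem_biUnion]
    by_cases hkA : k ∈ K.labels J c A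
    · exact ⟨A, hA, hkA⟩
    · exact ⟨B, hB, by tauto⟩

/-! ### Many centres -/

lemma Tight.exists_properOn (hK : K.Tight) {Q : Φ} (hQ : Q ∈ K.faces) (P : Finset E)
    (hP : P ⊆ K.bd Q) (c₀ : E → Fin 3)
    (hc₀ : ∀ a ∈ P, ∀ b ∈ P, a ≠ b ∧ K.Meets a b → c₀ a ≠ c₀ b) :
    ∃ c, (∀ a ∈ P, c a = c₀ a) ∧ K.ProperOn c Q := by
  obtain ⟨c, h1, h2⟩ := exists_extend_coloring (K.bd Q) (fun a b => a ≠ b ∧ K.Meets a b)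
    (fun a b h => ⟨h.1.symm, h.2.symm⟩) (fun a h => h.1 rfl) (by
      intro a ha
      obtain ⟨m, _, p, _, _, _, _, _, h⟩ := hK.exists_neighbours hQ ha
      refine (Finset.card_le_card (t := {m, p}) ?_).trans Finset.card_le_two
      intro b hb
      obtain ⟨hbQ, hab, hm⟩ := Finset.mem_filter.1 hb
      have := h b hbQ hm
      simp only [Finset.mem_insert, Finset.mem_singleton]
      tauto) P hP c₀ hc₀
  exact ⟨c, h1, fun a ha b hb hab hm => h2 a ha b hb ⟨hab, hm⟩⟩

/-- Each face of a sparse set can be recombined with its neighbours or not. -/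
lemma Tight.two_pow_le_of_sparse (hK : K.Tight) {J : Finset Φ} (hJ : K.Sparse J) :
    2 ^ J.card ≤ K.cdcs.card := by
  have hex : ∀ Q, ∃ c : E → Fin 3, Q ∈ K.faces → K.ProperOn c Q := by
    intro Q
    by_cases hQ : Q ∈ K.faces
    · obtain ⟨c, -, h⟩ := hK.exists_properOn hQ ∅ (by simp) (fun _ => 0) (by simp)
      exact ⟨c, fun _ => h⟩
    · exact ⟨fun _ => 0, fun h => absurd h hQ⟩
  choose c hc using hex
  -- The path `e₁, s, p` on the neighbour `F₁` of `Q` detects whether `Q` is recombined.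
  have main : ∀ Q ∈ J, ∃ a e b, K.Meets a e ∧ K.Meets e b ∧ ∀ U ⊆ J,
      ((∃ l ∈ K.faces.biUnion (K.labels U c), a ∈ K.recombine U c l ∧ e ∈ K.recombine U c l ∧
        b ∈ K.recombine U c l) ↔ Q ∉ U) := by
    intro Q hQJ
    have hQ := hJ.1 hQJ
    obtain ⟨e₁, e₂, s, p, q, F₁, hF₁, F₂, hF₂, R, hR, hQ1, hQ2, hQR, h12, h1R, h2R, he, hm12, hm1,
      hm2, ⟨a1, a2⟩, ⟨b1, b2⟩, ⟨s1, s2⟩, ⟨p1, p2⟩, ⟨q1, q2⟩⟩ := hK.exists_spoke hQ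
    refine ⟨e₁, s, p, hm1, hm2, fun U hU => ?_⟩
    have hUs := hJ.subset hU
    constructor
    · rintro ⟨l, -, hl1, hl2, hl3⟩ hQU
      rw [mem_recombine_iff_of_center hK hUs hQU a1] at hl1
      obtain ⟨i, hi, rfl⟩ := hl1
      have lab1 := (labels_of_adjacent (c := c) hK hUs hQU hF₁ hQ1 a1 a2).2
      have lab2 := (labels_of_adjacent (c := c) hK hUs hQU hF₂ hQ2 b1 b2).2
      rw [mem_recombine_iff hF₁ hF₂ h12 s1 s2, lab1, lab2] at hl2
      rw [mem_recombine_iff hF₁ hR h1R p1 p2, lab1] at hl3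
      simp only [Finset.mem_singleton, Sum.inr.injEq, Prod.mk.injEq, true_and, hi, false_iff,
        not_not] at hl2 hl3
      have hRU : R ∉ U := fun h => hQR (hUs.eq_of_mem hQU h hF₁ a2 a1 p1 p2)
      rcases labels_of_notMem (K := K) (c := c) hRU with ⟨Q', hQ', g, hgR, hgQ, h⟩ | ⟨-, h⟩
      · rw [h] at hl3
        simp only [Finset.mem_singleton, Sum.inr.injEq, Prod.mk.injEq] at hl3
        obtain ⟨rfl, hig⟩ := hl3
        -- A set containing the path has a label `(Q, i)` where `i` is not the colour of `e₁`. The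
        -- edge `s` forces `i` to be the colour of `e₂`, and `p` forces `R` to carry this label, so
        -- `R` touches `Q` in an edge `g` of colour `i`. But `Q`, `F₂`, `R` are pairwise adjacent,
        -- so `e₂` and `g` are consecutive on `Q`.
        obtain ⟨hne, hm⟩ := hK.star_of_triangle hQ hF₂ hR hQ2 hQR h2R b1 b2 hgQ hgR q1 q2
        exact hc Q hQ e₂ b1 g hgQ hne hm (hl2.symm.trans hig)
      · simp [h] at hl3
    · intro hQU
      -- By sparseness `Q` is the only member of `J` that touches `F₁`. So without `Q` the face `F₁`
      -- keeps its own label, and the path lies in the set with that label.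
      have hF1U : F₁ ∉ U := fun h => hQ1 (hJ.eq_of_mem hQJ (hU h) hF₁ a2 a1 a2 a2)
      have lab1 : K.labels U c F₁ = {Sum.inl F₁} := by
        rcases labels_of_notMem (K := K) (c := c) hF1U with ⟨Q', hQ', g, hgF, hgQ, -⟩ | ⟨-, h⟩
        · exact absurd (hJ.eq_of_mem hQJ (hU hQ') hF₁ a2 a1 hgF hgQ ▸ hQ') hQU
        · exact h
      have other : ∀ X, F₁ ≠ X → Sum.inl F₁ ∉ K.labels U c X :=
        fun X hX h => hX (eq_of_inl_mem_labels h)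
      refine ⟨Sum.inl F₁, Finset.mem_biUnion.2 ⟨F₁, hF₁, by simp [lab1]⟩, ?_, ?_, ?_⟩
      · rw [mem_recombine_iff hF₁ hQ hQ1.symm a2 a1]
        simp [lab1, other Q hQ1.symm]
      · rw [mem_recombine_iff hF₁ hF₂ h12 s1 s2]
        simp [lab1, other F₂ h12]
      · rw [mem_recombine_iff hF₁ hR h1R p1 p2]
        simp [lab1, other R h1R]
  rw [← Finset.card_powerset]
  refine card_le_card_cdcs J.powerset (fun U => K.faces.biUnion (K.labels U c))
    (fun U => K.recombine U c) (fun U hU => ?_) ?_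
  · exact isEvenDoubleCover_recombine hK (hJ.subset (Finset.mem_powerset.1 hU))
      fun Q hQ => hc Q (hJ.1 (Finset.mem_powerset.1 hU hQ))
  · intro U hU U' hU' hne
    rw [Finset.mem_powerset] at hU hU'
    obtain ⟨Q, hQ⟩ : ∃ Q, ¬ (Q ∈ U ↔ Q ∈ U') := by
      by_contra! h
      exact hne (Finset.ext h)
    have hQJ : Q ∈ J := by
      by_contra h
      exact hQ ⟨fun h' => absurd (hU h') h, fun h' => absurd (hU' h') h⟩
    obtain ⟨a, e, b, h1, h2, h3⟩ := main Q hQJ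
    refine ⟨a, e, b, h1, h2, ?_⟩
    rw [h3 U hU, h3 U' hU']
    tauto

/-! ### One centre with a long boundary -/

/-- A long face can be recombined with its neighbours in many ways. -/
lemma Tight.exists_two_pow_le_of_face (hK : K.Tight) (h4 : K.verts.card ≠ 4) {Q : Φ}
    (hQ : Q ∈ K.faces) : ∃ k : ℕ, (K.bd Q).card ≤ k * 27 ∧ 2 ^ k ≤ K.cdcs.card := by
  have hex : ∀ w, ∃ m p, w ∈ K.bd Q → (m ∈ K.bd Q ∧ p ∈ K.bd Q ∧ w ≠ m ∧ w ≠ p ∧ m ≠ p ∧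
      K.Meets w m ∧ K.Meets w p ∧ ¬ K.Meets m p ∧
      ∀ b ∈ K.bd Q, K.Meets w b → b = w ∨ b = m ∨ b = p) := by
    intro w
    by_cases hw : w ∈ K.bd Q
    · obtain ⟨m, hm, p, hp, h1, h2, h3, h, h5⟩ := hK.exists_neighbours hQ hw
      have hn := hK.not_meets h4 hQ hw hm hp h1 h2 h3 h
      obtain ⟨x, hx, y, hy, -, hwx, hwy, hmx, hpy⟩ := h
      exact ⟨m, p, fun _ => ⟨hm, hp, h1, h2, h3, ⟨x, hx, hwx, hmx⟩, ⟨y, hy, hwy, hpy⟩, hn, h5⟩⟩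
    · exact ⟨w, w, fun h => absurd h hw⟩
  choose m p hmp using hex
  have hrefl : ∀ a ∈ K.bd Q, K.Meets a a := fun a ha => Meets.refl (K.bd_subset Q hQ ha)
  have hN : ∀ a ∈ K.bd Q, ((K.bd Q).filter (K.Meets a)).card ≤ 3 := by
    intro a ha
    refine (Finset.card_le_card (t := {a, m a, p a}) ?_).trans Finset.card_le_three
    intro b hb
    obtain ⟨hbQ, hab⟩ := Finset.mem_filter.1 hb
    simpa using (hmp a ha).2.2.2.2.2.2.2.2 b hbQ hab
  -- The relation is distance at most three along `Q`, so that edges within distance one of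
  -- different members of `W` never meet. Each of the three steps has at most three outcomes,
  -- counting standing still, which gives `27 = 3 * 3 * 3`.
  obtain ⟨W, hWQ, hW, hcard⟩ := exists_independent_subset (K.bd Q)
    (fun a b => ∃ x ∈ K.bd Q, ∃ y ∈ K.bd Q, K.Meets a x ∧ K.Meets x y ∧ K.Meets y b) 27
    (fun a b ⟨x, hx, y, hy, h1, h2, h3⟩ => ⟨y, hy, x, hx, h3.symm, h2.symm, h1.symm⟩)
    (fun a ha => ⟨a, ha, a, ha, hrefl a ha, hrefl a ha, hrefl a ha⟩) (by
      intro a ha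
      have hsub : ((K.bd Q).filter fun b => ∃ x ∈ K.bd Q, ∃ y ∈ K.bd Q,
          K.Meets a x ∧ K.Meets x y ∧ K.Meets y b) ⊆
          ((K.bd Q).filter (K.Meets a)).biUnion fun x =>
            ((K.bd Q).filter (K.Meets x)).biUnion fun y => (K.bd Q).filter (K.Meets y) := by
        intro b hb
        obtain ⟨hbQ, x, hx, y, hy, h1, h2, h3⟩ := Finset.mem_filter.1 hb
        simp only [Finset.mem_biUnion, Finset.mem_filter]
        exact ⟨x, ⟨hx, h1⟩, y, ⟨hy, h2⟩, hbQ, h3⟩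
      refine (Finset.card_le_card hsub).trans ?_
      refine (Finset.card_biUnion_le_card_mul _ _ 9 fun x hx => ?_).trans
        (by have := hN a ha; omega)
      have hx := (Finset.mem_filter.1 hx).1
      refine (Finset.card_biUnion_le_card_mul _ _ 3 fun y hy => ?_).trans
        (by have := hN x hx; omega)
      exact hN y (Finset.mem_filter.1 hy).1)
  refine ⟨W.card, hcard, ?_⟩
  have hcol : ∀ U, ∃ c : E → Fin 3, U ⊆ W → K.ProperOn c Q ∧
      ∀ w ∈ W, (c (m w) = c (p w) ↔ w ∈ U) := by
    intro U
    by_cases hU : U ⊆ W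
    swap
    · exact ⟨fun _ => 0, fun h => absurd h hU⟩
    -- Around each `w ∈ W` the edges `m w`, `w`, `p w` get the colours 0, 1, 0 if `w ∈ U`, and 0, 1,
    -- 2 otherwise. The equal colours are allowed because `m w` and `p w` do not meet.
    set c₀ : E → Fin 3 := fun a =>
      if a ∈ W then 1 else if ∃ w ∈ W, w ∉ U ∧ a = p w then 2 else 0 with hc₀
    have cw : ∀ w ∈ W, c₀ w = 1 := fun w hw => by simp [hc₀, hw]
    have cm : ∀ w ∈ W, c₀ (m w) = 0 := by
      intro w hw
      obtain ⟨k1, k2, k3, k4, k5, k6, k7, k8, k9⟩ := hmp w (hWQ hw)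
      have n1 : m w ∉ W := fun h => k3 (hW w hw _ h
        ⟨m w, k1, m w, k1, k6, hrefl _ k1, hrefl _ k1⟩)
      have n2 : ¬ ∃ w' ∈ W, w' ∉ U ∧ m w = p w' := by
        rintro ⟨w', hw', -, heq⟩
        have k7' := (hmp w' (hWQ hw')).2.2.2.2.2.2.1
        have := hW w hw w' hw' ⟨m w, k1, m w, k1, k6, hrefl _ k1, by rw [heq]; exact k7'.symm⟩
        subst this
        exact k5 heq
      simp only [hc₀, n1, if_false, n2]
    have cp : ∀ w ∈ W, c₀ (p w) = if w ∈ U then 0 else 2 := by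
      intro w hw
      obtain ⟨k1, k2, k3, k4, k5, k6, k7, k8, k9⟩ := hmp w (hWQ hw)
      have n1 : p w ∉ W := fun h => k4 (hW w hw _ h
        ⟨p w, k2, p w, k2, k7, hrefl _ k2, hrefl _ k2⟩)
      have n2 : (∃ w' ∈ W, w' ∉ U ∧ p w = p w') ↔ w ∉ U := by
        constructor
        · rintro ⟨w', hw', hwU, heq⟩
          have k7' := (hmp w' (hWQ hw')).2.2.2.2.2.2.1
          have := hW w hw w' hw' ⟨p w, k2, p w, k2, k7, hrefl _ k2, by rw [heq]; exact k7'.symm⟩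
          subst this
          exact hwU
        · intro h
          exact ⟨w, hw, h, rfl⟩
      simp only [hc₀, n1, if_false, n2]
      by_cases h : w ∈ U <;> simp [h]
    obtain ⟨c, hc1, hc2⟩ := hK.exists_properOn hQ
      (W.biUnion fun w => (K.bd Q).filter (K.Meets w))
      (Finset.biUnion_subset.2 fun w _ => Finset.filter_subset _ _) c₀ (by
        rintro a ha b hb ⟨hab, hm⟩
        obtain ⟨w, hw, ha⟩ := Finset.mem_biUnion.1 ha
        obtain ⟨w', hw', hb⟩ := Finset.mem_biUnion.1 hb
        obtain ⟨haQ, hwa⟩ := Finset.mem_filter.1 ha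
        obtain ⟨hbQ, hwb⟩ := Finset.mem_filter.1 hb
        obtain rfl := hW w hw w' hw' ⟨a, haQ, b, hbQ, hwa, hm, hwb.symm⟩
        obtain ⟨k1, k2, k3, k4, k5, k6, k7, k8, k9⟩ := hmp w (hWQ hw)
        have c1 := cw w hw
        have c2 := cm w hw
        have c3 := cp w hw
        have c4 : c₀ w ≠ c₀ (p w) := by
          rw [c1, c3]; split_ifs <;> decide
        have c5 : c₀ w ≠ c₀ (m w) := by rw [c1, c2]; decide
        rcases k9 a haQ hwa with rfl | rfl | rfl <;> rcases k9 b hbQ hwb with h | h | h <;>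
          subst h
        · exact absurd rfl hab
        · exact c5
        · exact c4
        · exact c5.symm
        · exact absurd rfl hab
        · exact absurd hm k8
        · exact c4.symm
        · exact absurd hm.symm k8
        · exact absurd rfl hab)
    refine ⟨c, fun _ => ⟨hc2, fun w hw => ?_⟩⟩
    obtain ⟨k1, k2, k3, k4, k5, k6, k7, k8, k9⟩ := hmp w (hWQ hw)
    rw [hc1 (m w) (Finset.mem_biUnion.2 ⟨w, hw, Finset.mem_filter.2 ⟨k1, k6⟩⟩),
      hc1 (p w) (Finset.mem_biUnion.2 ⟨w, hw, Finset.mem_filter.2 ⟨k2, k7⟩⟩), cm w hw, cp w hw]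
    by_cases h : w ∈ U <;> simp [h]
  choose c hc using hcol
  have hsparse : K.Sparse {Q} := by
    refine ⟨by simpa using hQ, fun A hA B hB _ _ _ _ => ?_⟩
    rw [Finset.mem_singleton.1 hA, Finset.mem_singleton.1 hB]
  have trace : ∀ U ⊆ W, ∀ w ∈ W, ((∃ l ∈ K.faces.biUnion (K.labels {Q} fun _ => c U),
      m w ∈ K.recombine {Q} (fun _ => c U) l ∧ w ∈ K.recombine {Q} (fun _ => c U) l ∧
        p w ∈ K.recombine {Q} (fun _ => c U) l) ↔ w ∈ U) := by
    intro U hU w hw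
    obtain ⟨k1, k2, k3, k4, k5, k6, k7, k8, k9⟩ := hmp w (hWQ hw)
    obtain ⟨hprop, hcU⟩ := hc U hU
    have hQQ : Q ∈ ({Q} : Finset Φ) := Finset.mem_singleton_self Q
    simp only [mem_recombine_iff_of_center hK hsparse hQQ k1,
      mem_recombine_iff_of_center hK hsparse hQQ k2,
      mem_recombine_iff_of_center hK hsparse hQQ (hWQ hw)]
    rw [← hcU w hw]
    have n1 := hprop w (hWQ hw) (m w) k1 k3 k6
    have n2 := hprop w (hWQ hw) (p w) k2 k4 k7
    -- The set with label `(Q, i)` contains the edges of `Q` whose colour is not `i`. So `m w`, `w`,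
    -- `p w` lie in one set exactly when they leave some colour unused, that is, when the outer two
    -- have the same colour.
    have fin3 : ∀ x y z : Fin 3, x ≠ y → x ≠ z →
        ((∃ i, i ≠ y ∧ i ≠ x ∧ i ≠ z) ↔ y = z) := by decide
    rw [← fin3 _ _ _ n1 n2]
    constructor
    · rintro ⟨l, -, ⟨i, hi, rfl⟩, ⟨j, hj, hij⟩, ⟨k, hk, hik⟩⟩
      simp only [Sum.inr.injEq, Prod.mk.injEq, true_and] at hij hik
      subst hij hik
      exact ⟨_, hi, hj, hk⟩
    · rintro ⟨i, h1, h2, h3⟩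
      exact ⟨Sum.inr (Q, i), Finset.mem_biUnion.2 ⟨Q, hQ, (mem_labels_of_mem hQQ).2 ⟨i, rfl⟩⟩,
        ⟨i, h1, rfl⟩, ⟨i, h2, rfl⟩, ⟨i, h3, rfl⟩⟩
  rw [← Finset.card_powerset]
  refine card_le_card_cdcs W.powerset (fun U => K.faces.biUnion (K.labels {Q} fun _ => c U))
    (fun U => K.recombine {Q} fun _ => c U) (fun U hU => ?_) ?_
  · refine isEvenDoubleCover_recombine hK hsparse fun Q' hQ' => ?_
    rw [Finset.mem_singleton.1 hQ']
    exact (hc U (Finset.mem_powerset.1 hU)).1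
  · intro U hU U' hU' hne
    rw [Finset.mem_powerset] at hU hU'
    obtain ⟨w, hw⟩ : ∃ w, ¬ (w ∈ U ↔ w ∈ U') := by
      by_contra! h
      exact hne (Finset.ext h)
    have hwW : w ∈ W := by
      by_contra h
      exact hw ⟨fun h' => absurd (hU h') h, fun h' => absurd (hU' h') h⟩
    obtain ⟨k1, k2, k3, k4, k5, k6, k7, k8, k9⟩ := hmp w (hWQ hwW)
    refine ⟨m w, w, p w, k6.symm, k7, ?_⟩
    rw [trace U hU w hwW, trace U' hU' w hwW]
    exact hw

/-- If all faces are short, there are many faces that do not touch a common face. -/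
lemma exists_sparse (d : ℕ) (hd : ∀ φ ∈ K.faces, (K.bd φ).card ≤ d) :
    ∃ J, K.Sparse J ∧ K.faces.card ≤ J.card * (2 * d * (2 * d)) := by
  have hN : ∀ A ∈ K.faces, (K.faces.filter fun R => (K.bd R ∩ K.bd A).Nonempty).card ≤ 2 * d := by
    intro A hA
    have hsub : (K.faces.filter fun R => (K.bd R ∩ K.bd A).Nonempty) ⊆
        (K.bd A).biUnion fun e => K.faces.filter fun R => e ∈ K.bd R := by
      intro R hR
      obtain ⟨hR, e, he⟩ := Finset.mem_filter.1 hR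
      rw [Finset.mem_inter] at he
      exact Finset.mem_biUnion.2 ⟨e, he.2, Finset.mem_filter.2 ⟨hR, he.1⟩⟩
    refine (Finset.card_le_card hsub).trans ((Finset.card_biUnion_le_card_mul _ _ 2
      fun e he => (K.card_sides e (K.bd_subset A hA he)).le).trans ?_)
    have := hd A hA
    omega
  -- Two faces conflict if some face touches both. There are at most `2 * d` choices for the
  -- touching face and, for each, at most `2 * d` for the second face.
  obtain ⟨J, hJ, hind, hcard⟩ := exists_independent_subset K.faces
    (fun A B => ∃ R ∈ K.faces, (K.bd R ∩ K.bd A).Nonempty ∧ (K.bd R ∩ K.bd B).Nonempty)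
    (2 * d * (2 * d)) (fun A B ⟨R, hR, h1, h2⟩ => ⟨R, hR, h2, h1⟩)
    (fun A hA => ⟨A, hA, by simpa using K.bd_nonempty A hA, by simpa using K.bd_nonempty A hA⟩) (by
      intro A hA
      have hsub : (K.faces.filter fun B => ∃ R ∈ K.faces, (K.bd R ∩ K.bd A).Nonempty ∧
          (K.bd R ∩ K.bd B).Nonempty) ⊆
          (K.faces.filter fun R => (K.bd R ∩ K.bd A).Nonempty).biUnion fun R =>
            K.faces.filter fun B => (K.bd B ∩ K.bd R).Nonempty := by
        intro B hB
        obtain ⟨hB, R, hR, h1, h2⟩ := Finset.mem_filter.1 hB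
        rw [Finset.inter_comm] at h2
        exact Finset.mem_biUnion.2 ⟨R, Finset.mem_filter.2 ⟨hR, h1⟩,
          Finset.mem_filter.2 ⟨hB, h2⟩⟩
      refine (Finset.card_le_card hsub).trans ((Finset.card_biUnion_le_card_mul _ _ (2 * d)
        fun R hR => hN R (Finset.mem_filter.1 hR).1).trans ?_)
      exact Nat.mul_le_mul_right _ (hN A hA))
  exact ⟨J, ⟨hJ, fun Q hQ Q' hQ' R hR h1 h2 => hind Q hQ Q' hQ' ⟨R, hR, h1, h2⟩⟩, hcard⟩

end FacedCubic

namespace FacedCubic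

variable {V E Φ : Type*} {K : FacedCubic V E Φ}

/-! ### Cuts of two edges -/

section Necklace

variable {a b c d e g : E}

/-- The necklace consists of two pairs of parallel edges, `a, b` and `c, d`, joined by `e` and `g`.
The cover has the two digons and two circuits of length four; exchanging `c` and `d` changes which
edges the long circuits pair, and so gives a second cover. -/
lemma isEvenDoubleCover_necklace
    (hstar : ∀ v ∈ K.verts, K.star v = {e, a, b} ∨ K.star v = {g, a, b} ∨ K.star v = {e, c, d} ∨
      K.star v = {g, c, d}) (hedges : K.edges = {a, b, c, d, e, g})
    (hnd : [a, b, c, d, e, g].Nodup) :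
    K.IsEvenDoubleCover (Finset.univ : Finset (Fin 4))
      ![{a, b}, {c, d}, {e, g, a, c}, {e, g, b, d}] := by
  simp only [List.nodup_cons, List.mem_cons, List.not_mem_nil, or_false, not_or,
    not_false_eq_true, and_true, List.nodup_nil] at hnd
  obtain ⟨⟨ab, ac, ad, ae, ag⟩, ⟨bc, bd, be, bg⟩, ⟨cd, ce, cg⟩, ⟨de, dg⟩, eg⟩ := hnd
  constructor
  · intro i _
    refine ⟨?_, fun v hv => ?_⟩
    · rw [hedges]
      fin_cases i <;> simp [Finset.insert_subset_iff]
    · rcases hstar v hv with h | h | h | h <;> rw [h, even_card_inter_triple] <;> fin_cases i <;>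
        simp [*, Ne.symm ab, Ne.symm ac, Ne.symm ad, Ne.symm ae, Ne.symm ag, Ne.symm bc,
        Ne.symm bd, Ne.symm be, Ne.symm bg, Ne.symm cd, Ne.symm ce, Ne.symm cg, Ne.symm de, Ne.symm dg,
        Ne.symm eg]
  · intro k hk
    rw [hedges] at hk
    simp only [Finset.mem_insert, Finset.mem_singleton] at hk
    rw [Finset.card_filter, Fin.sum_univ_four]
    rcases hk with rfl | rfl | rfl | rfl | rfl | rfl <;>
      simp [*, Ne.symm ab, Ne.symm ac, Ne.symm ad, Ne.symm ae, Ne.symm ag, Ne.symm bc,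
        Ne.symm bd, Ne.symm be, Ne.symm bg, Ne.symm cd, Ne.symm ce, Ne.symm cg, Ne.symm de, Ne.symm dg,
        Ne.symm eg]

lemma two_le_card_cdcs_necklace
    (hstar : ∀ v ∈ K.verts, K.star v = {e, a, b} ∨ K.star v = {g, a, b} ∨ K.star v = {e, c, d} ∨
      K.star v = {g, c, d}) (hedges : K.edges = {a, b, c, d, e, g})
    (hnd : [a, b, c, d, e, g].Nodup) (hae : K.Meets a e) (hec : K.Meets e c) :
    2 ≤ K.cdcs.card := by
  have h1 := isEvenDoubleCover_necklace hstar hedges hnd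
  have h2 := isEvenDoubleCover_necklace (K := K) (a := a) (b := b) (c := d) (d := c) (e := e)
    (g := g) (by
      intro v hv
      rw [Finset.pair_comm d c]
      exact hstar v hv) (by rw [hedges]; ext; simp; tauto)
    (by simp only [List.nodup_cons, List.mem_cons, List.not_mem_nil, or_false, not_or,
          not_false_eq_true, and_true, List.nodup_nil] at hnd ⊢
        simp only [eq_comm (a := d) (b := c)]
        tauto)
  simp only [List.nodup_cons, List.mem_cons, List.not_mem_nil, or_false, not_or,
    not_false_eq_true, and_true, List.nodup_nil] at hnd
  obtain ⟨⟨ab, ac, ad, ae, ag⟩, ⟨bc, bd, be, bg⟩, ⟨cd, ce, cg⟩, ⟨de, dg⟩, eg⟩ := hnd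
  have y1 : ∃ i ∈ (Finset.univ : Finset (Fin 4)),
      a ∈ (![{a, b}, {c, d}, {e, g, a, c}, {e, g, b, d}] : Fin 4 → Finset E) i ∧
      e ∈ (![{a, b}, {c, d}, {e, g, a, c}, {e, g, b, d}] : Fin 4 → Finset E) i ∧
      c ∈ (![{a, b}, {c, d}, {e, g, a, c}, {e, g, b, d}] : Fin 4 → Finset E) i :=
    ⟨2, by simp, by simp, by simp, by simp⟩
  have y2 : ¬ ∃ i ∈ (Finset.univ : Finset (Fin 4)),
      a ∈ (![{a, b}, {d, c}, {e, g, a, d}, {e, g, b, c}] : Fin 4 → Finset E) i ∧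
      e ∈ (![{a, b}, {d, c}, {e, g, a, d}, {e, g, b, c}] : Fin 4 → Finset E) i ∧
      c ∈ (![{a, b}, {d, c}, {e, g, a, d}, {e, g, b, c}] : Fin 4 → Finset E) i := by
    rintro ⟨i, -, hi⟩
    revert hi
    fin_cases i <;> simp [*, Ne.symm ac, Ne.symm ae, Ne.symm bc, Ne.symm ce, Ne.symm be]
  refine le_trans (by simp) (card_le_card_cdcs (Finset.univ : Finset Bool) (fun _ => Finset.univ)
    (fun s => if s then ![{a, b}, {c, d}, {e, g, a, c}, {e, g, b, d}] else
      ![{a, b}, {d, c}, {e, g, a, d}, {e, g, b, c}]) ?_ ?_)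
  · rintro (_ | _) -
    · exact h2
    · exact h1
  · rintro (_ | _) - (_ | _) - hst
    · exact absurd rfl hst
    · exact ⟨a, e, c, hae, hec, fun h => y2 (h.2 y1)⟩
    · exact ⟨a, e, c, hae, hec, fun h => y2 (h.1 y1)⟩
    · exact absurd rfl hst

/-- The edges at two vertices that are left by exactly two edges. -/
lemma star_of_cut_pair {x y : V} (hx : x ∈ K.verts) (hy : y ∈ K.verts) (hxy : x ≠ y) (heg : e ≠ g)
    (hcut : K.cut {x, y} = {e, g}) : ∃ a b, a ≠ b ∧ a ≠ e ∧ a ≠ g ∧ b ≠ e ∧ b ≠ g ∧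
      (K.star x = {e, a, b} ∧ K.star y = {g, a, b} ∨
        K.star x = {g, a, b} ∧ K.star y = {e, a, b}) := by
  have key : ∀ k, ¬ (k ∈ K.star x ↔ k ∈ K.star y) ↔ k = e ∨ k = g := by
    intro k
    rw [← mem_cut_pair hx hy hxy, hcut]
    simp
  have aux : ∀ {x y : V}, x ∈ K.verts → y ∈ K.verts →
      (∀ k, ¬ (k ∈ K.star x ↔ k ∈ K.star y) ↔ k = e ∨ k = g) → e ∈ K.star x →
      ∃ a b, a ≠ b ∧ a ≠ e ∧ a ≠ g ∧ b ≠ e ∧ b ≠ g ∧ K.star x = {e, a, b} ∧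
        K.star y = {g, a, b} := by
    intro x y hx hy key hex
    have hey : e ∉ K.star y := by have := key e; tauto
    have hgx : g ∉ K.star x := by
      intro hgx
      have hgy : g ∉ K.star y := by have := key g; tauto
      have hss : K.star y ⊂ K.star x := by
        refine (Finset.ssubset_iff_of_subset fun k hk => ?_).2 ⟨e, hex, hey⟩
        by_contra hkx
        rcases (key k).1 (by tauto) with rfl | rfl
        · exact hey hk
        · exact hgy hk
      have := Finset.card_lt_card hss
      rw [K.card_star x hx, K.card_star y hy] at this
      omega
    have hgy : g ∈ K.star y := by have := key g; tauto
    obtain ⟨a, b, hea, heb, hab, hs⟩ := exists_star_eq hx hex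
    have hax : a ∈ K.star x := by simp [hs]
    have hbx : b ∈ K.star x := by simp [hs]
    have hag : a ≠ g := fun h => hgx (h ▸ hax)
    have hbg : b ≠ g := fun h => hgx (h ▸ hbx)
    have hay : a ∈ K.star y := by have := key a; have := hea.symm; tauto
    have hby : b ∈ K.star y := by have := key b; have := heb.symm; tauto
    refine ⟨a, b, hab, hea.symm, hag, heb.symm, hbg, hs, ?_⟩
    refine (Finset.eq_of_subset_of_card_le ?_ ?_).symm
    · intro k hk
      simp only [Finset.mem_insert, Finset.mem_singleton] at hk
      rcases hk with rfl | rfl | rfl <;> assumption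
    · rw [K.card_star y hy, Finset.card_eq_three.2 ⟨g, a, b, hag.symm, hbg.symm, hab, rfl⟩]
  by_cases hex : e ∈ K.star x
  · obtain ⟨a, b, h1, h2, h3, h4, h5, h6, h7⟩ := aux hx hy key hex
    exact ⟨a, b, h1, h2, h3, h4, h5, .inl ⟨h6, h7⟩⟩
  · have hey : e ∈ K.star y := by have := key e; tauto
    obtain ⟨a, b, h1, h2, h3, h4, h5, h6, h7⟩ := aux hy hx (fun k => by rw [← key k]; tauto) hey
    exact ⟨a, b, h1, h2, h3, h4, h5, .inr ⟨h7, h6⟩⟩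

end Necklace

/-- If all cuts of three edges are trivial, then both sides of a cut of two edges have two
vertices. -/
lemma card_compl_of_card_cut_eq_two (h3 : ∀ X ⊆ K.verts, (K.cut X).card = 3 →
      X.card ≤ 1 ∨ (K.verts \ X).card ≤ 1) {X : Finset V} (hX : X ⊆ K.verts)
    (hcut : (K.cut X).card = 2) : (K.verts \ X).card = 2 := by
  obtain ⟨e, g, heg, hc⟩ := Finset.card_eq_two.1 hcut
  have heX : e ∈ K.cut X := by simp [hc]
  have heK := K.cut_subset X heX
  obtain ⟨y, hy, hyX, hey, hXne⟩ : ∃ y ∈ K.verts, y ∉ X ∧ e ∈ K.star y ∧ X.Nonempty := by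
    obtain ⟨x, hx, y, hy, hxy, h⟩ := exists_ends heK
    have := (mem_cut_iff hX heK hxy h).1 heX
    by_cases hxX : x ∈ X
    · exact ⟨y, hy, this.1 hxX, (h y hy).2 (.inr rfl), x, hxX⟩
    · exact ⟨x, hx, hxX, (h x hx).2 (.inl rfl), y, by tauto⟩
  obtain ⟨b, c, heb, hec, hbc, hs⟩ := exists_star_eq hy hey
  have hins : insert y X ⊆ K.verts := Finset.insert_subset hy hX
  have hmem : ∀ k, k ∈ K.cut (insert y X) ↔
      ¬ ((k = e ∨ k = g) ↔ (k = e ∨ k = b ∨ k = c)) := by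
    intro k
    rw [mem_cut_insert hyX hy, hc, hs]
    simp
  -- If `g` also ended at `y`, moving `y` into `X` would leave a cut of one edge.
  have hgy : g ≠ b ∧ g ≠ c := by
    constructor
    · rintro rfl
      refine card_cut_ne_one hins (Finset.card_eq_one.2 ⟨c, ?_⟩)
      ext k; rw [hmem]; simp only [Finset.mem_singleton]
      grind
    · rintro rfl
      refine card_cut_ne_one hins (Finset.card_eq_one.2 ⟨b, ?_⟩)
      ext k; rw [hmem]; simp only [Finset.mem_singleton]
      grind
  -- Moving `y` across trades `e` for `b` and `c`. The new cut of three edges is trivial, so at most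
  -- one vertex is left outside besides `y`; parity makes it exactly one.
  have hcut3 : K.cut (insert y X) = {g, b, c} := by
    ext k; rw [hmem]; simp only [Finset.mem_insert, Finset.mem_singleton]
    grind
  have hle : (K.verts \ insert y X).card ≤ 1 := by
    refine (h3 _ hins ?_).resolve_left ?_
    · rw [hcut3, Finset.card_eq_three.2 ⟨g, b, c, hgy.1, hgy.2, hbc, rfl⟩]
    · rw [Finset.card_insert_of_notMem hyX]
      have := Finset.card_pos.2 hXne
      omega
  have hy' : y ∈ K.verts \ X := Finset.mem_sdiff.2 ⟨hy, hyX⟩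
  have herase : K.verts \ insert y X = (K.verts \ X).erase y := by ext; simp; tauto
  rw [herase, Finset.card_erase_of_mem hy'] at hle
  have hpos := Finset.card_pos.2 ⟨y, hy'⟩
  have hev : Even (K.verts \ X).card := by
    rw [← even_card_cut_iff Finset.sdiff_subset, cut_compl hX, hcut]; decide
  rcases hev with ⟨r, hr⟩
  omega

lemma two_le_card_cdcs_of_card_cut_eq_two (h3 : ∀ X ⊆ K.verts, (K.cut X).card = 3 →
      X.card ≤ 1 ∨ (K.verts \ X).card ≤ 1) {X : Finset V} (hX : X ⊆ K.verts)
    (hcut : (K.cut X).card = 2) : K.verts.card = 4 ∧ 2 ≤ K.cdcs.card := by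
  have hY2 := card_compl_of_card_cut_eq_two h3 hX hcut
  have hX2 : X.card = 2 := by
    have := card_compl_of_card_cut_eq_two h3 (X := K.verts \ X) Finset.sdiff_subset
      (by rw [cut_compl hX, hcut])
    rwa [Finset.sdiff_sdiff_eq_self hX] at this
  have h4 : K.verts.card = 4 := by
    have := Finset.card_sdiff_add_card_eq_card hX
    omega
  refine ⟨h4, ?_⟩
  have hcY := cut_compl hX
  obtain ⟨e, g, heg, hc⟩ := Finset.card_eq_two.1 hcut
  obtain ⟨x, x', hxx, rfl⟩ := Finset.card_eq_two.1 hX2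
  obtain ⟨y, y', hyy, hY⟩ := Finset.card_eq_two.1 hY2
  have hverts : ∀ v, v ∈ K.verts ↔ (v = x ∨ v = x') ∨ (v = y ∨ v = y') := by
    intro v
    have := congrArg (v ∈ ·) hY
    simp only [Finset.mem_sdiff, Finset.mem_insert, Finset.mem_singleton, eq_iff_iff] at this
    have h' := @hX v
    simp only [Finset.mem_insert, Finset.mem_singleton] at h'
    tauto
  have hdis : ∀ v, (v = x ∨ v = x') → (v = y ∨ v = y') → False := by
    intro v h1 h2
    have : v ∈ K.verts \ {x, x'} := by rw [hY]; simpa using h2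
    simp only [Finset.mem_sdiff, Finset.mem_insert, Finset.mem_singleton] at this
    exact this.2 h1
  have hx : x ∈ K.verts := (hverts x).2 (by tauto)
  have hx' : x' ∈ K.verts := (hverts x').2 (by tauto)
  have hy : y ∈ K.verts := (hverts y).2 (by tauto)
  have hy' : y' ∈ K.verts := (hverts y').2 (by tauto)
  obtain ⟨a, b, hab, hae, hag, hbe, hbg, hsx⟩ := star_of_cut_pair hx hx' hxx heg hc
  obtain ⟨c, d, hcd, hce, hcg, hde, hdg, hsy⟩ := star_of_cut_pair hy hy' hyy heg
    (by rw [← hY, hcY, hc])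
  have inner : ∀ k ∈ K.star x, k ∈ K.star x' → ∀ v ∈ K.verts, k ∈ K.star v → v = x ∨ v = x' := by
    intro k h1 h2 v hv hkv
    obtain ⟨z, hz, hne, h⟩ := exists_other_end (K.star_subset x hx h1) hx h1
    have e1 := (h x' hx').1 h2
    have e2 := (h v hv).1 hkv
    rcases e1 with e1 | e1
    · exact absurd e1.symm hxx
    · rw [← e1] at e2; exact e2
  have hax : ∀ k, k = a ∨ k = b → k ∈ K.star x ∧ k ∈ K.star x' := by
    rintro k (rfl | rfl) <;> rcases hsx with ⟨h1, h2⟩ | ⟨h1, h2⟩ <;> simp [h1, h2]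
  have hcy : ∀ k, k = c ∨ k = d → k ∈ K.star y := by
    rintro k (rfl | rfl) <;> rcases hsy with ⟨h1, h2⟩ | ⟨h1, h2⟩ <;> simp [h1]
  have hne : ∀ k, (k = a ∨ k = b) → (k = c ∨ k = d) → False := by
    intro k h1 h2
    exact hdis y (inner k (hax k h1).1 (hax k h1).2 y hy (hcy k h2)) (.inl rfl)
  have hac : a ≠ c := fun h => hne a (.inl rfl) (.inl h)
  have had : a ≠ d := fun h => hne a (.inl rfl) (.inr h)
  have hbc : b ≠ c := fun h => hne b (.inr rfl) (.inl h)
  have hbd : b ≠ d := fun h => hne b (.inr rfl) (.inr h)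
  have hstar : ∀ v ∈ K.verts, K.star v = {e, a, b} ∨ K.star v = {g, a, b} ∨
      K.star v = {e, c, d} ∨ K.star v = {g, c, d} := by
    intro v hv
    rcases (hverts v).1 hv with (rfl | rfl) | (rfl | rfl)
    · rcases hsx with h | h <;> simp [h.1]
    · rcases hsx with h | h <;> simp [h.2]
    · rcases hsy with h | h <;> simp [h.1]
    · rcases hsy with h | h <;> simp [h.2]
  have hedges : K.edges = {a, b, c, d, e, g} := by
    ext k
    constructor
    · intro hk
      obtain ⟨z, hz, _, _, _, h⟩ := exists_ends hk
      have hkz := (h z hz).2 (.inl rfl)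
      rcases hstar z hz with h | h | h | h <;> rw [h] at hkz <;>
        simp only [Finset.mem_insert, Finset.mem_singleton] at hkz <;>
        rcases hkz with rfl | rfl | rfl <;> simp
    · intro hk
      have hX1 := K.star_subset x hx
      have hX2 := K.star_subset x' hx'
      have hY1 := K.star_subset y hy
      have hY2 := K.star_subset y' hy'
      simp only [Finset.mem_insert, Finset.mem_singleton] at hk
      rcases hk with rfl | rfl | rfl | rfl | rfl | rfl
      · exact hX1 (hax k (.inl rfl)).1
      · exact hX1 (hax k (.inr rfl)).1
      · exact hY1 (hcy k (.inl rfl))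
      · exact hY1 (hcy k (.inr rfl))
      · exact K.cut_subset {x, x'} (by simp [hc])
      · exact K.cut_subset {x, x'} (by simp [hc])
  refine two_le_card_cdcs_necklace hstar hedges ?_ ?_ ?_
  · simp only [List.nodup_cons, List.mem_cons, List.not_mem_nil, or_false, not_or,
      not_false_eq_true, and_true, List.nodup_nil]
    exact ⟨⟨hab, hac, had, hae, hag⟩, ⟨hbc, hbd, hbe, hbg⟩, ⟨hcd, hce, hcg⟩, ⟨hde, hdg⟩, heg⟩
  · rcases hsx with ⟨h1, h2⟩ | ⟨h1, h2⟩
    · exact ⟨x, hx, by simp [h1], by simp [h1]⟩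
    · exact ⟨x', hx', by simp [h2], by simp [h2]⟩
  · rcases hsy with ⟨h1, h2⟩ | ⟨h1, h2⟩
    · exact ⟨y, hy, by simp [h1], by simp [h1]⟩
    · exact ⟨y', hy', by simp [h2], by simp [h2]⟩

/-! ### The lower bound -/

lemma two_rpow_le_of_two_pow_le {u : ℝ} {k N : ℕ} (hu : u ≤ 100 * k) (h : 2 ^ k ≤ N) :
    (2 : ℝ) ^ (u / 100) ≤ N := by
  calc (2 : ℝ) ^ (u / 100) ≤ (2 : ℝ) ^ (k : ℝ) :=
        Real.rpow_le_rpow_of_exponent_le (by norm_num) (by linarith)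
    _ = ((2 ^ k : ℕ) : ℝ) := by rw [Real.rpow_natCast]; push_cast; rfl
    _ ≤ N := by exact_mod_cast h

lemma cube_root_pow (f : ℕ) : ((2 * (f : ℝ)) ^ ((1 : ℝ) / 3)) ^ 3 = 2 * f := by
  rw [← Real.rpow_natCast, ← Real.rpow_mul (by positivity)]
  norm_num

/-- Four vertices allow at most 12 faces, and the cube root of 24 is below 100, so two covers
suffice. -/
lemma two_rpow_le_of_card_verts_eq_four (h4 : K.verts.card = 4) {N : ℕ} (hN : 2 ≤ N) :
    (2 : ℝ) ^ ((2 * (K.faces.card : ℝ)) ^ ((1 : ℝ) / 3) / 100) ≤ N := by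
  refine two_rpow_le_of_two_pow_le (k := 1) ?_ (by simpa using hN)
  have h1 : K.faces.card ≤ 12 := by
    have := K.card_faces_le
    omega
  have h2 := cube_root_pow K.faces.card
  have h3 : (K.faces.card : ℝ) ≤ 12 := by exact_mod_cast h1
  have h0 : 0 ≤ (2 * (K.faces.card : ℝ)) ^ ((1 : ℝ) / 3) := by positivity
  by_contra hcon
  push Not at hcon
  have : (100 : ℝ) ^ 3 < ((2 * (K.faces.card : ℝ)) ^ ((1 : ℝ) / 3)) ^ 3 :=
    pow_lt_pow_left₀ (by simpa using hcon) (by norm_num) (by norm_num)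
  linarith

lemma Tight.two_rpow_le (hK : K.Tight) :
    (2 : ℝ) ^ ((2 * (K.faces.card : ℝ)) ^ ((1 : ℝ) / 3) / 100) ≤ K.cdcs.card := by
  -- Four vertices are treated apart because the argument for a long face needs that a face contains
  -- no triangle. A single centre already gives two covers.
  by_cases h4 : K.verts.card = 4
  · refine two_rpow_le_of_card_verts_eq_four h4 ?_
    obtain ⟨v, hv⟩ : K.verts.Nonempty := by rw [← Finset.card_pos]; omega
    obtain ⟨e, he⟩ : (K.star v).Nonempty := by rw [← Finset.card_pos, K.card_star v hv]; omega
    obtain ⟨Q, hQ, -⟩ := exists_sides (K.star_subset v hv he)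
    have hsparse : K.Sparse {Q} := by
      refine ⟨by simpa using hQ, fun A hA B hB _ _ _ _ => ?_⟩
      rw [Finset.mem_singleton.1 hA, Finset.mem_singleton.1 hB]
    simpa using hK.two_pow_le_of_sparse hsparse
  have hu3 := cube_root_pow K.faces.card
  have hu0 : 0 ≤ (2 * (K.faces.card : ℝ)) ^ ((1 : ℝ) / 3) := by positivity
  set u := (2 * (K.faces.card : ℝ)) ^ ((1 : ℝ) / 3) with hu
  -- The threshold `u` balances the two constructions: a face of length at least `u` gives the
  -- exponent `u / 27`, and otherwise `f / (2 * u) ^ 2 = u / 8` by `u ^ 3 = 2 * f`.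
  by_cases hlong : ∃ Q ∈ K.faces, u ≤ (K.bd Q).card
  · obtain ⟨Q, hQ, hQu⟩ := hlong
    obtain ⟨k, hk1, hk2⟩ := hK.exists_two_pow_le_of_face h4 hQ
    refine two_rpow_le_of_two_pow_le ?_ hk2
    have : ((K.bd Q).card : ℝ) ≤ k * 27 := by exact_mod_cast hk1
    have hk0 : (0 : ℝ) ≤ k := by positivity
    linarith
  · push Not at hlong
    obtain ⟨J, hJ, hcard⟩ := exists_sparse (K := K) ⌊u⌋₊ fun φ hφ => Nat.le_floor (hlong φ hφ).le
    refine two_rpow_le_of_two_pow_le ?_ (hK.two_pow_le_of_sparse hJ)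
    have hfl : (⌊u⌋₊ : ℝ) ≤ u := Nat.floor_le hu0
    have hcard' : (K.faces.card : ℝ) ≤ J.card * (2 * ⌊u⌋₊ * (2 * ⌊u⌋₊)) := by exact_mod_cast hcard
    have hJ0 : (0 : ℝ) ≤ J.card := by positivity
    rcases hu0.eq_or_lt with h0 | hpos
    · rw [← h0]; positivity
    · have h1 : (2 * ⌊u⌋₊ * (2 * ⌊u⌋₊) : ℝ) ≤ 2 * u * (2 * u) := by gcongr
      have h2 : u ^ 3 ≤ 8 * J.card * u ^ 2 := by
        have := hcard'.trans (mul_le_mul_of_nonneg_left h1 hJ0)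
        nlinarith
      have h3 : u * u ^ 2 ≤ 8 * J.card * u ^ 2 := by linarith [show u * u ^ 2 = u ^ 3 by ring]
      have h4 := le_of_mul_le_mul_right h3 (by positivity)
      linarith

theorem two_rpow_le_card_cdcs (K : FacedCubic V E Φ) (hn : 4 ≤ K.verts.card) :
    (2 : ℝ) ^ ((2 * (K.faces.card : ℝ)) ^ ((1 : ℝ) / 3) / 100) ≤ K.cdcs.card := by
  induction h : K.verts.card using Nat.strong_induction_on generalizing K with
  | _ n ih =>
    subst h
    by_cases h3 : ∀ X ⊆ K.verts, (K.cut X).card = 3 → X.card ≤ 1 ∨ (K.verts \ X).card ≤ 1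
    · by_cases h2 : ∃ X ⊆ K.verts, (K.cut X).card = 2
      · obtain ⟨X, hX, hc⟩ := h2
        obtain ⟨h4, hN⟩ := two_le_card_cdcs_of_card_cut_eq_two h3 hX hc
        exact two_rpow_le_of_card_verts_eq_four h4 hN
      · push Not at h2
        refine Tight.two_rpow_le ⟨h2, fun X hX hc => ?_, hn⟩
        have aux : ∀ Y ⊆ K.verts, (K.cut Y).card = 3 → Y.card ≤ 1 →
            ∃ v ∈ K.verts, K.cut Y = K.star v := by
          intro Y hY hc hcard
          have hne : Y.card ≠ 0 := by
            intro h0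
            rw [Finset.card_eq_zero.1 h0] at hc
            simp [oddPart] at hc
          obtain ⟨v, rfl⟩ := Finset.card_eq_one.1 (show Y.card = 1 by omega)
          have hv : v ∈ K.verts := hY (by simp)
          exact ⟨v, hv, cut_singleton hv⟩
        rcases h3 X hX hc with hle | hle
        · exact aux X hX hc hle
        · rw [← cut_compl hX] at hc ⊢
          exact aux _ Finset.sdiff_subset hc hle
    · push Not at h3
      obtain ⟨S, hS, hcut, hS1, hS2⟩ := h3
      have hcut' : (K.cut (K.verts \ S)).card = 3 := by rw [cut_compl hS, hcut]
      -- A side of a cut of three edges has an odd number of vertices. So both sides have at least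
      -- three, and each contraction is smaller than `K` but still has four vertices.
      have odd : ∀ Y ⊆ K.verts, (K.cut Y).card = 3 → 1 < Y.card → 3 ≤ Y.card := by
        intro Y hY hc h1
        have := (even_card_cut_iff hY).not.1 (by rw [hc]; decide)
        rw [Nat.not_even_iff_odd] at this
        obtain ⟨r, hr⟩ := this
        omega
      have hS3 := odd S hS hcut hS1
      have hT3 := odd _ Finset.sdiff_subset hcut' hS2
      obtain ⟨s, hs⟩ : S.Nonempty := by rw [← Finset.card_pos]; omega
      obtain ⟨t, ht⟩ : (K.verts \ S).Nonempty := by rw [← Finset.card_pos]; omega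
      have hsum := Finset.card_sdiff_add_card_eq_card hS
      have c1 := card_verts_contract hS hcut hs
      have c2 := card_verts_contract Finset.sdiff_subset hcut' ht
      rw [Finset.sdiff_sdiff_eq_self hS] at c2
      have b1 := ih _ (by omega) (K.contract hS hcut hs) (by omega) rfl
      have b2 := ih _ (by omega) (K.contract Finset.sdiff_subset hcut' ht) (by omega) rfl
      have hmul := card_cdcs_contract_mul_le hS hcut hs hcut' ht
      have hfaces := card_faces_le_contract hS hcut hs hcut' ht
      set f₁ := (K.contract hS hcut hs).faces.card
      set f₂ := (K.contract Finset.sdiff_subset hcut' ht).faces.card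
      -- Subadditivity of the cube root turns the product of the two bounds into the bound for all
      -- faces.
      have hsub : (2 * (K.faces.card : ℝ)) ^ ((1 : ℝ) / 3) ≤
          (2 * (f₁ : ℝ)) ^ ((1 : ℝ) / 3) + (2 * (f₂ : ℝ)) ^ ((1 : ℝ) / 3) := by
        have hf : (K.faces.card : ℝ) ≤ f₁ + f₂ := by exact_mod_cast hfaces
        calc (2 * (K.faces.card : ℝ)) ^ ((1 : ℝ) / 3) ≤ (2 * (f₁ : ℝ) + 2 * f₂) ^ ((1 : ℝ) / 3) :=
              Real.rpow_le_rpow (by positivity) (by linarith) (by norm_num)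
          _ ≤ _ := Real.rpow_add_le_add_rpow (by positivity) (by positivity) (by norm_num)
              (by norm_num)
      calc (2 : ℝ) ^ ((2 * (K.faces.card : ℝ)) ^ ((1 : ℝ) / 3) / 100)
          ≤ (2 : ℝ) ^ ((2 * (f₁ : ℝ)) ^ ((1 : ℝ) / 3) / 100 +
              (2 * (f₂ : ℝ)) ^ ((1 : ℝ) / 3) / 100) :=
            Real.rpow_le_rpow_of_exponent_le (by norm_num) (by linarith)
        _ = (2 : ℝ) ^ ((2 * (f₁ : ℝ)) ^ ((1 : ℝ) / 3) / 100) *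
              (2 : ℝ) ^ ((2 * (f₂ : ℝ)) ^ ((1 : ℝ) / 3) / 100) :=
            Real.rpow_add (by norm_num) _ _
        _ ≤ _ := mul_le_mul b1 b2 (by positivity) (by positivity)
        _ ≤ K.cdcs.card := by exact_mod_cast hmul

end FacedCubic

/-! ### Bridges, loops and finiteness in cubic graphs -/

namespace Graph

variable {α β : Type*} {G : Graph α β}

/-- An edge that is the only one to leave a set of vertices is a bridge. -/
lemma isBridge_of_unique {X : Set α} {e : β} {x y : α} (he : G.IsLink e x y) (hx : x ∈ X)
    (hy : y ∉ X) (h : ∀ f u v, f ≠ e → G.IsLink f u v → (u ∈ X ↔ v ∈ X)) : G.IsBridge e := by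
  refine ⟨x, y, he, fun hr => hy ?_⟩
  clear he hy
  induction hr with
  | refl => exact hx
  | tail _ hab ih =>
    obtain ⟨f, hf⟩ := hab
    rw [deleteEdges_isLink] at hf
    exact (h f _ _ (by simpa using hf.2) hf.1).1 ih

lemma IsConnected.eq_of_closed (hG : G.IsConnected) {X : Set α}
    (h : ∀ f u v, G.IsLink f u v → (u ∈ X ↔ v ∈ X)) {x y : α} (hx : x ∈ V(G)) (hy : y ∈ V(G))
    (hxX : x ∈ X) : y ∈ X := by
  have hr := hG.2 x hx y hy
  clear hy
  induction hr with
  | refl => exact hxX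
  | tail _ hab ih =>
    obtain ⟨f, hf⟩ := hab
    exact (h f _ _ hf).1 ih

lemma IsCubic.incidenceSet_finite (hG : G.IsCubic) {x : α} (hx : x ∈ V(G)) :
    (G.incidenceSet x).Finite := by
  rw [← Set.encard_lt_top_iff]
  have := hG x hx
  rw [deg] at this
  calc (G.incidenceSet x).encard ≤ (G.incidenceSet x).encard + (G.loopSet x).encard :=
        le_self_add
    _ < ⊤ := by rw [this]; exact ENat.natCast_lt_top 3

/-- A loop uses up two of the three edge ends at its vertex, so the remaining edge is the only one
to leave it, and is a bridge. -/
lemma IsCubic.not_isLink_self (hG : G.IsCubic) (hb : G.IsBridgeless) (e : β) (x : α) :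
    ¬ G.IsLink e x x := by
  intro he
  have hx := he.left_mem
  have hfin := hG.incidenceSet_finite hx
  have hsub := G.loopSet_subset_incidenceSet x
  have hfin' := hfin.subset hsub
  have hdeg := hG x hx
  rw [deg, ← hfin.cast_ncard_eq, ← hfin'.cast_ncard_eq] at hdeg
  have hdeg' : (G.incidenceSet x).ncard + (G.loopSet x).ncard = 3 := by exact_mod_cast hdeg
  have hpos : 0 < (G.loopSet x).ncard := (Set.ncard_pos hfin').2 ⟨e, he⟩
  have hd := Set.ncard_sdiff_add_ncard_of_subset hsub hfin
  have h1 : (G.incidenceSet x \ G.loopSet x).ncard = 1 := by omega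
  obtain ⟨f, hf⟩ := Set.ncard_eq_one.1 h1
  have hfm : f ∈ G.incidenceSet x \ G.loopSet x := by rw [hf]; rfl
  obtain ⟨y, hy⟩ := hfm.1
  have hyx : y ≠ x := by rintro rfl; exact hfm.2 hy
  have key : ∀ g v, g ≠ f → G.IsLink g x v → v = x := by
    intro g v hg hgv
    by_contra hv
    have : g ∈ G.incidenceSet x \ G.loopSet x :=
      ⟨⟨v, hgv⟩, fun hl => hv (IsLink.right_unique hgv hl)⟩
    rw [hf] at this
    exact hg this
  refine hb f (isBridge_of_unique (X := {x}) hy rfl hyx fun g u v hg hl => ?_)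
  simp only [Set.mem_singleton_iff]
  constructor
  · rintro rfl; exact key g v hg hl
  · rintro rfl; exact key g u hg hl.symm

lemma IsCubic.ncard_incidenceSet (hG : G.IsCubic) (hb : G.IsBridgeless) {x : α} (hx : x ∈ V(G)) :
    (G.incidenceSet x).ncard = 3 := by
  have h0 : G.loopSet x = ∅ := by
    ext e
    simpa using hG.not_isLink_self hb e x
  have := hG x hx
  rw [deg, h0, Set.encard_empty, add_zero] at this
  rw [Set.ncard, this]
  rfl

lemma IsCubic.edgeSet_finite (hG : G.IsCubic) (hfin : V(G).Finite) : E(G).Finite := by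
  refine (hfin.biUnion (t := G.incidenceSet) fun x hx => hG.incidenceSet_finite hx).subset ?_
  intro e he
  obtain ⟨x, y, h⟩ := exists_isLink_of_mem_edgeSet he
  exact Set.mem_biUnion h.left_mem h.inc_left

end Graph

namespace SurfaceEmbedding

variable {α β F : Type*} {G : Graph α β} (M : SurfaceEmbedding G F)

/-! ### Curves that cross a set of edges -/

lemma edge_mem (x : F) : M.edge x ∈ E(G) := (M.isLink x).edge_mem

lemma edge_flipFace (x : F) : M.edge (M.flipFace x) = M.edge x :=
  ((M.edge_eq_iff x _).2 (.inr (.inr (.inl rfl)))).symm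

/-- The union of the segments that run from the midpoints of the edges in `D` to the centres of
the faces. -/
def curve (D : Set β) : Graph ((α ⊕ β) ⊕ M.Face) (Sym2 F ⊕ Sym2 F) where
  vertexSet := {a | ∃ x, M.edge x ∈ D ∧ (a = Sum.inl (Sum.inr (M.edge x)) ∨ a = Sum.inr (M.face x))}
  IsLink s a b := ∃ x, M.edge x ∈ D ∧ s = Sum.inl s(x, M.flipVert x) ∧
    ((a = Sum.inl (Sum.inr (M.edge x)) ∧ b = Sum.inr (M.face x)) ∨
      (a = Sum.inr (M.face x) ∧ b = Sum.inl (Sum.inr (M.edge x))))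
  isLink_symm := by
    intro s _
    refine ⟨fun a b => ?_⟩
    rintro ⟨x, h, hs, h'⟩
    exact ⟨x, h, hs, h'.symm.imp And.symm And.symm⟩
  eq_or_eq_of_isLink_of_isLink := by
    rintro s a b c d ⟨x, -, rfl, h⟩ ⟨y, -, hs, h'⟩
    obtain ⟨h1, h2⟩ : M.edge x = M.edge y ∧ M.face x = M.face y := by
      rcases Sym2.eq_iff.1 (Sum.inl.inj hs) with ⟨rfl, -⟩ | ⟨rfl, -⟩
      · exact ⟨rfl, rfl⟩
      · exact ⟨M.edge_flipVert y, M.face_flipVert y⟩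
    rw [h1, h2] at h
    rcases h with ⟨rfl, rfl⟩ | ⟨rfl, rfl⟩ <;> rcases h' with ⟨rfl, rfl⟩ | ⟨rfl, rfl⟩ <;> simp
  left_mem_of_isLink := by
    rintro s a b ⟨x, h, -, h'⟩
    exact ⟨x, h, h'.imp And.left And.left⟩

variable {M} {D : Set β}

lemma curve_le : M.curve D ≤ M.segmentGraph where
  vertexSet_mono := by
    rintro a ⟨x, -, h⟩
    exact ⟨_, _, _, .toEdge x, h⟩
  isLink_mono := by
    rintro s a b ⟨x, -, rfl, h⟩
    exact ⟨_, _, .toEdge x, h⟩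

lemma inl_mem_edgeSet_curve {x : F} :
    Sum.inl s(x, M.flipVert x) ∈ E(M.curve D) ↔ M.edge x ∈ D := by
  constructor
  · rintro ⟨a, b, y, hy, hs, -⟩
    rcases Sym2.eq_iff.1 (Sum.inl.inj hs) with ⟨rfl, -⟩ | ⟨rfl, -⟩
    · exact hy
    · rwa [M.edge_flipVert]
  · intro h
    exact ⟨_, _, x, h, rfl, .inl ⟨rfl, rfl⟩⟩

lemma inr_notMem_edgeSet_curve {s : Sym2 F} : Sum.inr s ∉ E(M.curve D) := by
  rintro ⟨a, b, y, hy, hs, -⟩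
  simp at hs

lemma curve_not_isLoopAt (s : Sym2 F ⊕ Sym2 F) (a) : ¬ (M.curve D).IsLoopAt s a := by
  rintro ⟨x, -, -, ⟨rfl, h⟩ | ⟨rfl, h⟩⟩ <;> simp at h

lemma sym2_ne_of_edge_ne {x y : F} (h : M.edge x ≠ M.edge y) :
    s(x, M.flipVert x) ≠ s(y, M.flipVert y) := by
  intro hs
  rcases Sym2.eq_iff.1 hs with ⟨rfl, -⟩ | ⟨rfl, -⟩
  · exact h rfl
  · exact h (M.edge_flipVert y)

lemma sym2_flipFace_ne (x : F) :
    s(x, M.flipVert x) ≠ s(M.flipFace x, M.flipVert (M.flipFace x)) := by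
  intro hs
  rcases Sym2.eq_iff.1 hs with ⟨h, -⟩ | ⟨h, -⟩
  · exact M.flipFace_ne x h.symm
  · exact M.flipVert_flipFace_ne x h.symm

/-- An edge midpoint has degree two on the curve because an edge has two sides; `hface` gives degree
two at the face centres and `hpair` connectedness. `hface` counts segments rather than edges, so
that it also covers one edge with the same face on both sides. -/
lemma isSimpleClosedCurve_curve (hD : D.Finite) (hne : D.Nonempty) (hDE : D ⊆ E(G))
    (hpair : ∀ e ∈ D, ∀ g ∈ D, ∃ x y, M.edge x = e ∧ M.edge y = g ∧ M.face x = M.face y)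
    (hface : ∀ z, M.edge z ∈ D → ∃ x y, M.edge x ∈ D ∧ M.edge y ∈ D ∧ M.face x = M.face z ∧
      M.face y = M.face z ∧ s(x, M.flipVert x) ≠ s(y, M.flipVert y) ∧ ∀ w, M.edge w ∈ D →
        M.face w = M.face z →
        s(w, M.flipVert w) = s(x, M.flipVert x) ∨ s(w, M.flipVert w) = s(y, M.flipVert y)) :
    M.IsSimpleClosedCurve (M.curve D) where
  le := curve_le
  finite := by
    have hF : {x | M.edge x ∈ D}.Finite := by
      have : {x | M.edge x ∈ D} ⊆ ⋃ e ∈ D, {x | M.edge x = e} := by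
        intro x hx
        exact Set.mem_biUnion (t := fun e => {x | M.edge x = e}) hx rfl
      refine (hD.biUnion fun e _ => ?_).subset this
      by_cases h : ∃ y, M.edge y = e
      · obtain ⟨y, rfl⟩ := h
        refine (Set.toFinite {y, M.flipVert y, M.flipFace y, M.flipVert (M.flipFace y)}).subset ?_
        intro x hx
        exact (M.edge_eq_iff y x).1 (Eq.symm hx)
      · convert Set.finite_empty
        ext x
        simp only [Set.mem_ofPred_eq, Set.mem_empty_iff_false, iff_false]
        exact fun hx => h ⟨x, hx⟩
    refine ((hF.image fun x => Sum.inl (Sum.inr (M.edge x))).union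
      (hF.image fun x => Sum.inr (M.face x))).subset ?_
    rintro a ⟨x, hx, rfl | rfl⟩
    · exact .inl ⟨x, hx, rfl⟩
    · exact .inr ⟨x, hx, rfl⟩
  connected := by
    have hadj : ∀ x, M.edge x ∈ D →
        (M.curve D).Adj (Sum.inl (Sum.inr (M.edge x))) (Sum.inr (M.face x)) :=
      fun x hx => ⟨_, x, hx, rfl, .inl ⟨rfl, rfl⟩⟩
    have hmid : ∀ e ∈ D, ∀ g ∈ D, Relation.ReflTransGen (M.curve D).Adj
        (Sum.inl (Sum.inr e)) (Sum.inl (Sum.inr g)) := by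
      intro e he g hg
      obtain ⟨x, y, rfl, rfl, hxy⟩ := hpair e he g hg
      exact .tail (.single (hadj x he)) (hxy ▸ (hadj y hg).symm)
    refine ⟨?_, ?_⟩
    · obtain ⟨e, he⟩ := hne
      obtain ⟨x, rfl⟩ := M.exists_edge e (hDE he)
      exact ⟨_, x, he, .inl rfl⟩
    · rintro a ⟨x, hx, ha⟩ b ⟨y, hy, hb⟩
      have h1 : Relation.ReflTransGen (M.curve D).Adj a (Sum.inl (Sum.inr (M.edge x))) := by
        rcases ha with rfl | rfl
        · exact .refl
        · exact .single (hadj x hx).symm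
      have h2 : Relation.ReflTransGen (M.curve D).Adj (Sum.inl (Sum.inr (M.edge y))) b := by
        rcases hb with rfl | rfl
        · exact .refl
        · exact .single (hadj y hy)
      exact h1.trans ((hmid _ hx _ hy).trans h2)
  deg_eq_two := by
    have hloop : ∀ a, (M.curve D).loopSet a = ∅ := by
      intro a
      ext s
      simpa using curve_not_isLoopAt s a
    rintro a ⟨z, hz, ha⟩
    rw [Graph.deg, hloop, Set.encard_empty, add_zero, Set.encard_eq_two]
    rcases ha with rfl | rfl
    · refine ⟨Sum.inl s(z, M.flipVert z), Sum.inl s(M.flipFace z, M.flipVert (M.flipFace z)),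
        fun h => sym2_flipFace_ne z (Sum.inl.inj h), ?_⟩
      ext s
      simp only [Graph.mem_incidenceSet, Set.mem_insert_iff, Set.mem_singleton_iff]
      constructor
      · rintro ⟨b, x, hx, rfl, ⟨h, -⟩ | ⟨h, -⟩⟩
        · simp only [Sum.inl.injEq, Sum.inr.injEq] at h ⊢
          rcases (M.edge_eq_iff z x).1 h with rfl | rfl | rfl | rfl
          · exact .inl rfl
          · left; rw [M.flipVert_invol z, Sym2.eq_swap]
          · exact .inr rfl
          · right; rw [M.flipVert_invol, Sym2.eq_swap]
        · simp at h
      · rintro (rfl | rfl)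
        · exact ⟨_, z, hz, rfl, .inl ⟨rfl, rfl⟩⟩
        · exact ⟨_, M.flipFace z, by rwa [M.edge_flipFace], rfl, .inl ⟨by rw [M.edge_flipFace], rfl⟩⟩
    · obtain ⟨x, y, hx, hy, hxz, hyz, hxy, hw⟩ := hface z hz
      refine ⟨Sum.inl s(x, M.flipVert x), Sum.inl s(y, M.flipVert y),
        fun h => hxy (Sum.inl.inj h), ?_⟩
      ext s
      simp only [Graph.mem_incidenceSet, Set.mem_insert_iff, Set.mem_singleton_iff]
      constructor
      · rintro ⟨b, w, hwD, rfl, ⟨h, -⟩ | ⟨h, -⟩⟩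
        · simp at h
        · simp only [Sum.inr.injEq, Sum.inl.injEq] at h ⊢
          exact hw w hwD h.symm
      · rintro (rfl | rfl)
        · exact ⟨_, x, hx, rfl, .inr ⟨by rw [hxz], rfl⟩⟩
        · exact ⟨_, y, hy, rfl, .inr ⟨by rw [hyz], rfl⟩⟩

lemma numPoints_curve_le : M.numPoints (M.curve D) ≤ D.encard := by
  rw [numPoints, ← (Sum.inr_injective (α := α)).encard_image D]
  refine Set.encard_le_encard ?_
  rintro p ⟨x, hx, h | h⟩
  · simp only [Sum.inl.injEq] at h
    exact ⟨_, hx, h.symm⟩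
  · simp at h

/-- If a curve does not have a connected complement, the vertices on one side are separated from
the others by the edges that it crosses. -/
lemma exists_side_of_not_isNonseparating (h : ¬ M.IsNonseparating (M.curve D)) :
    ∃ X : Set α, (∃ u ∈ V(G), u ∈ X) ∧ (∃ v ∈ V(G), v ∉ X) ∧
      ∀ e u v, e ∉ D → G.IsLink e u v → (u ∈ X ↔ v ∈ X) := by
  simp only [IsNonseparating, not_forall] at h
  obtain ⟨x, y, hxy⟩ := h
  -- The curve crosses edges at their midpoints and avoids the vertices. So all flags at a vertex
  -- are on the same side, and "side" makes sense for vertices.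
  have hclass : ∀ z w, M.vert z = M.vert w → Relation.EqvGen (M.AdjOff (M.curve D)) z w := by
    intro z w hzw
    refine ((M.vert_eq_iff z w).1 hzw).mono ?_
    rintro a b (rfl | rfl)
    · exact .inr (.inl ⟨rfl, inr_notMem_edgeSet_curve⟩)
    · exact .inr (.inr rfl)
  refine ⟨{u | ∃ z, M.vert z = u ∧ Relation.EqvGen (M.AdjOff (M.curve D)) x z},
    ⟨M.vert x, (M.isLink x).left_mem, x, rfl, .refl x⟩,
    ⟨M.vert y, (M.isLink y).left_mem, ?_⟩, ?_⟩
  · rintro ⟨z, hz, hxz⟩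
    exact hxy (hxz.trans _ _ _ (hclass z y hz))
  · intro e u v he huv
    obtain ⟨z, rfl⟩ := M.exists_edge e huv.edge_mem
    have hzz : Relation.EqvGen (M.AdjOff (M.curve D)) z (M.flipVert z) :=
      .rel _ _ (.inl ⟨rfl, fun h => he (inl_mem_edgeSet_curve.1 h)⟩)
    have hmem : ∀ w, (M.vert w ∈ {u | ∃ z, M.vert z = u ∧
        Relation.EqvGen (M.AdjOff (M.curve D)) x z}) ↔
        Relation.EqvGen (M.AdjOff (M.curve D)) x w :=
      fun w => ⟨fun ⟨z, hz, hxz⟩ => hxz.trans _ _ _ (hclass z w hz), fun h => ⟨w, rfl, h⟩⟩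
    have hboth : Relation.EqvGen (M.AdjOff (M.curve D)) x z ↔
        Relation.EqvGen (M.AdjOff (M.curve D)) x (M.flipVert z) :=
      ⟨fun h => h.trans _ _ _ hzz, fun h => h.trans _ _ _ (hzz.symm _ _)⟩
    rcases huv.eq_and_eq_or_eq_and_eq (M.isLink z) with ⟨rfl, rfl⟩ | ⟨rfl, rfl⟩
    · rw [hmem, hmem, hboth]
    · rw [hmem, hmem, hboth]

lemma exists_side (hrep : 4 ≤ M.representativity) (hD3 : D.encard ≤ 3) (hne : D.Nonempty)
    (hDE : D ⊆ E(G))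
    (hpair : ∀ e ∈ D, ∀ g ∈ D, ∃ x y, M.edge x = e ∧ M.edge y = g ∧ M.face x = M.face y)
    (hface : ∀ z, M.edge z ∈ D → ∃ x y, M.edge x ∈ D ∧ M.edge y ∈ D ∧ M.face x = M.face z ∧
      M.face y = M.face z ∧ s(x, M.flipVert x) ≠ s(y, M.flipVert y) ∧ ∀ w, M.edge w ∈ D →
        M.face w = M.face z →
        s(w, M.flipVert w) = s(x, M.flipVert x) ∨ s(w, M.flipVert w) = s(y, M.flipVert y)) :
    ∃ X : Set α, (∃ u ∈ V(G), u ∈ X) ∧ (∃ v ∈ V(G), v ∉ X) ∧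
      ∀ e u v, e ∉ D → G.IsLink e u v → (u ∈ X ↔ v ∈ X) := by
  have hfin : D.Finite := Set.encard_lt_top_iff.1 (hD3.trans_lt (ENat.natCast_lt_top 3))
  have hC := isSimpleClosedCurve_curve hfin hne hDE hpair hface
  refine exists_side_of_not_isNonseparating (M := M) fun hns => ?_
  have h1 : M.representativity ≤ M.numPoints (M.curve D) :=
    iInf_le_of_le _ (iInf_le_of_le hC (iInf_le_of_le hns le_rfl))
  have h2 : (4 : ℕ∞) ≤ 3 := hrep.trans (h1.trans (numPoints_curve_le.trans hD3))
  exact absurd h2 (by decide)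

/-- The two sides of an edge belong to different faces. -/
lemma face_flipFace_ne (hconn : G.IsConnected) (hb : G.IsBridgeless)
    (hrep : 4 ≤ M.representativity) (x : F) : M.face (M.flipFace x) ≠ M.face x := by
  intro hx
  have hall : ∀ w, M.edge w = M.edge x → M.face w = M.face x ∧
      (s(w, M.flipVert w) = s(x, M.flipVert x) ∨
        s(w, M.flipVert w) = s(M.flipFace x, M.flipVert (M.flipFace x))) := by
    intro w hw
    rcases (M.edge_eq_iff x w).1 hw.symm with rfl | rfl | rfl | rfl
    · exact ⟨rfl, .inl rfl⟩
    · exact ⟨M.face_flipVert _, .inl (by rw [M.flipVert_invol, Sym2.eq_swap])⟩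
    · exact ⟨hx, .inr rfl⟩
    · exact ⟨(M.face_flipVert _).trans hx, .inr (by rw [M.flipVert_invol, Sym2.eq_swap])⟩
  obtain ⟨X, ⟨u, hu, huX⟩, ⟨v, hv, hvX⟩, hX⟩ := exists_side (M := M) (D := {M.edge x}) hrep
    (by simp) (by simp) (by simpa using M.edge_mem x)
    (by
      rintro e rfl g rfl
      exact ⟨x, x, rfl, rfl, rfl⟩)
    (by
      intro z hz
      refine ⟨x, M.flipFace x, rfl, M.edge_flipFace x, (hall z hz).1.symm,
        hx.trans (hall z hz).1.symm, sym2_flipFace_ne x, fun w hw _ => (hall w hw).2⟩)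
  have hlink := M.isLink x
  -- The closed curve through the single edge separates the surface. If the ends of the edge were on
  -- the same side, `G` would be disconnected; otherwise the edge is a bridge.
  by_cases h : (M.vert x ∈ X ↔ M.vert (M.flipVert x) ∈ X)
  · refine hvX (hconn.eq_of_closed (X := X) (fun f a b hf => ?_) hu hv huX)
    by_cases hfe : f = M.edge x
    · subst hfe
      rcases hf.eq_and_eq_or_eq_and_eq hlink with ⟨rfl, rfl⟩ | ⟨rfl, rfl⟩
      · exact h
      · exact h.symm
    · exact hX f a b hfe hf
  · have hX' : ∀ f a b, f ≠ M.edge x → G.IsLink f a b → (a ∈ X ↔ b ∈ X) :=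
      fun f a b hf => hX f a b hf
    by_cases hxX : M.vert x ∈ X
    · exact hb _ (Graph.isBridge_of_unique hlink hxX (by tauto) hX')
    · exact hb _ (Graph.isBridge_of_unique hlink.symm (by tauto) hxX hX')

end SurfaceEmbedding

/-- A finite set with an involution without fixed points has an even number of elements. -/
lemma Finset.even_card_of_involution {ι : Type*} (s : Finset ι) (f : ι → ι)
    (hf : ∀ a ∈ s, f a ∈ s) (hinv : Function.Involutive f) (hne : ∀ a, f a ≠ a) :
    Even s.card := by
  have h := Finset.sum_involution (s := s) (f := fun _ => (1 : ZMod 2)) (fun a _ => f a)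
    (fun a _ => by decide) (fun a _ _ => hne a) hf (fun a _ => hinv a)
  rw [Finset.sum_const, nsmul_one] at h
  exact even_iff_two_dvd.2 ((ZMod.natCast_eq_zero_iff _ 2).1 h)

namespace SurfaceEmbedding

variable {α β F : Type*} {G : Graph α β} {M : SurfaceEmbedding G F}

/-! ### The faces of an embedding as a double cover -/

lemma flag_finite (M : SurfaceEmbedding G F) (hE : E(G).Finite) : Finite F := by
  have : (Set.univ : Set F) ⊆ ⋃ e ∈ E(G), {x | M.edge x = e} := by
    intro x _
    exact Set.mem_biUnion (t := fun e => {x | M.edge x = e}) (M.edge_mem x) rfl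
  refine Set.finite_univ_iff.1 ((hE.biUnion fun e he => ?_).subset this)
  obtain ⟨y, rfl⟩ := M.exists_edge e he
  refine (Set.toFinite {y, M.flipVert y, M.flipFace y, M.flipVert (M.flipFace y)}).subset ?_
  intro x hx
  exact (M.edge_eq_iff y x).1 (Eq.symm hx)

/-- The flags of an edge on a face are the two flags along one side of the edge. -/
lemma eq_or_eq_flipVert (hne : ∀ x, M.face (M.flipFace x) ≠ M.face x) {x y : F}
    (he : M.edge x = M.edge y) (hf : M.face x = M.face y) : y = x ∨ y = M.flipVert x := by
  rcases (M.edge_eq_iff x y).1 he with h | h | rfl | rfl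
  · exact .inl h
  · exact .inr h
  · exact absurd hf.symm (hne x)
  · exact absurd (hf.trans (M.face_flipVert _)).symm (hne x)

lemma face_eq_of_edge_eq {x y : F} (he : M.edge x = M.edge y) :
    M.face y = M.face x ∨ M.face y = M.face (M.flipFace x) := by
  rcases (M.edge_eq_iff x y).1 he with rfl | rfl | rfl | rfl
  · exact .inl rfl
  · exact .inl (M.face_flipVert x)
  · exact .inr rfl
  · exact .inr (M.face_flipVert _)

variable (M) in
/-- The edges on the boundary of a face. -/
noncomputable def boundary (S : Finset β) (φ : M.Face) : Finset β :=
  S.filter fun e => ∃ x, M.edge x = e ∧ M.face x = φ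

variable {S : Finset β}

lemma mem_boundary (hS : ∀ e, e ∈ S ↔ e ∈ E(G)) {φ : M.Face} {e : β} :
    e ∈ M.boundary S φ ↔ ∃ x, M.edge x = e ∧ M.face x = φ := by
  simp only [boundary, Finset.mem_filter, and_iff_right_iff_imp]
  rintro ⟨x, rfl, -⟩
  exact (hS _).2 (M.edge_mem x)

/-- The boundary of a face has an even number of edges at every vertex. -/
lemma even_card_boundary_inter [Finite F] (hloop : ∀ e u, ¬ G.IsLink e u u)
    (hne : ∀ x, M.face (M.flipFace x) ≠ M.face x) (hS : ∀ e, e ∈ S ↔ e ∈ E(G)) (φ : M.Face)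
    (v : α) : Even (M.boundary S φ ∩ S.filter fun e => G.Inc e v).card := by
  cases nonempty_fintype F
  set T := (Finset.univ : Finset F).filter fun x => M.face x = φ ∧ M.vert x = v with hT
  have hev : Even T.card := by
    refine Finset.even_card_of_involution T M.flipEdge (fun x hx => ?_) M.flipEdge_invol
      M.flipEdge_ne
    simp only [hT, Finset.mem_filter, Finset.mem_univ, true_and] at hx ⊢
    rwa [M.face_flipEdge, M.vert_flipEdge]
  convert hev using 1
  -- The flags of `φ` at `v` are paired off by `flipEdge`. They correspond to the edges of `φ` at
  -- `v` one to one, because there are no loops and the two sides of an edge belong to different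
  -- faces.
  refine (Finset.card_nbij M.edge ?_ ?_ ?_).symm
  · intro x hx
    simp only [hT, Finset.coe_filter, Finset.mem_univ, true_and, Set.mem_ofPred_eq] at hx
    rw [Finset.mem_coe, Finset.mem_inter, mem_boundary hS, Finset.mem_filter, hS]
    exact ⟨⟨x, rfl, hx.1⟩, M.edge_mem x, hx.2 ▸ (M.isLink x).inc_left⟩
  · intro x hx y hy hxy
    simp only [hT, Finset.coe_filter, Finset.mem_univ, true_and, Set.mem_ofPred_eq] at hx hy
    rcases eq_or_eq_flipVert hne hxy (hx.1.trans hy.1.symm) with h | h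
    · exact h.symm
    · have := M.isLink x
      rw [← h, hx.2, hy.2] at this
      exact absurd this (hloop _ _)
  · intro e he
    rw [Finset.mem_coe, Finset.mem_inter, mem_boundary hS, Finset.mem_filter] at he
    obtain ⟨⟨x, rfl, hx⟩, -, hv⟩ := he
    rcases hv.eq_or_eq_of_isLink (M.isLink x) with h | h
    · exact ⟨x, by simp [hT, hx, h], rfl⟩
    · exact ⟨M.flipVert x, by simp [hT, hx, h, M.face_flipVert], M.edge_flipVert x⟩

lemma card_sides [Fintype M.Face] (hne : ∀ x, M.face (M.flipFace x) ≠ M.face x)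
    (hS : ∀ e, e ∈ S ↔ e ∈ E(G)) {e : β} (he : e ∈ S) :
    ((Finset.univ : Finset M.Face).filter fun φ => e ∈ M.boundary S φ).card = 2 := by
  obtain ⟨x, rfl⟩ := M.exists_edge e ((hS e).1 he)
  rw [Finset.card_eq_two]
  refine ⟨M.face x, M.face (M.flipFace x), (hne x).symm, ?_⟩
  ext φ
  simp only [Finset.mem_filter, Finset.mem_univ, true_and, Finset.mem_insert,
    Finset.mem_singleton]
  rw [mem_boundary hS]
  constructor
  · rintro ⟨y, hy, rfl⟩
    exact face_eq_of_edge_eq hy.symm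
  · rintro (rfl | rfl)
    · exact ⟨x, rfl, rfl⟩
    · exact ⟨M.flipFace x, M.edge_flipFace x, rfl⟩

/-- Two edges of a set of at most three edges that is even in the dual graph have a common face. -/
lemma exists_common_face [Fintype M.Face] (hne : ∀ x, M.face (M.flipFace x) ≠ M.face x)
    (hS : ∀ e, e ∈ S ↔ e ∈ E(G)) {D : Finset β} (hDS : D ⊆ S) (hcard : D.card = 2 ∨ D.card = 3)
    (hev : ∀ φ, Even (M.boundary S φ ∩ D).card) {e g : β} (he : e ∈ D) (hg : g ∈ D)
    (heg : e ≠ g) : ∃ φ, e ∈ M.boundary S φ ∧ g ∈ M.boundary S φ := by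
  rcases hcard with h2 | h3
  · have hD : D = {e, g} := (Finset.eq_of_subset_of_card_le
      (by intro x hx; simp only [Finset.mem_insert, Finset.mem_singleton] at hx
          rcases hx with rfl | rfl <;> assumption) (by rw [h2, Finset.card_pair heg])).symm
    obtain ⟨x, rfl⟩ := M.exists_edge e ((hS e).1 (hDS he))
    have hx : M.edge x ∈ M.boundary S (M.face x) := (mem_boundary hS).2 ⟨x, rfl, rfl⟩
    refine ⟨M.face x, hx, ?_⟩
    by_contra hgx
    have h1 := hev (M.face x)
    have : M.boundary S (M.face x) ∩ D = {M.edge x} := by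
      rw [hD]; ext y
      simp only [Finset.mem_inter, Finset.mem_insert, Finset.mem_singleton]
      constructor
      · rintro ⟨hy, rfl | rfl⟩
        · rfl
        · exact absurd hy hgx
      · rintro rfl
        exact ⟨hx, .inl rfl⟩
    simp [this] at h1
  · have : ((D.erase e).erase g).card = 1 := by
      rw [Finset.card_erase_of_mem (by simp [hg, heg.symm]), Finset.card_erase_of_mem he, h3]
    obtain ⟨h, hh⟩ := Finset.card_eq_one.1 this
    have hm : h ∈ (D.erase e).erase g := by simp [hh]
    simp only [Finset.mem_erase] at hm
    have hD : D = {e, g, h} := by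
      rw [← hh, Finset.insert_erase (by simp [hg, heg.symm]), Finset.insert_erase he]
    -- The counting used at a cubic vertex, now in the dual: the faces meet the three edges evenly
    -- and cover each twice, so exactly one face contains any two of them.
    have h1 := card_filter_pair_eq_one (I := (Finset.univ : Finset M.Face)) (A := M.boundary S)
      heg hm.2.1.symm hm.1.symm (fun φ _ => hD ▸ hev φ) (card_sides hne hS (hDS he))
      (card_sides hne hS (hDS hg)) (card_sides hne hS (hDS hm.2.2))
    obtain ⟨φ, hφ⟩ := Finset.card_pos.1 (h1.symm ▸ Nat.one_pos)
    exact ⟨φ, (Finset.mem_filter.1 hφ).2⟩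

lemma boundary_inter_eq_pair {D : Finset β} (hcard : D.card ≤ 3) {φ : M.Face}
    (hev : Even (M.boundary S φ ∩ D).card) {e g : β} (heg : e ≠ g)
    (he : e ∈ M.boundary S φ ∩ D) (hg : g ∈ M.boundary S φ ∩ D) :
    M.boundary S φ ∩ D = {e, g} := by
  refine (Finset.eq_of_subset_of_card_le ?_ ?_).symm
  · intro x hx
    simp only [Finset.mem_insert, Finset.mem_singleton] at hx
    rcases hx with rfl | rfl <;> assumption
  · rw [Finset.card_pair heg]
    have := Finset.card_le_card (Finset.inter_subset_right (s₁ := M.boundary S φ) (s₂ := D))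
    obtain ⟨r, hr⟩ := hev
    omega

/-- A set of two or three edges that is even in the dual graph is a cut. -/
lemma exists_cut [Finite F] [Fintype M.Face] (hconn : G.IsConnected)
    (hrep : 4 ≤ M.representativity) (hloop : ∀ e u, ¬ G.IsLink e u u)
    (hne : ∀ x, M.face (M.flipFace x) ≠ M.face x) (hS : ∀ e, e ∈ S ↔ e ∈ E(G)) {W : Finset α}
    (hW : ∀ v, v ∈ W ↔ v ∈ V(G)) {D : Finset β} (hDS : D ⊆ S) (hcard : D.card = 2 ∨ D.card = 3)
    (hev : ∀ φ, Even (M.boundary S φ ∩ D).card) :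
    ∃ X ⊆ W, oddPart S X (fun v => S.filter fun e => G.Inc e v) = D := by
  have hD3 : D.card ≤ 3 := by omega
  have hDne : D.Nonempty := by rw [← Finset.card_pos]; omega
  obtain ⟨X, ⟨u, hu, huX⟩, ⟨v, hv, hvX⟩, hX⟩ := exists_side (M := M) (D := (D : Set β)) hrep
    (by rw [Set.encard_coe_eq_coe_finsetCard]; exact_mod_cast hD3) (by simpa using hDne)
    (fun e he => (hS e).1 (hDS he)) (by
      intro e he g hg
      by_cases heg : e = g
      · subst heg
        obtain ⟨x, rfl⟩ := M.exists_edge e ((hS e).1 (hDS he))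
        exact ⟨x, x, rfl, rfl, rfl⟩
      · obtain ⟨φ, h1, h2⟩ := exists_common_face hne hS hDS hcard hev he hg heg
        rw [mem_boundary hS] at h1 h2
        obtain ⟨x, hx, hxφ⟩ := h1
        obtain ⟨y, hy, hyφ⟩ := h2
        exact ⟨x, y, hx, hy, hxφ.trans hyφ.symm⟩) (by
      intro z hz
      have hzm : M.edge z ∈ M.boundary S (M.face z) ∩ D :=
        Finset.mem_inter.2 ⟨(mem_boundary hS).2 ⟨z, rfl, rfl⟩, hz⟩
      obtain ⟨g, hg, hgz⟩ : ∃ g ∈ M.boundary S (M.face z) ∩ D, g ≠ M.edge z := by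
        by_contra! hcon
        have h1 := hev (M.face z)
        rw [Finset.eq_singleton_iff_unique_mem.2 ⟨hzm, hcon⟩] at h1
        simp at h1
      have hpair := boundary_inter_eq_pair hD3 (hev (M.face z)) hgz.symm hzm hg
      obtain ⟨hg1, hgD⟩ := Finset.mem_inter.1 hg
      obtain ⟨y, rfl, hyz⟩ := (mem_boundary hS).1 hg1
      refine ⟨z, y, hz, hgD, rfl, hyz, sym2_ne_of_edge_ne hgz.symm, fun w hw hwz => ?_⟩
      have hwm : M.edge w ∈ M.boundary S (M.face z) ∩ D :=
        Finset.mem_inter.2 ⟨(mem_boundary hS).2 ⟨w, rfl, hwz⟩, hw⟩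
      have same : ∀ x, M.edge x = M.edge w → M.face x = M.face w →
          s(w, M.flipVert w) = s(x, M.flipVert x) := by
        intro x h1 h2
        rcases eq_or_eq_flipVert hne h1 h2 with rfl | rfl
        · rfl
        · rw [M.flipVert_invol, Sym2.eq_swap]
      rw [hpair, Finset.mem_insert, Finset.mem_singleton] at hwm
      rcases hwm with h | h
      · exact .inl (same z h.symm hwz.symm)
      · exact .inr (same y h.symm (hyz.trans hwz.symm)))
  set Y := W.filter (· ∈ X) with hY
  have hmem : ∀ {e a b}, G.IsLink e a b →
      (e ∈ oddPart S Y (fun v => S.filter fun e => G.Inc e v) ↔ ¬ (a ∈ X ↔ b ∈ X)) := by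
    intro e a b hl
    have hab : a ≠ b := by rintro rfl; exact hloop _ _ hl
    have heS : e ∈ S := (hS e).2 hl.edge_mem
    have hends : ∀ v ∈ W, e ∈ S.filter (fun e => G.Inc e v) ↔ v = a ∨ v = b := by
      intro v _
      rw [Finset.mem_filter]
      refine ⟨fun h => h.2.eq_or_eq_of_isLink hl, ?_⟩
      rintro (rfl | rfl)
      · exact ⟨heS, hl.inc_left⟩
      · exact ⟨heS, hl.inc_right⟩
    rw [mem_oddPart, FacedCubic.odd_card_filter_pair hab (Finset.filter_subset _ _) hends]
    simp only [heS, true_and, Finset.mem_filter, hW, hl.left_mem, hl.right_mem]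
    tauto
  have hsub : oddPart S Y (fun v => S.filter fun e => G.Inc e v) ⊆ D := by
    intro e he
    obtain ⟨a, b, hl⟩ := Graph.exists_isLink_of_mem_edgeSet ((hS e).1 (mem_oddPart.1 he).1)
    by_contra heD
    exact (hmem hl).1 he (hX e a b heD hl)
  refine ⟨Y, Finset.filter_subset _ _, hsub.antisymm ?_⟩
  -- The curve shows only that the cut of `Y` is contained in `D`. It is nonempty by connectedness.
  -- If it contained `e` but missed some `g ∈ D`, a common face of `e` and `g` would meet it in `e`
  -- alone, against evenness.
  obtain ⟨e, he⟩ : (oddPart S Y (fun v => S.filter fun e => G.Inc e v)).Nonempty := by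
    by_contra hcon
    rw [Finset.not_nonempty_iff_eq_empty] at hcon
    refine hvX (hconn.eq_of_closed (X := X) (fun f a b hf => ?_) hu hv huX)
    have := (hmem hf).not.1 (by rw [hcon]; simp)
    tauto
  intro g hg
  by_contra hgn
  have heg : e ≠ g := by rintro rfl; exact hgn he
  obtain ⟨φ, h1, h2⟩ := exists_common_face hne hS hDS hcard hev (hsub he) hg heg
  have hpair := boundary_inter_eq_pair hD3 (hev φ) heg (Finset.mem_inter.2 ⟨h1, hsub he⟩)
    (Finset.mem_inter.2 ⟨h2, hg⟩)
  have heven : Even (M.boundary S φ ∩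
      oddPart S Y (fun v => S.filter fun e => G.Inc e v)).card := by
    refine even_card_inter_oddPart_of_even (Finset.filter_subset _ _) fun v _ => ?_
    rw [Finset.inter_comm]
    exact even_card_boundary_inter hloop hne hS φ v
  have hone : M.boundary S φ ∩ oddPart S Y (fun v => S.filter fun e => G.Inc e v) = {e} := by
    ext k
    rw [Finset.mem_inter, Finset.mem_singleton]
    constructor
    · rintro ⟨hk1, hk2⟩
      have : k ∈ M.boundary S φ ∩ D := Finset.mem_inter.2 ⟨hk1, hsub hk2⟩
      rw [hpair, Finset.mem_insert, Finset.mem_singleton] at this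
      rcases this with h | rfl
      · exact h
      · exact absurd hk2 hgn
    · rintro rfl
      exact ⟨h1, he⟩
  simp [hone] at heven

/-- The combinatorial data of an embedding of representativity at least four. -/
noncomputable def facedCubic (M : SurfaceEmbedding G F) [Finite F] [Fintype M.Face]
    (hconn : G.IsConnected) (hcubic : G.IsCubic) (hb : G.IsBridgeless)
    (hrep : 4 ≤ M.representativity) (W : Finset α) (hW : ∀ v, v ∈ W ↔ v ∈ V(G)) (S : Finset β)
    (hS : ∀ e, e ∈ S ↔ e ∈ E(G)) : FacedCubic α β M.Face where
  verts := W
  edges := S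
  faces := Finset.univ
  star v := S.filter fun e => G.Inc e v
  bd := M.boundary S
  star_subset _ _ := Finset.filter_subset _ _
  card_star v hv := by
    rw [← hcubic.ncard_incidenceSet hb ((hW v).1 hv), ← Set.ncard_coe_finset]
    congr 1
    ext e
    simp only [Finset.coe_filter, Set.mem_ofPred_eq, Graph.mem_incidenceSet,
      and_iff_right_iff_imp]
    exact fun h => (hS e).2 h.edge_mem
  card_ends e he := by
    obtain ⟨x, y, hl⟩ := Graph.exists_isLink_of_mem_edgeSet ((hS e).1 he)
    rw [Finset.card_eq_two]
    refine ⟨x, y, by rintro rfl; exact hcubic.not_isLink_self hb _ _ hl, ?_⟩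
    ext v
    simp only [Finset.mem_filter, Finset.mem_insert, Finset.mem_singleton, he, true_and]
    refine ⟨fun h => h.2.eq_or_eq_of_isLink hl, ?_⟩
    rintro (rfl | rfl)
    · exact ⟨(hW _).2 hl.left_mem, hl.inc_left⟩
    · exact ⟨(hW _).2 hl.right_mem, hl.inc_right⟩
  bd_subset _ _ := Finset.filter_subset _ _
  bd_nonempty φ _ := by
    obtain ⟨x, rfl⟩ := Quot.exists_rep φ
    exact ⟨M.edge x, (mem_boundary hS).2 ⟨x, rfl, rfl⟩⟩
  bd_even φ _ v _ := even_card_boundary_inter (hcubic.not_isLink_self hb)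
    (face_flipFace_ne hconn hb hrep) hS φ v
  card_sides _ he := card_sides (face_flipFace_ne hconn hb hrep) hS he
  conn X hX h := by
    by_cases hne : X = ∅
    · exact .inl hne
    right
    obtain ⟨x, hx⟩ := Finset.nonempty_iff_ne_empty.2 hne
    refine hX.antisymm fun y hy => ?_
    refine Finset.mem_coe.1 (hconn.eq_of_closed (X := X) (fun f a b hf => ?_) ((hW x).1 (hX hx))
      ((hW y).1 hy) hx)
    have hab : a ≠ b := by rintro rfl; exact hcubic.not_isLink_self hb _ _ hf
    have hfS : f ∈ S := (hS f).2 hf.edge_mem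
    have hends : ∀ v ∈ W, f ∈ S.filter (fun e => G.Inc e v) ↔ v = a ∨ v = b := by
      intro v _
      rw [Finset.mem_filter]
      refine ⟨fun h => h.2.eq_or_eq_of_isLink hf, ?_⟩
      rintro (rfl | rfl)
      · exact ⟨hfS, hf.inc_left⟩
      · exact ⟨hfS, hf.inc_right⟩
    have hnot : f ∉ oddPart S X (fun v => S.filter fun e => G.Inc e v) := by rw [h]; simp
    rw [mem_oddPart, FacedCubic.odd_card_filter_pair hab hX hends] at hnot
    simp only [hfS, true_and] at hnot
    simp only [Finset.mem_coe]
    tauto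
  dual _ hD hcard hev := exists_cut hconn hrep (hcubic.not_isLink_self hb)
    (face_flipFace_ne hconn hb hrep) hS hW hD hcard fun φ => hev φ (Finset.mem_univ φ)

end SurfaceEmbedding

namespace Graph

variable {α β Φ : Type*} {G : Graph α β}

/-! ### Circuits as subgraphs -/

variable (G) in
/-- The subgraph formed by a set of edges and their ends. -/
def ofEdges (C : Set β) : Graph α β where
  vertexSet := {x | ∃ e ∈ C, G.Inc e x}
  IsLink e x y := e ∈ C ∧ G.IsLink e x y
  isLink_symm := fun _ _ => ⟨fun _ _ h => ⟨h.1, h.2.symm⟩⟩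
  eq_or_eq_of_isLink_of_isLink := fun _ _ _ _ _ h h' => h.2.left_eq_or_eq h'.2
  left_mem_of_isLink := fun e _ _ h => ⟨e, h.1, h.2.inc_left⟩

lemma ofEdges_inc {C : Set β} {e : β} {x : α} : (G.ofEdges C).Inc e x ↔ e ∈ C ∧ G.Inc e x :=
  ⟨fun ⟨y, h⟩ => ⟨h.1, y, h.2⟩, fun ⟨h, y, h'⟩ => ⟨y, h, h'⟩⟩

lemma edgeSet_ofEdges {C : Set β} (hC : C ⊆ E(G)) : E(G.ofEdges C) = C := by
  ext e
  refine ⟨fun ⟨x, y, h⟩ => h.1, fun h => ?_⟩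
  obtain ⟨x, y, hl⟩ := exists_isLink_of_mem_edgeSet (hC h)
  exact ⟨x, y, h, hl⟩

lemma isCircuitOf_ofEdges {K : FacedCubic α β Φ} (hverts : ∀ v, v ∈ K.verts ↔ v ∈ V(G))
    (hstar : ∀ v ∈ K.verts, ∀ e, e ∈ K.star v ↔ G.Inc e v) (hloop : ∀ e u, ¬ G.IsLink e u u)
    {C : Finset β} (hC : K.IsCircuit C) : (G.ofEdges (C : Set β)).IsCircuitOf G where
  le :=
    { vertexSet_mono := by rintro x ⟨e, -, h⟩; exact h.vertex_mem
      isLink_mono := fun _ _ _ h => h.2 }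
  finite := by
    refine K.verts.finite_toSet.subset ?_
    rintro x ⟨e, -, h⟩
    exact (hverts x).2 h.vertex_mem
  connected := by
    constructor
    · obtain ⟨e, he⟩ := hC.nonempty
      obtain ⟨x, hx, _, _, _, h⟩ := FacedCubic.exists_ends (hC.even.1 he)
      exact ⟨x, e, he, (hstar x hx e).1 ((h x hx).2 (.inl rfl))⟩
    · rintro x ⟨e, he, hex⟩ y ⟨g, hg, hgy⟩
      -- The edges of the component of `x` in `C` form an even set, so by minimality they are all of
      -- `C`.
      set D := C.filter fun k => ∃ u, G.Inc k u ∧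
        Relation.ReflTransGen (G.ofEdges (C : Set β)).Adj x u with hD
      have hreach : ∀ k ∈ D, ∀ v, G.Inc k v →
          Relation.ReflTransGen (G.ofEdges (C : Set β)).Adj x v := by
        intro k hk v hkv
        obtain ⟨hkC, u, hku, hxu⟩ := Finset.mem_filter.1 hk
        by_cases huv : v = u
        · exact huv ▸ hxu
        · obtain ⟨w, hw⟩ := hku
          obtain rfl := hkv.eq_of_isLink_of_ne_left hw huv
          exact hxu.tail ⟨k, hkC, hw⟩
      have hDe : K.IsEven D := by
        refine ⟨(Finset.filter_subset _ _).trans hC.even.1, fun v hv => ?_⟩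
        by_cases hxv : Relation.ReflTransGen (G.ofEdges (C : Set β)).Adj x v
        · have : D ∩ K.star v = C ∩ K.star v := by
            ext k
            simp only [Finset.mem_inter, hD, Finset.mem_filter]
            exact ⟨fun h => ⟨h.1.1, h.2⟩, fun h => ⟨⟨h.1, v, (hstar v hv k).1 h.2, hxv⟩, h.2⟩⟩
          rw [this]
          exact hC.even.2 v hv
        · have : D ∩ K.star v = ∅ := by
            rw [Finset.eq_empty_iff_forall_notMem]
            intro k hk
            obtain ⟨hkD, hkv⟩ := Finset.mem_inter.1 hk
            exact hxv (hreach k hkD v ((hstar v hv k).1 hkv))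
          simp [this]
      have heD : e ∈ D := Finset.mem_filter.2 ⟨he, x, hex, .refl⟩
      have hDC := (hC.minimal D (Finset.filter_subset _ _) hDe).resolve_left
        (Finset.ne_empty_of_mem heD)
      exact hreach g (hDC ▸ hg) y hgy
  deg_eq_two := by
    rintro x ⟨e, he, hex⟩
    have hx : x ∈ K.verts := (hverts x).2 hex.vertex_mem
    have hl : (G.ofEdges (C : Set β)).loopSet x = ∅ := by
      ext k
      simp only [mem_loopSet, Set.mem_empty_iff_false, iff_false]
      exact fun h => hloop _ _ h.2
    have hi : (G.ofEdges (C : Set β)).incidenceSet x = (C ∩ K.star x : Finset β) := by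
      ext k
      simp only [mem_incidenceSet, ofEdges_inc, Finset.coe_inter, Set.mem_inter_iff,
        Finset.mem_coe, hstar x hx k]
    rw [deg, hl, hi, Set.encard_empty, add_zero, Set.encard_coe_eq_coe_finsetCard,
      hC.even.card_inter_star hx ⟨e, Finset.mem_inter.2 ⟨he, (hstar x hx e).2 hex⟩⟩]
    rfl

/-- Needed because `ncard` is zero on infinite sets. Every circuit has an edge, so no circuit occurs
more than twice, and the covers lie below twice the finite set of all circuits. -/
lemma finite_isCircuitDoubleCover (hV : V(G).Finite) (hE : E(G).Finite) :
    {𝒞 : Multiset (Graph α β) | G.IsCircuitDoubleCover 𝒞}.Finite := by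
  have hfin : {C : Graph α β | C.IsCircuitOf G}.Finite := by
    refine Set.Finite.of_finite_image (f := fun C : Graph α β => (V(C), E(C))) ?_ ?_
    · refine (hV.powerset.prod hE.powerset).subset ?_
      rintro _ ⟨C, hC, rfl⟩
      exact ⟨hC.le.vertexSet_mono, IsSubgraph.edgeSet_mono hC.le⟩
    · intro C hC C' hC' h
      simp only [Prod.mk.injEq] at h
      refine Graph.ext h.1 fun e x y => ?_
      constructor
      · intro hl
        exact (IsSubgraph.isLink_iff hC'.le (h.2 ▸ hl.edge_mem)).2 (hl.mono hC.le)
      · intro hl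
        exact (IsSubgraph.isLink_iff hC.le (h.2.symm ▸ hl.edge_mem)).2 (hl.mono hC'.le)
  refine (Set.finite_Iic (2 • hfin.toFinset.val)).subset ?_
  intro 𝒞 h𝒞
  rw [Set.mem_Iic, Multiset.le_iff_count]
  intro C
  by_cases hC : C ∈ 𝒞
  · have hCG := h𝒞.1 C hC
    obtain ⟨e, he⟩ : ∃ e, e ∈ E(C) := by
      obtain ⟨x, hx⟩ := hCG.connected.1
      have hd := hCG.deg_eq_two x hx
      by_contra! hcon
      have h1 : C.incidenceSet x = ∅ := by
        ext e
        simp only [mem_incidenceSet, Set.mem_empty_iff_false, iff_false]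
        exact fun h => hcon e h.edge_mem
      have h2 : C.loopSet x = ∅ :=
        Set.subset_empty_iff.1 ((C.loopSet_subset_incidenceSet x).trans h1.subset)
      rw [deg, h1, h2] at hd
      simp at hd
    have h2 := h𝒞.2 e (IsSubgraph.edgeSet_mono hCG.le he)
    have hle : Multiset.count C 𝒞 ≤ 2 := by
      rw [← h2, Multiset.count, Multiset.countP_eq_card_filter, Multiset.countP_eq_card_filter]
      refine Multiset.card_le_card (Multiset.monotone_filter_right _ fun C' h => ?_)
      exact h ▸ he
    rw [Multiset.count_nsmul, Multiset.count_eq_one_of_mem hfin.toFinset.nodup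
      (by simpa using hCG)]
    simpa using hle
  · rw [Multiset.count_eq_zero_of_notMem hC]
    exact Nat.zero_le _

/-- Circuit double covers by sets of edges give circuit double covers by subgraphs. -/
lemma card_cdcs_le_numCircuitDoubleCovers {K : FacedCubic α β Φ}
    (hverts : ∀ v, v ∈ K.verts ↔ v ∈ V(G)) (hedges : ∀ e, e ∈ K.edges ↔ e ∈ E(G))
    (hstar : ∀ v ∈ K.verts, ∀ e, e ∈ K.star v ↔ G.Inc e v) (hloop : ∀ e u, ¬ G.IsLink e u u) :
    K.cdcs.card ≤ G.numCircuitDoubleCovers := by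
  have hV : V(G).Finite := K.verts.finite_toSet.subset fun v hv => (hverts v).2 hv
  have hE : E(G).Finite := K.edges.finite_toSet.subset fun e he => (hedges e).2 he
  have hedge : ∀ {C : Finset β}, K.IsCircuit C → E(G.ofEdges (C : Set β)) = (C : Set β) :=
    fun hC => edgeSet_ofEdges fun e he => (hedges e).1 (hC.even.1 he)
  set f : Finset (Finset β) → Multiset (Graph α β) :=
    fun 𝒞 => 𝒞.val.map fun C : Finset β => G.ofEdges (C : Set β) with hf
  have hinj : Set.InjOn f K.cdcs := by
    intro 𝒞 h𝒞 𝒟 h𝒟 h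
    rw [Finset.mem_coe, FacedCubic.mem_cdcs] at h𝒞 h𝒟
    have key : ∀ ℰ : Finset (Finset β), K.IsCDC ℰ →
        (f ℰ).map (fun C => E(C)) = ℰ.val.map fun C : Finset β => (C : Set β) := by
      intro ℰ hℰ
      rw [hf, Multiset.map_map]
      exact Multiset.map_congr rfl fun C hC => hedge (hℰ.circuit C hC)
    have h2 := key 𝒞 h𝒞
    rw [h, key 𝒟 h𝒟] at h2
    exact (Finset.val_injective (Multiset.map_injective Finset.coe_injective h2)).symm
  rw [numCircuitDoubleCovers, ← Finset.card_image_of_injOn hinj, ← Set.ncard_coe_finset]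
  refine Set.ncard_le_ncard ?_ (finite_isCircuitDoubleCover hV hE)
  intro 𝒟 h𝒟
  obtain ⟨𝒞, h𝒞, rfl⟩ := Finset.mem_image.1 (Finset.mem_coe.1 h𝒟)
  rw [FacedCubic.mem_cdcs] at h𝒞
  constructor
  · intro C hC
    obtain ⟨C', hC', rfl⟩ := Multiset.mem_map.1 hC
    exact isCircuitOf_ofEdges hverts hstar hloop (h𝒞.circuit C' hC')
  · intro e he
    rw [Multiset.countP_map, ← h𝒞.card_eq e ((hedges e).2 he), Finset.card_def, Finset.filter_val]
    congr 1
    refine Multiset.filter_congr fun C hC => ?_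
    rw [hedge (h𝒞.circuit C hC), Finset.mem_coe]

end Graph

end

/-! ### The bound for embedded graphs -/

theorem theorem4p3 {α β F : Type*} (G : Graph α β)
    (hfin : V(G).Finite) (hconn : G.IsConnected) (hcubic : G.IsCubic) (hbridge : G.IsBridgeless)
    (hn : 4 ≤ V(G).ncard)
    (M : SurfaceEmbedding G F) (χ : ℤ) (hχ : M.eulerChar = χ) (hrep : 4 ≤ M.representativity) :
    (2 : ℝ) ^ (((V(G).ncard : ℝ) + 2 * (χ : ℝ)) ^ ((1 : ℝ) / 3) / 100) ≤
      (G.numCircuitDoubleCovers : ℝ) := by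
  classical
  have hE := hcubic.edgeSet_finite hfin
  have : Finite F := M.flag_finite hE
  have : Finite M.Face := Quot.finite _
  let _ : Fintype M.Face := Fintype.ofFinite _
  set K := M.facedCubic hconn hcubic hbridge hrep hfin.toFinset (by simp) hE.toFinset (by simp)
    with hK
  have hv : K.verts.card = V(G).ncard := (Set.ncard_eq_toFinset_card _ hfin).symm
  have he : K.edges.card = E(G).ncard := (Set.ncard_eq_toFinset_card _ hE).symm
  have hf : K.faces.card = Nat.card M.Face := by
    rw [Nat.card_eq_fintype_card]; rfl
  have h3 := K.three_mul_card_verts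
  -- Cubicity removes `n` and `|E|` from Euler's formula: `n + 2 * (n - |E| + f) = 2 * f`.
  have hsum : (V(G).ncard : ℝ) + 2 * (χ : ℝ) = 2 * (K.faces.card : ℝ) := by
    rw [← hχ, SurfaceEmbedding.eulerChar, ← hv, ← he, ← hf]
    have h3' : 3 * (K.verts.card : ℝ) = 2 * K.edges.card := by exact_mod_cast h3
    push_cast
    linarith
  rw [hsum]
  refine (K.two_rpow_le_card_cdcs (by omega)).trans ?_
  have hle : K.cdcs.card ≤ G.numCircuitDoubleCovers := by
    refine Graph.card_cdcs_le_numCircuitDoubleCovers (K := K) (fun v => hfin.mem_toFinset)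
      (fun e => hE.mem_toFinset) (fun v _ e => ?_) (hcubic.not_isLink_self hbridge)
    refine Finset.mem_filter.trans ⟨fun h => h.2, fun h => ⟨?_, h⟩⟩
    exact hE.mem_toFinset.2 h.edge_mem
  exact_mod_cast hle
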